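/- **Definitions.** Let $G$ be a finite simple graph with minimum degree $\delta(G)$. An $(s,t)$-bipartite-hole in $G$ is a pair of disjoint sets $S,T$ of vertices with $|S|=s$, $|T|=t$ and no edge of $G$ between $S$ and $T$. The bipartite-hole-number $\widetilde{\alpha}(G)$ is the least integer of the form $s+t-1$, with $s,t$ positive integers, such that $G$ contains no $(s,t)$-bipartite-hole. A *certificate* that $\widetilde{\alpha}(G)\ge k$ consists of pairs $(S_i,T_i)$, $i=1,\dots,\lfloor k/2\rfloor$, such that $(S_i,T_i)$ is an $(i,k-i)$-bipartite-hole in $G$; a certificate that $\widetilde{\alpha}(G)>x$, for a rational $x$, is a certificate that $\widetilde{\alpha}(G)\ge k$ for some non-negative integer $k>x$, given together with $k$. Running time is the number of steps on a unit-cost random access machine (structured programs, with addition, truncated subtraction, multiplication, integer division, comparison and indirect addressing) with words of $O(\log n)$ bits, where $n$ is the number of vertices of the input graph, which is given by $n$ and its adjacency matrix. **Theorem.** There is an algorithm that, on input a graph $G$ with $n\ge 3$ vertices, in $O(n^4)$ time outputs a non-negative integer $r$, a collection of $r$ pairwise edge-disjoint Hamilton cycles of $G$, and a certificate that $$\widetilde{\alpha}(G)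 > \frac{\delta(G)-3r}{r+1}$$ (so that, in particular, this inequality holds). -/

import Mathlib

/-! ## Bipartite holes -/

/-- `(S, T)` is an `(s, t)`-bipartite-hole of `G`: `S` and `T` are disjoint sets of `s` and `t`
vertices respectively, and no edge of `G` joins `S` to `T`. -/
structure IsBipartiteHole {V : Type*} (G : SimpleGraph V) (s t : ℕ) (S T : Finset V) : Prop where
  disjoint : Disjoint S T
  card_left : S.card = s
  card_right : T.card = t
  no_edge : ∀ u ∈ S, ∀ v ∈ T, ¬ G.Adj u v

/-- The bipartite-hole-number of a finite graph: the least `r` of the form `s + t - 1` with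
`s, t` positive such that `G` has no `(s, t)`-bipartite-hole. (The set is non-empty for a finite
graph, since `s = 1`, `t = |V|` qualifies when `V` is non-empty.) -/
noncomputable def bipartiteHoleNumber {V : Type*} (G : SimpleGraph V) : ℕ :=
  sInf {r : ℕ | ∃ s t : ℕ, 0 < s ∧ 0 < t ∧ r = s + t - 1 ∧
    ¬ ∃ S T : Finset V, IsBipartiteHole G s t S T}

/-- The pairs `(S i, T i)`, `i = 1, …, ⌊k/2⌋`, form a certificate that the bipartite-hole-number
of `G` is at least `k`: each `(S i, T i)` is an `(i, k - i)`-bipartite-hole. -/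
def IsHoleCertificate {V : Type*} (G : SimpleGraph V) (k : ℕ) (S T : ℕ → Finset V) : Prop :=
  ∀ i : ℕ, 1 ≤ i → i ≤ k / 2 → IsBipartiteHole G i (k - i) (S i) (T i)

/-! ## A random access machine with unit cost

A program acts on registers and on arrays of words. Which registers and which arrays an
instruction touches is fixed in the program; the position inside an array is the content of a
register (indirect addressing). Control flow is structured. Every instruction and every test
takes one unit of time. Words are natural numbers below a bound `W`; an arithmetic operation whose
result does not fit into a word has no execution, so that an overflowing run does not count. -/

namespace RAM

/-- A memory state: `reg x` is the content of register `x`, and `arr a p` is the content of the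
cell at position `p` of array `a`. -/
structure State where
  reg : ℕ → ℕ
  arr : ℕ → ℕ → ℕ

/-- `s` with register `x` set to `v`. -/
def State.setReg (s : State) (x v : ℕ) : State :=
  { s with reg := Function.update s.reg x v }

/-- `s` with the cell at position `p` of array `a` set to `v`. -/
def State.setArr (s : State) (a p v : ℕ) : State :=
  { s with arr := Function.update s.arr a (Function.update (s.arr a) p v) }

/-- The arithmetic operations. Subtraction is truncated at `0`, division is rounded down (and
division by `0` gives `0`). -/
inductive Op where
  | add
  | sub
  | mul
  | div

/-- The value of an arithmetic operation. -/
def Op.eval : Op → ℕ → ℕ → ℕ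
  | .add, u, v => u + v
  | .sub, u, v => u - v
  | .mul, u, v => u * v
  | .div, u, v => u / v

/-- Programs. -/
inductive Prog where
  /-- do nothing -/
  | skip
  /-- `reg x := c` -/
  | const (x c : ℕ)
  /-- `reg x := reg y o reg z` -/
  | arith (o : Op) (x y z : ℕ)
  /-- `reg x := arr a (reg y)` -/
  | load (x a y : ℕ)
  /-- `arr a (reg y) := reg x` -/
  | store (a y x : ℕ)
  /-- first `p`, then `q` -/
  | seq (p q : Prog)
  /-- if `reg x < reg y` then `p` else `q` -/
  | branch (x y : ℕ) (p q : Prog)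
  /-- while `reg x < reg y` do `p` -/
  | loop (x y : ℕ) (p : Prog)

/-- `Exec W P s s' t`: started in state `s`, the program `P` halts in state `s'` after exactly `t`
steps, and no arithmetic overflow (result at least `W`) occurs on the way. -/
inductive Exec (W : ℕ) : Prog → State → State → ℕ → Prop where
  | skip (s : State) : Exec W .skip s s 1
  | const (s : State) (x c : ℕ) (h : c < W) :
      Exec W (.const x c) s (s.setReg x c) 1
  | arith (s : State) (o : Op) (x y z : ℕ) (h : o.eval (s.reg y) (s.reg z) < W) :
      Exec W (.arith o x y z) s (s.setReg x (o.eval (s.reg y) (s.reg z))) 1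
  | load (s : State) (x a y : ℕ) :
      Exec W (.load x a y) s (s.setReg x (s.arr a (s.reg y))) 1
  | store (s : State) (a y x : ℕ) :
      Exec W (.store a y x) s (s.setArr a (s.reg y) (s.reg x)) 1
  | seq {p q : Prog} {s s' s'' : State} {t t' : ℕ}
      (hp : Exec W p s s' t) (hq : Exec W q s' s'' t') :
      Exec W (.seq p q) s s'' (t + t')
  | branch_true {x y : ℕ} {p q : Prog} {s s' : State} {t : ℕ}
      (h : s.reg x < s.reg y) (hp : Exec W p s s' t) :
      Exec W (.branch x y p q) s s' (t + 1)
  | branch_false {x y : ℕ} {p q : Prog} {s s' : State} {t : ℕ}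
      (h : ¬ s.reg x < s.reg y) (hq : Exec W q s s' t) :
      Exec W (.branch x y p q) s s' (t + 1)
  | loop_true {x y : ℕ} {p : Prog} {s s' s'' : State} {t t' : ℕ}
      (h : s.reg x < s.reg y) (hp : Exec W p s s' t) (hl : Exec W (.loop x y p) s' s'' t') :
      Exec W (.loop x y p) s s'' (t + t' + 1)
  | loop_false {x y : ℕ} {p : Prog} {s : State}
      (h : ¬ s.reg x < s.reg y) :
      Exec W (.loop x y p) s s 1

open Classical in
/-- The initial state for the input graph `G` on the vertices `0, …, n - 1`: register `0` holds
`n`, array `0` holds the adjacency matrix of `G` row by row, and everything else is `0`. -/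
noncomputable def input {n : ℕ} (G : SimpleGraph (Fin n)) : State where
  reg x := if x = 0 then n else 0
  arr a p := if a = 0 ∧ ∃ i j : Fin n, p = n * i + j ∧ G.Adj i j then 1 else 0

/-- The set of vertices whose characteristic vector is row `i` of array `a`, the rows having
length `n`. -/
def State.vertexSet (s : State) (n a i : ℕ) : Finset (Fin n) :=
  Finset.univ.filter fun v : Fin n => s.arr a (n * i + v) = 1

/-- In state `s`, the `n` entries of row `i` of array `a` (the rows having length `n`) are
the successive vertices of the closed walk `w`, beginning with its base point. -/
def State.ListsCycle (s : State) {n : ℕ} (a i : ℕ) {G : SimpleGraph (Fin n)} {v : Fin n}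
    (w : G.Walk v v) : Prop :=
  ∀ j : Fin n, s.arr a (n * i + j) = (w.getVert j : ℕ)

end RAM

/-!
The proof has a combinatorial part, a description of the algorithm as a command in a small language
of bounded loops, and a compilation of that language to the random access machine.

**Combinatorics.** Let `A` be a graph all of whose degrees are at least `d`. A path in `A` is
lengthened greedily: if its ends are not adjacent, one tries to close it to a cycle by reversing an
initial and a final segment, which takes a neighbor of the first vertex at position `a`, a neighbor
of the last vertex at position `b`, and one further edge (`CanCloseOutward` for `a ≤ b`,
`CanCloseCrossing` for `b < a`); a cycle that misses a neighbor of one of its vertices is opened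
there (`CanLeave`); and an end with a neighbor outside the path is extended. By `round_of_moves`,
one round of such moves either lengthens the path or leaves it `Stuck`, so after `n` rounds the path
is stuck. Now it is either a Hamilton cycle, or `Stuck.exists_hole` applies: as the further edge is
missing for all `a` and `b`, the vertices just before the first `i` neighbors of one end of the path
and a suitable set of `d + 1 - i` vertices form a bipartite-hole of `A`.

The Hamilton cycles found are removed one by one. After `r` of them the degrees have dropped by at
most `2 r`, so that `d = D - 2 r`, where `D` is the minimum degree of the input graph. A hole of the
remaining graph with a left side of `i` vertices loses at most `2 r i` vertices of its right side
when the removed edges are put back (`Stuck.exists_le_count_free`). For the size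
`K = ⌊(D - 3 r) / (r + 1)⌋ + 1` of the certificate and `2 i ≤ K`, what is left has at least `K - i`
vertices, because `(r + 1) K ≤ d + 1` (`Failed.eval_certificate`). If `D < 3 r`, then `K = 0`
will do. The left sides are determined by the path alone, so the algorithm need not search for a
hole: for each `i` it tries the two ends of the path and collects the vertices that can be on the
right side. Finally, a certificate bounds the bipartite-hole-number, since an
`(i, k - i)`-bipartite-hole contains an `(s, t)`-bipartite-hole, or its mirror image, whenever
`s + t ≤ k` and `i` is one of `s` and `t`.

**Running time.** In the language of `RAM.Cmd` every loop makes exactly `n` rounds, and apart from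
addresses of array cells there is no arithmetic that lets a value grow faster than the running time.
So `RAM.Cmd.cost` bounds both the running time of the compiled command and the growth of the words
in the memory, which is how `RAM.Cmd.run_compile` excludes overflow, and a command with loops nested
at most `m` deep takes time `O(n ^ m)` on words of `O(log n)` bits (`RAM.Cmd.exists_prog`). Four
nested loops suffice: at most `n` searches for a Hamilton cycle, `n` rounds in each of them, and all
pairs of positions in each round. What `RAM.algorithm` computes is stated in `RAM.eval_algorithm`.
-/

/-! ### A language of bounded loops and its compilation -/

namespace RAM

/-- Arithmetic expressions over the variables and arrays of a `State`. `size` is the number `n` of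
vertices, and `get a i j` is the entry in row `i` and column `j` of array `a`, the rows having
length `n`. There is no addition or multiplication beyond the implicit address computation, so an
expression exceeds the values it reads by at most a constant. -/
inductive Exp where
  | size
  | const (c : ℕ)
  | var (x : ℕ)
  | succ (e : Exp)
  | sub (e f : Exp)
  | div (e f : Exp)
  | get (a : ℕ) (i j : Exp)

/-- Tests. -/
inductive Test where
  | lt (e f : Exp)
  | and (b c : Test)
  | not (b : Test)

/-- Commands. The only loop is `forEach x p`, which runs `p` with `x = 0, …, n - 1`. -/
inductive Cmd where
  | skip
  | assign (x : ℕ) (e : Exp)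
  | put (a : ℕ) (i j e : Exp)
  | seq (p q : Cmd)
  | ite (b : Test) (p q : Cmd)
  | forEach (x : ℕ) (p : Cmd)

/-- The value of an expression. -/
def Exp.eval (n : ℕ) (h : State) : Exp → ℕ
  | .size => n
  | .const c => c
  | .var x => h.reg x
  | .succ e => e.eval n h + 1
  | .sub e f => e.eval n h - f.eval n h
  | .div e f => e.eval n h / f.eval n h
  | .get a i j => h.arr a (n * i.eval n h + j.eval n h)

/-- The truth value of a test. -/
def Test.Holds (n : ℕ) (h : State) : Test → Prop
  | .lt e f => e.eval n h < f.eval n h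
  | .and b c => b.Holds n h ∧ c.Holds n h
  | .not b => ¬ b.Holds n h

/-- The state after `k` rounds of `f`, the rounds being numbered from `0`. -/
def iter (f : ℕ → State → State) : ℕ → State → State
  | 0, h => h
  | k + 1, h => f k (iter f k h)

open Classical in
/-- The state in which a command ends. -/
noncomputable def Cmd.eval (n : ℕ) : Cmd → State → State
  | .skip, h => h
  | .assign x e, h => h.setReg x (e.eval n h)
  | .put a i j e, h => h.setArr a (n * i.eval n h + j.eval n h) (e.eval n h)
  | .seq p q, h => q.eval n (p.eval n h)
  | .ite b p q, h => if b.Holds n h then p.eval n h else q.eval n h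
  | .forEach x p, h => iter (fun k h => p.eval n (h.setReg x k)) n h

/-- The running time of the compiled expression; it also bounds by how much the value of the
expression exceeds the values it reads. -/
def Exp.cost : Exp → ℕ
  | .size => 2
  | .const c => c + 1
  | .var _ => 2
  | .succ e => e.cost + 2
  | .sub e f => e.cost + f.cost + 1
  | .div e f => e.cost + f.cost + 1
  | .get _ i j => i.cost + j.cost + 3

/-- A bound for the running time of the compiled test. -/
def Test.cost : Test → ℕ
  | .lt e f => e.cost + f.cost + 1
  | .and b c => b.cost + c.cost
  | .not b => b.cost

/-- A bound for the running time of the compiled command and for the growth of the values in the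
memory during its execution. -/
def Cmd.cost (n : ℕ) : Cmd → ℕ
  | .skip => 1
  | .assign _ e => e.cost + 2
  | .put _ i j e => i.cost + j.cost + e.cost + 3
  | .seq p q => p.cost n + q.cost n
  | .ite b p q => b.cost + p.cost n + q.cost n
  | .forEach _ p => n * (p.cost n + 5) + 2

/-- The scratch registers are odd. Register `1` holds `n`, and the variables are kept in the even
registers. -/
def scratch (d : ℕ) : ℕ := 2 * d + 3

/-- The program that puts the value of an expression into scratch register `d`, using no scratch
register below `d`. -/
def Exp.compile : Exp → ℕ → Prog
  | .size, d => .seq (.const (scratch d) 0) (.arith .add (scratch d) (scratch d) 1)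
  | .const c, d => .const (scratch d) c
  | .var x, d => .seq (.const (scratch d) 0) (.arith .add (scratch d) (scratch d) (2 * x))
  | .succ e, d => .seq (e.compile d) (.seq (.const (scratch (d + 1)) 1)
      (.arith .add (scratch d) (scratch d) (scratch (d + 1))))
  | .sub e f, d => .seq (e.compile d) (.seq (f.compile (d + 1))
      (.arith .sub (scratch d) (scratch d) (scratch (d + 1))))
  | .div e f, d => .seq (e.compile d) (.seq (f.compile (d + 1))
      (.arith .div (scratch d) (scratch d) (scratch (d + 1))))
  | .get a i j, d => .seq (i.compile d) (.seq (j.compile (d + 1))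
      (.seq (.arith .mul (scratch d) 1 (scratch d))
      (.seq (.arith .add (scratch d) (scratch d) (scratch (d + 1)))
      (.load (scratch d) a (scratch d)))))

/-- The program that continues with `p` or with `q` according to a test. -/
def Test.compile : Test → ℕ → Prog → Prog → Prog
  | .lt e f, d, p, q => .seq (e.compile d) (.seq (f.compile (d + 1))
      (.branch (scratch d) (scratch (d + 1)) p q))
  | .and b c, d, p, q => b.compile d (c.compile d p q) q
  | .not b, d, p, q => b.compile d q p

/-- The program for a command; it uses no scratch register below `d`. A loop keeps its counter in
scratch register `d` and copies it to the loop variable at the start of each round. -/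
def Cmd.compile : Cmd → ℕ → Prog
  | .skip, _ => .skip
  | .assign x e, d => .seq (e.compile d) (.seq (.const (scratch (d + 1)) 0)
      (.arith .add (2 * x) (scratch d) (scratch (d + 1))))
  | .put a i j e, d => .seq (i.compile d) (.seq (j.compile (d + 1)) (.seq (e.compile (d + 2))
      (.seq (.arith .mul (scratch d) 1 (scratch d))
      (.seq (.arith .add (scratch d) (scratch d) (scratch (d + 1)))
      (.store a (scratch d) (scratch (d + 2)))))))
  | .seq p q, d => .seq (p.compile d) (q.compile d)
  | .ite b p q, d => b.compile d (p.compile d) (q.compile d)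
  | .forEach x p, d => .seq (.const (scratch d) 0) (.loop (scratch d) 1
      (.seq (.const (2 * x) 0) (.seq (.arith .add (2 * x) (2 * x) (scratch d))
      (.seq (p.compile (d + 1)) (.seq (.const (scratch (d + 1)) 1)
      (.arith .add (scratch d) (scratch d) (scratch (d + 1))))))))

/-- The machine state `s` represents the state `h` of the language. -/
structure Represents (n : ℕ) (h s : State) : Prop where
  size : s.reg 1 = n
  reg : ∀ x, s.reg (2 * x) = h.reg x
  arr : s.arr = h.arr

/-- All values in the memory are at most `M`. -/
structure State.BoundedBy (h : State) (M : ℕ) : Prop where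
  reg : ∀ x, h.reg x ≤ M
  arr : ∀ a p, h.arr a p ≤ M

lemma State.BoundedBy.mono {h : State} {M M' : ℕ} (hb : h.BoundedBy M) (hM : M ≤ M') :
    h.BoundedBy M' :=
  ⟨fun x => (hb.reg x).trans hM, fun a p => (hb.arr a p).trans hM⟩

/-- The scratch registers below `d` agree. -/
def SameBelow (d : ℕ) (s s' : State) : Prop :=
  ∀ d' < d, s'.reg (scratch d') = s.reg (scratch d')

lemma SameBelow.refl (d : ℕ) (s : State) : SameBelow d s s := fun _ _ => rfl

lemma SameBelow.trans {d : ℕ} {s s' s'' : State} (h : SameBelow d s s') (h' : SameBelow d s' s'') :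
    SameBelow d s s'' := fun d' hd => (h' d' hd).trans (h d' hd)

lemma SameBelow.mono {d e : ℕ} {s s' : State} (h : SameBelow e s s') (hd : d ≤ e) :
    SameBelow d s s' := fun d' hd' => h d' (hd'.trans_le hd)

@[simp] lemma setReg_reg (s : State) (x v y : ℕ) :
    (s.setReg x v).reg y = if y = x then v else s.reg y := by
  simp [State.setReg, Function.update_apply]

@[simp] lemma setReg_arr (s : State) (x v : ℕ) : (s.setReg x v).arr = s.arr := rfl

@[simp] lemma setArr_reg (s : State) (a p v : ℕ) : (s.setArr a p v).reg = s.reg := rfl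

@[simp] lemma setArr_arr (s : State) (a p v b q : ℕ) :
    (s.setArr a p v).arr b q = if b = a ∧ q = p then v else s.arr b q := by
  simp only [State.setArr, Function.update_apply]
  split_ifs <;> simp_all

lemma scratch_ne_two_mul (d x : ℕ) : scratch d ≠ 2 * x := by unfold scratch; omega

lemma two_mul_ne_scratch (d x : ℕ) : 2 * x ≠ scratch d := by unfold scratch; omega

lemma scratch_inj {d e : ℕ} : scratch d = scratch e ↔ d = e := by unfold scratch; omega

lemma one_ne_scratch (d : ℕ) : 1 ≠ scratch d := by unfold scratch; omega

lemma Represents.setScratch {n : ℕ} {h s : State} (hr : Represents n h s) (d v : ℕ) :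
    Represents n h (s.setReg (scratch d) v) where
  size := by simp [one_ne_scratch, hr.size]
  reg x := by simp [two_mul_ne_scratch, hr.reg]
  arr := by simp [hr.arr]

lemma Represents.setVar {n : ℕ} {h s : State} (hr : Represents n h s) (x v : ℕ) :
    Represents n (h.setReg x v) (s.setReg (2 * x) v) where
  size := by
    have : 1 ≠ 2 * x := by omega
    simp [this, hr.size]
  reg y := by simp [hr.reg]
  arr := by simp [hr.arr]

lemma sameBelow_setScratch {d e : ℕ} (hd : d ≤ e) (s : State) (v : ℕ) :
    SameBelow d s (s.setReg (scratch e) v) := by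
  intro d' hd'
  have : d' ≠ e := by omega
  simp [scratch_inj, this]

lemma sameBelow_setVar (d : ℕ) (s : State) (x v : ℕ) :
    SameBelow d s (s.setReg (2 * x) v) := by
  intro d' _
  simp [scratch_ne_two_mul]

/-- Started in `s`, the program `P` halts within `T` steps in a state that satisfies `Q`. -/
def Run (W : ℕ) (P : Prog) (s : State) (T : ℕ) (Q : State → Prop) : Prop :=
  ∃ s' t, Exec W P s s' t ∧ t ≤ T ∧ Q s'

section Run

variable {W x y T T' : ℕ} {p q : Prog} {s : State} {Q Q' : State → Prop}

lemma Run.imp (h : Run W p s T Q) (hT : T ≤ T') (hQ : ∀ s', Q s' → Q' s') : Run W p s T' Q' := by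
  obtain ⟨s', t, he, ht, hq⟩ := h
  exact ⟨s', t, he, ht.trans hT, hQ _ hq⟩

lemma Run.seq (h : Run W p s T fun s' => Run W q s' T' Q) : Run W (.seq p q) s (T + T') Q := by
  obtain ⟨s', t, he, ht, s'', t', he', ht', hq⟩ := h
  exact ⟨s'', _, .seq he he', by omega, hq⟩

lemma Run.skip (h : Q s) : Run W .skip s 1 Q := ⟨s, _, .skip s, le_rfl, h⟩

lemma Run.const {c : ℕ} (hc : c < W) (h : Q (s.setReg x c)) : Run W (.const x c) s 1 Q :=
  ⟨_, _, .const s x c hc, le_rfl, h⟩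

lemma Run.arith {o : Op} {z : ℕ} {u v : ℕ} (hy : s.reg y = u) (hz : s.reg z = v)
    (ho : o.eval u v < W) (h : Q (s.setReg x (o.eval u v))) :
    Run W (.arith o x y z) s 1 Q := by
  subst hy hz
  exact ⟨_, _, .arith s o x y z ho, le_rfl, h⟩

lemma Run.load {a : ℕ} (h : Q (s.setReg x (s.arr a (s.reg y)))) : Run W (.load x a y) s 1 Q :=
  ⟨_, _, .load s x a y, le_rfl, h⟩

lemma Run.store {a : ℕ} (h : Q (s.setArr a (s.reg y) (s.reg x))) :
    Run W (.store a y x) s 1 Q :=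
  ⟨_, _, .store s a y x, le_rfl, h⟩

lemma Run.branch_true (hxy : s.reg x < s.reg y) (h : Run W p s T Q) :
    Run W (.branch x y p q) s (T + 1) Q := by
  obtain ⟨s', t, he, ht, hq⟩ := h
  exact ⟨s', _, .branch_true hxy he, by omega, hq⟩

lemma Run.branch_false (hxy : ¬ s.reg x < s.reg y) (h : Run W q s T Q) :
    Run W (.branch x y p q) s (T + 1) Q := by
  obtain ⟨s', t, he, ht, hq⟩ := h
  exact ⟨s', _, .branch_false hxy he, by omega, hq⟩

lemma Run.loop_true (hxy : s.reg x < s.reg y)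
    (h : Run W p s T fun s' => Run W (.loop x y p) s' T' Q) :
    Run W (.loop x y p) s (T + T' + 1) Q := by
  obtain ⟨s', t, he, ht, s'', t', he', ht', hq⟩ := h
  exact ⟨s'', _, .loop_true hxy he he', by omega, hq⟩

lemma Run.loop_false (hxy : ¬ s.reg x < s.reg y) (h : Q s) : Run W (.loop x y p) s 1 Q :=
  ⟨_, _, .loop_false hxy, le_rfl, h⟩

end Run

lemma Exp.eval_le {n M : ℕ} {h : State} (hb : h.BoundedBy M) (hn : n ≤ M) (e : Exp) :
    e.eval n h ≤ M + e.cost := by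
  induction e with
  | size => simp only [eval]; omega
  | const c => simp only [eval, cost]; omega
  | var x => simp only [eval]; exact (hb.reg x).trans (by omega)
  | succ e ih => simp only [eval, cost]; omega
  | sub e f ih _ => simp only [eval, cost]; omega
  | div e f ih _ => simp only [eval, cost]; exact (Nat.div_le_self _ _).trans (by omega)
  | get a i j => simp only [eval]; exact (hb.arr _ _).trans (by omega)

lemma address_lt {n W B u v : ℕ} (hW : (n + 1) * B < W) (hu : u ≤ B) (hv : v ≤ B) :
    n * u + v < W := by
  have : n * u ≤ n * B := Nat.mul_le_mul_left _ hu
  rw [Nat.add_mul, Nat.one_mul] at hW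
  omega

lemma lt_of_succ_mul_lt {n W B u : ℕ} (hW : (n + 1) * B < W) (hu : u ≤ B) : u < W := by
  have := address_lt (n := n) (u := 0) hW (Nat.zero_le _) hu
  simpa using this

/-- `s'` still represents `h`, the scratch registers below `d` are as in `s`, and the value `v` has
been put into scratch register `d`. -/
structure HasValue (n : ℕ) (h s : State) (d v : ℕ) (s' : State) : Prop where
  rep : Represents n h s'
  below : SameBelow d s s'
  value : s'.reg (scratch d) = v

lemma HasValue.set {n d v w : ℕ} {h s s' : State} (hv : HasValue n h s d v s') :
    HasValue n h s d w (s'.setReg (scratch d) w) :=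
  ⟨hv.rep.setScratch _ _, hv.below.trans (sameBelow_setScratch le_rfl _ _), by simp⟩

lemma HasValue.next {n d u v : ℕ} {h s s₁ s₂ : State} (h₁ : HasValue n h s d u s₁)
    (h₂ : HasValue n h s₁ (d + 1) v s₂) : HasValue n h s d u s₂ :=
  ⟨h₂.rep, h₁.below.trans (h₂.below.mono (by omega)),
    (h₂.below d (by omega)).trans h₁.value⟩

/-- The compiled expression computes the value of the expression, within its cost and without
overflow, as the words can hold the address of any array cell that it may read. -/
lemma Exp.run_compile {n W M : ℕ} {h : State} (hb : h.BoundedBy M) (hn : n ≤ M) (e : Exp) :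
    ∀ (d : ℕ) (s : State), Represents n h s → (n + 1) * (M + e.cost) < W →
      Run W (e.compile d) s e.cost (HasValue n h s d (e.eval n h)) := by
  have weaken {B C : ℕ} (hBC : B ≤ C) (hC : (n + 1) * (M + C) < W) : (n + 1) * (M + B) < W :=
    (Nat.mul_le_mul_left _ (by omega)).trans_lt hC
  have init {s : State} (hr : Represents n h s) (d v : ℕ) :
      HasValue n h s d v (s.setReg (scratch d) v) :=
    ⟨hr.setScratch _ _, sameBelow_setScratch le_rfl _ _, by simp⟩
  induction e with
  | size =>
    intro d s hr hW
    refine Run.seq (Run.const (by omega) (Run.arith (u := 0) (v := n) (by simp) ?_ ?_ ?_))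
    · simp [one_ne_scratch, hr.size]
    · simpa [Op.eval] using lt_of_succ_mul_lt (u := n) hW (by omega)
    · simpa [Op.eval, eval] using (init hr d 0).set
  | const c =>
    intro d s hr hW
    refine (Run.const (lt_of_succ_mul_lt hW ?_) (init hr d c)).imp ?_ fun _ => id <;>
      simp only [cost] <;> omega
  | var x =>
    intro d s hr hW
    refine Run.seq (Run.const (by omega) (Run.arith (u := 0) (v := h.reg x) (by simp) ?_ ?_ ?_))
    · simp [two_mul_ne_scratch, hr.reg]
    · simpa [Op.eval] using lt_of_succ_mul_lt (u := h.reg x) hW ((hb.reg x).trans (by omega))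
    · simpa [Op.eval, eval] using (init hr d 0).set
  | succ e ih =>
    intro d s hr hW
    have he := Exp.eval_le hb hn e
    simp only [cost] at hW ⊢
    refine Run.seq (T' := 1 + 1) ((ih d s hr (weaken (by omega) hW)).imp le_rfl fun s₁ h₁ => ?_)
    have hn := h₁.next (init h₁.rep (d + 1) 1)
    refine Run.seq (Run.const (lt_of_succ_mul_lt hW (by omega))
      (Run.arith (u := e.eval n h) (v := 1) hn.value (by simp) ?_ hn.set))
    exact lt_of_succ_mul_lt hW (by simp only [Op.eval]; omega)
  | sub e f ihe ihf =>
    intro d s hr hW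
    have he := Exp.eval_le hb hn e
    simp only [cost] at hW ⊢
    rw [Nat.add_assoc]
    refine Run.seq ((ihe d s hr (weaken (by omega) hW)).imp le_rfl fun s₁ h₁ => ?_)
    refine Run.seq ((ihf (d + 1) s₁ h₁.rep (weaken (by omega) hW)).imp le_rfl fun s₂ h₂ => ?_)
    refine Run.arith (h₁.next h₂).value h₂.value ?_ (h₁.next h₂).set
    exact lt_of_succ_mul_lt hW (by simp only [Op.eval]; omega)
  | div e f ihe ihf =>
    intro d s hr hW
    have he := Exp.eval_le hb hn e
    simp only [cost] at hW ⊢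
    rw [Nat.add_assoc]
    refine Run.seq ((ihe d s hr (weaken (by omega) hW)).imp le_rfl fun s₁ h₁ => ?_)
    refine Run.seq ((ihf (d + 1) s₁ h₁.rep (weaken (by omega) hW)).imp le_rfl fun s₂ h₂ => ?_)
    refine Run.arith (h₁.next h₂).value h₂.value ?_ (h₁.next h₂).set
    exact lt_of_succ_mul_lt hW ((Nat.div_le_self _ _).trans (by omega))
  | get a i j ihi ihj =>
    intro d s hr hW
    have hi := Exp.eval_le hb hn i
    have hj := Exp.eval_le hb hn j
    simp only [cost] at hW ⊢
    have hij := address_lt hW (u := i.eval n h) (v := j.eval n h) (by omega) (by omega)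
    rw [Nat.add_assoc, show 3 = 1 + (1 + 1) from rfl]
    refine Run.seq ((ihi d s hr (weaken (by omega) hW)).imp le_rfl fun s₁ h₁ => ?_)
    refine Run.seq ((ihj (d + 1) s₁ h₁.rep (weaken (by omega) hW)).imp le_rfl fun s₂ h₂ => ?_)
    have h₃ := h₁.next h₂
    refine Run.seq (Run.arith h₂.rep.size h₃.value (by simp only [Op.eval]; omega) ?_)
    refine Run.seq (Run.arith (u := n * i.eval n h) (v := j.eval n h) ?_ ?_ hij (Run.load ?_))
    · simp [Op.eval]
    · simp [scratch_inj, h₂.value]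
    · have h₄ := h₃.set (w := n * i.eval n h)
      have h₅ := h₄.set (w := n * i.eval n h + j.eval n h)
      have h₆ := h₅.set (w := h.arr a (n * i.eval n h + j.eval n h))
      simpa [Op.eval, eval, h₂.rep.arr] using h₆

/-- Running a compiled test leads, within the cost of the test, to the branch that the truth value
selects. -/
lemma Test.run_compile {n W M T d : ℕ} {h : State} (hb : h.BoundedBy M) (hn : n ≤ M) (b : Test) :
    ∀ {p q : Prog} {Q : State → Prop} {s : State}, Represents n h s →
      (n + 1) * (M + b.cost) < W →
      (∀ s', Represents n h s' → SameBelow d s s' → b.Holds n h → Run W p s' T Q) →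
      (∀ s', Represents n h s' → SameBelow d s s' → ¬ b.Holds n h → Run W q s' T Q) →
      Run W (b.compile d p q) s (b.cost + T) Q := by
  have weaken {B C : ℕ} (hBC : B ≤ C) (hC : (n + 1) * (M + C) < W) : (n + 1) * (M + B) < W :=
    (Nat.mul_le_mul_left _ (by omega)).trans_lt hC
  induction b generalizing T with
  | lt e f =>
    intro p q Q s hr hW hp hq
    simp only [cost] at hW ⊢
    rw [show e.cost + f.cost + 1 + T = e.cost + (f.cost + (T + 1)) by omega]
    refine Run.seq ((e.run_compile hb hn d s hr (weaken (by omega) hW)).imp le_rfl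
      fun s₁ h₁ => ?_)
    refine Run.seq ((f.run_compile hb hn (d + 1) s₁ h₁.rep (weaken (by omega) hW)).imp le_rfl
      fun s₂ h₂ => ?_)
    have h₃ := h₁.next h₂
    by_cases hlt : e.eval n h < f.eval n h
    · refine Run.branch_true ?_ (hp s₂ h₃.rep h₃.below hlt)
      rwa [h₃.value, h₂.value]
    · refine Run.branch_false ?_ (hq s₂ h₃.rep h₃.below hlt)
      rwa [h₃.value, h₂.value]
  | and b c ihb ihc =>
    intro p q Q s hr hW hp hq
    simp only [cost] at hW ⊢
    rw [Nat.add_assoc]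
    refine ihb hr (weaken (by omega) hW) (fun s₁ h₁ hs₁ hb₁ => ?_) (fun s₁ h₁ hs₁ hb₁ => ?_)
    · exact ihc h₁ (weaken (by omega) hW)
        (fun s₂ h₂ hs₂ hc₂ => hp s₂ h₂ (hs₁.trans hs₂) ⟨hb₁, hc₂⟩)
        (fun s₂ h₂ hs₂ hc₂ => hq s₂ h₂ (hs₁.trans hs₂) fun hbc => hc₂ hbc.2)
    · exact (hq s₁ h₁ hs₁ fun hbc => hb₁ hbc.1).imp (by omega) fun _ => id
  | not b ih =>
    intro p q Q s hr hW hp hq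
    exact ih hr hW (fun s₁ h₁ hs₁ hb₁ => hq s₁ h₁ hs₁ fun hnb => hnb hb₁)
      (fun s₁ h₁ hs₁ hb₁ => hp s₁ h₁ hs₁ hb₁)

lemma State.BoundedBy.setReg {h : State} {M x v : ℕ} (hb : h.BoundedBy M) (hv : v ≤ M) :
    (h.setReg x v).BoundedBy M where
  reg y := by
    rw [setReg_reg]
    split_ifs
    exacts [hv, hb.reg y]
  arr := hb.arr

lemma State.BoundedBy.setArr {h : State} {M a p v : ℕ} (hb : h.BoundedBy M) (hv : v ≤ M) :
    (h.setArr a p v).BoundedBy M where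
  reg := hb.reg
  arr b q := by
    rw [setArr_arr]
    split_ifs
    exacts [hv, hb.arr b q]

/-- The values in the memory grow by at most the cost of the command. -/
lemma Cmd.boundedBy_eval {n : ℕ} (p : Cmd) : ∀ {M : ℕ} {h : State}, h.BoundedBy M → n ≤ M →
    (p.eval n h).BoundedBy (M + p.cost n) := by
  induction p with
  | skip => exact fun hb _ => hb.mono (by omega)
  | assign x e =>
    intro M h hb hn
    exact (hb.mono (by omega)).setReg ((e.eval_le hb hn).trans (by simp only [cost]; omega))
  | put a i j e =>
    intro M h hb hn
    exact (hb.mono (by omega)).setArr ((e.eval_le hb hn).trans (by simp only [cost]; omega))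
  | seq p q ihp ihq =>
    intro M h hb hn
    exact (ihq (ihp hb hn) (by omega)).mono (by simp only [cost]; omega)
  | ite b p q ihp ihq =>
    intro M h hb hn
    simp only [eval]
    split_ifs
    · exact (ihp hb hn).mono (by simp only [cost]; omega)
    · exact (ihq hb hn).mono (by simp only [cost]; omega)
  | forEach x p ih =>
    intro M h hb hn
    have key : ∀ k ≤ n, (iter (fun k h => p.eval n (h.setReg x k)) k h).BoundedBy
        (M + k * (p.cost n + 5)) := by
      intro k
      induction k with
      | zero => intro _; simpa [iter] using hb
      | succ k ihk =>
        intro hk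
        refine (ih ((ihk (by omega)).setReg (v := k) (by omega)) (by omega)).mono ?_
        rw [Nat.succ_mul]
        omega
    exact (key n le_rfl).mono (by simp only [cost]; omega)

/-- The compiled command simulates the command, within its cost and without overflow. -/
lemma Cmd.run_compile {n W : ℕ} (p : Cmd) : ∀ {M d : ℕ} {h s : State}, h.BoundedBy M → n ≤ M →
    Represents n h s → (n + 1) * (M + p.cost n) < W →
      Run W (p.compile d) s (p.cost n) fun s' =>
        Represents n (p.eval n h) s' ∧ SameBelow d s s' := by
  have weaken {B C : ℕ} (hBC : B ≤ C) (hC : (n + 1) * C < W) : (n + 1) * B < W :=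
    (Nat.mul_le_mul_left _ hBC).trans_lt hC
  induction p with
  | skip => exact fun _ _ hr _ => Run.skip ⟨hr, SameBelow.refl _ _⟩
  | assign x e =>
    intro M d h s hb hn hr hW
    simp only [cost] at hW ⊢
    refine Run.seq (T' := 1 + 1) ((e.run_compile hb hn d s hr (weaken (by omega) hW)).imp le_rfl
      fun s₁ h₁ => ?_)
    refine Run.seq (Run.const (by omega)
      (Run.arith (u := e.eval n h) (v := 0) ?_ (by simp) ?_ ⟨?_, ?_⟩))
    · simp [scratch_inj, h₁.value]
    · exact lt_of_succ_mul_lt hW ((e.eval_le hb hn).trans (by omega))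
    · exact (h₁.rep.setScratch _ _).setVar _ _
    · exact (h₁.below.trans (sameBelow_setScratch (by omega) _ _)).trans
        (sameBelow_setVar _ _ _ _)
  | put a i j e =>
    intro M d h s hb hn hr hW
    have hi := Exp.eval_le hb hn i
    have hj := Exp.eval_le hb hn j
    simp only [cost] at hW ⊢
    have hij := address_lt hW (u := i.eval n h) (v := j.eval n h) (by omega) (by omega)
    rw [Nat.add_assoc, Nat.add_assoc, show 3 = 1 + (1 + 1) from rfl]
    refine Run.seq ((i.run_compile hb hn d s hr (weaken (by omega) hW)).imp le_rfl
      fun s₁ h₁ => ?_)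
    refine Run.seq ((j.run_compile hb hn (d + 1) s₁ h₁.rep (weaken (by omega) hW)).imp le_rfl
      fun s₂ h₂ => ?_)
    refine Run.seq ((e.run_compile hb hn (d + 2) s₂ h₂.rep (weaken (by omega) hW)).imp le_rfl
      fun s₃ h₃ => ?_)
    have h₃' := h₂.next h₃
    have h₄ := h₁.next h₃'
    refine Run.seq (Run.arith h₄.rep.size h₄.value (by simp only [Op.eval]; omega) ?_)
    refine Run.seq (Run.arith (u := n * i.eval n h) (v := j.eval n h) ?_ ?_ hij (Run.store ?_))
    · simp [Op.eval]
    · simp [scratch_inj, h₃'.value]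
    · have h₅ := (h₄.set (w := n * i.eval n h)).set (w := n * i.eval n h + j.eval n h)
      have hne : d + 2 ≠ d := by omega
      simp only [Op.eval, setReg_reg, scratch_inj, if_true, hne, if_false, h₃.value]
      refine ⟨⟨h₅.rep.size, h₅.rep.reg, ?_⟩, h₅.below⟩
      simp [State.setArr, eval, h₃.rep.arr]
  | seq p q ihp ihq =>
    intro M d h s hb hn hr hW
    simp only [cost] at hW ⊢
    refine Run.seq ((ihp hb hn hr (weaken (by omega) hW)).imp le_rfl fun s₁ ⟨h₁, hs₁⟩ => ?_)
    exact (ihq (p.boundedBy_eval hb hn) (by omega) h₁ (weaken (by omega) hW)).imp le_rfl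
      fun s₂ ⟨h₂, hs₂⟩ => ⟨h₂, hs₁.trans hs₂⟩
  | ite b p q ihp ihq =>
    intro M d h s hb hn hr hW
    simp only [cost] at hW ⊢
    rw [Nat.add_assoc]
    refine b.run_compile hb hn hr (weaken (by omega) hW) (fun s₁ h₁ hs₁ hb₁ => ?_)
      (fun s₁ h₁ hs₁ hb₁ => ?_)
    · refine (ihp hb hn h₁ (weaken (by omega) hW)).imp (by omega) fun s₂ ⟨h₂, hs₂⟩ => ⟨?_, ?_⟩
      · simpa [eval, hb₁] using h₂
      · exact hs₁.trans hs₂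
    · refine (ihq hb hn h₁ (weaken (by omega) hW)).imp (by omega) fun s₂ ⟨h₂, hs₂⟩ => ⟨?_, ?_⟩
      · simpa [eval, hb₁] using h₂
      · exact hs₁.trans hs₂
  | forEach x p ih =>
    intro M d h s hb hn hr hW
    simp only [cost] at hW ⊢
    set c := p.cost n with hc
    set f := fun k h => p.eval n (State.setReg h x k) with hf
    -- Induction on the number `m` of remaining rounds, after `k` rounds have been executed.
    have key : ∀ m k, k + m = n → ∀ h' s', h'.BoundedBy (M + k * (c + 5)) →
        Represents n h' s' → s'.reg (scratch d) = k → SameBelow d s s' → h' = iter f k h →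
        Run W (.loop (scratch d) 1
      (.seq (.const (2 * x) 0) (.seq (.arith .add (2 * x) (2 * x) (scratch d))
      (.seq (p.compile (d + 1)) (.seq (.const (scratch (d + 1)) 1)
      (.arith .add (scratch d) (scratch d) (scratch (d + 1)))))))) s' (m * (c + 5) + 1) fun s'' =>
          Represents n (iter f n h) s'' ∧ SameBelow d s s'' := by
      intro m
      induction m with
      | zero =>
        intro k hk h' s' _ hr' hs' hbel hh
        obtain rfl : k = n := by omega
        refine (Run.loop_false ?_ ⟨hh ▸ hr', hbel⟩).imp (by omega) fun _ => id
        rw [hs', hr'.size]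
        exact lt_irrefl _
      | succ m ihm =>
        intro k hk h' s' hb' hr' hs' hbel hh
        have hkn : k < n := by omega
        have hkc : k * (c + 5) + (c + 5) ≤ n * (c + 5) := by
          rw [← Nat.succ_mul]
          exact Nat.mul_le_mul_right _ hkn
        have hsmall : 1 < W ∧ k + 1 < W := by
          have h2 : k + 1 ≤ M + (n * (c + 5) + 2) := by omega
          have h3 := lt_of_succ_mul_lt hW h2
          have h4 := lt_of_succ_mul_lt (u := 1) hW (by omega)
          exact ⟨h4, h3⟩
        rw [show (m + 1) * (c + 5) + 1 = (1 + (1 + (c + (1 + 1)))) + (m * (c + 5) + 1) + 1 by ring]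
        refine Run.loop_true (by rw [hs', hr'.size]; exact hkn) ?_
        refine Run.seq (Run.const (by omega) (Run.seq (Run.arith (u := 0) (v := k) (by simp) ?_ ?_
          (Run.seq ?_))))
        · simp [scratch_ne_two_mul, hs']
        · simp only [Op.eval]; omega
        have hr₁ := (hr'.setVar x 0).setVar x (Op.add.eval 0 k)
        have hb₁ : (h'.setReg x k).BoundedBy (M + k * (c + 5)) := hb'.setReg (by omega)
        have hset : (h'.setReg x 0).setReg x (Op.add.eval 0 k) = h'.setReg x k := by
          simp [State.setReg, Op.eval]
        rw [hset] at hr₁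
        refine (ih hb₁ (by omega) hr₁ (weaken (by omega) hW)).imp le_rfl fun s₂ ⟨h₂, hs₂⟩ => ?_
        have hd2 : s₂.reg (scratch d) = k := by
          rw [hs₂ d (by omega)]
          simp [scratch_ne_two_mul, hs']
        refine Run.seq (Run.const hsmall.1 (Run.arith (u := k) (v := 1) ?_ (by simp) ?_ ?_))
        · simp [scratch_inj, hd2]
        · exact hsmall.2
        refine ihm (k + 1) (by omega) (p.eval n (h'.setReg x k)) _ ?_
          ((h₂.setScratch _ _).setScratch _ _) (by simp [Op.eval]) ?_ ?_
        · refine (p.boundedBy_eval hb₁ (by omega)).mono ?_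
          rw [Nat.succ_mul]
          omega
        · have t1 := (sameBelow_setVar d s' x 0).trans
            (sameBelow_setVar d _ x (Op.add.eval 0 k))
          exact ((hbel.trans t1).trans (hs₂.mono (by omega))).trans
            ((sameBelow_setScratch (by omega) _ _).trans (sameBelow_setScratch le_rfl _ _))
        · rw [hh]
          rfl
    rw [show n * (c + 5) + 2 = 1 + (n * (c + 5) + 1) by ring]
    refine Run.seq (Run.const (by omega) ?_)
    exact key n 0 (by omega) h _ (by simpa using hb) (hr.setScratch _ _) (by simp)
      (sameBelow_setScratch le_rfl _ _) rfl

/-- The nesting depth of the loops of a command. -/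
def Cmd.depth : Cmd → ℕ
  | .skip => 0
  | .assign _ _ => 0
  | .put _ _ _ _ => 0
  | .seq p q => max p.depth q.depth
  | .ite _ p q => max p.depth q.depth
  | .forEach _ p => p.depth + 1

lemma Cmd.exists_cost_le (p : Cmd) : ∃ K, ∀ n, 1 ≤ n → p.cost n ≤ K * n ^ p.depth := by
  have lift {n K a b : ℕ} (hn : 1 ≤ n) (hab : a ≤ b) : K * n ^ a ≤ K * n ^ b :=
    Nat.mul_le_mul_left _ (Nat.pow_le_pow_right hn hab)
  induction p with
  | skip => exact ⟨1, fun n _ => by simp [cost, depth]⟩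
  | assign x e => exact ⟨e.cost + 2, fun n _ => by simp [cost, depth]⟩
  | put a i j e => exact ⟨i.cost + j.cost + e.cost + 3, fun n _ => by simp [cost, depth]⟩
  | seq p q ihp ihq =>
    obtain ⟨K, hK⟩ := ihp
    obtain ⟨K', hK'⟩ := ihq
    refine ⟨K + K', fun n hn => ?_⟩
    simp only [cost, depth, Nat.add_mul]
    exact Nat.add_le_add ((hK n hn).trans (lift hn (le_max_left _ _)))
      ((hK' n hn).trans (lift hn (le_max_right _ _)))
  | ite b p q ihp ihq =>
    obtain ⟨K, hK⟩ := ihp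
    obtain ⟨K', hK'⟩ := ihq
    refine ⟨b.cost + K + K', fun n hn => ?_⟩
    simp only [cost, depth, Nat.add_mul]
    exact Nat.add_le_add (Nat.add_le_add (Nat.le_mul_of_pos_right _ (Nat.pow_pos hn))
      ((hK n hn).trans (lift hn (le_max_left _ _))))
      ((hK' n hn).trans (lift hn (le_max_right _ _)))
  | forEach x p ih =>
    obtain ⟨K, hK⟩ := ih
    refine ⟨K + 7, fun n hn => ?_⟩
    simp only [cost, depth]
    have h1 := hK n hn
    have h2 : 1 ≤ n ^ p.depth := Nat.one_le_pow _ _ hn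
    have h3 : n * (p.cost n + 7) ≤ n * (K * n ^ p.depth + 7 * n ^ p.depth) :=
      Nat.mul_le_mul_left _ (by omega)
    calc n * (p.cost n + 5) + 2 ≤ n * (p.cost n + 7) := by rw [Nat.mul_add, Nat.mul_add]; omega
      _ ≤ _ := h3
      _ = (K + 7) * n ^ (p.depth + 1) := by ring

/-- Every command of depth at most `m` can be run on a random access machine in time `O(n ^ m)` with
words of `O(log n)` bits; variable `0` and variable `y` are returned in the registers `0`
and `1`. -/
theorem Cmd.exists_prog (p : Cmd) (y : ℕ) {m : ℕ} (hm : p.depth ≤ m) :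
    ∃ (P : Prog) (c C : ℕ), ∀ (n : ℕ), 3 ≤ n → ∀ h : State, h.BoundedBy n → h.reg 0 = n →
      (∀ x ≠ 0, h.reg x = 0) →
      Run (n ^ c) P h (C * n ^ m) fun s =>
        s.reg 0 = (p.eval n h).reg 0 ∧ s.reg 1 = (p.eval n h).reg y ∧
          s.arr = (p.eval n h).arr := by
  obtain ⟨K, hK⟩ := p.exists_cost_le
  -- The memory holds `n` in register `0` at first. The program copies it to register `1`, where the
  -- compiled command expects it, and moves the second result to register `1` in the end. The words
  -- have to hold `(n + 1) * (n + p.cost n)`, which is less than `n ^ (m + 2) * (2 * K + 2)`.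
  refine ⟨.seq (.const 1 0) (.seq (.arith .add 1 1 0) (.seq (p.compile 0)
    (.seq (.const 1 0) (.arith .add 1 1 (2 * y))))), m + 2 + (2 * K + 2), K + 4, ?_⟩
  intro n hn h hb h0 hx
  have hcost : p.cost n ≤ K * n ^ m :=
    (hK n (by omega)).trans (Nat.mul_le_mul_left _ (Nat.pow_le_pow_right (by omega) hm))
  have h1 : 1 ≤ n ^ m := Nat.one_le_pow _ _ (by omega)
  set W := n ^ (m + 2 + (2 * K + 2)) with hWdef
  have hW : (n + 1) * (n + p.cost n) < W := by
    have h2 : p.cost n ≤ K * n ^ (m + 1) :=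
      hcost.trans (Nat.mul_le_mul_left _ (Nat.pow_le_pow_right (by omega) (by omega)))
    have h3 : n ≤ n ^ (m + 1) := Nat.le_self_pow (by omega) n
    have h4 : 2 * K + 2 < n ^ (2 * K + 2) := Nat.lt_pow_self (by omega)
    calc (n + 1) * (n + p.cost n) ≤ (2 * n) * (n ^ (m + 1) + K * n ^ (m + 1)) :=
          Nat.mul_le_mul (by omega) (by omega)
      _ = n ^ (m + 2) * (2 * K + 2) := by ring
      _ < n ^ (m + 2) * n ^ (2 * K + 2) := Nat.mul_lt_mul_of_pos_left h4 (Nat.pow_pos (by omega))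
      _ = W := by rw [hWdef, ← pow_add]
  have hn' := lt_of_succ_mul_lt (u := n) hW (by omega)
  have hr : Represents n h ((h.setReg 1 0).setReg 1 (Op.add.eval 0 n)) := by
    refine ⟨by simp [Op.eval], fun x => ?_, rfl⟩
    have : 2 * x ≠ 1 := by omega
    simp only [setReg_reg, this, if_false]
    by_cases h2 : x = 0
    · simp [h2]
    · rw [hx x h2, hx (2 * x) (by omega)]
  have hfin := p.boundedBy_eval hb le_rfl
  refine Run.imp (T := 1 + (1 + (p.cost n + (1 + 1)))) (Run.seq (Run.const (by omega) (Run.seq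
    (Run.arith (u := 0) (v := n) (by simp) (by simpa using h0) (by simpa [Op.eval] using hn')
    (Run.seq ?_))))) (by rw [Nat.add_mul]; omega) fun _ => id
  refine (p.run_compile hb le_rfl hr hW).imp le_rfl fun s' ⟨hr', _⟩ => ?_
  refine Run.seq (Run.const (by omega) (Run.arith (u := 0) (v := (p.eval n h).reg y)
    (by simp) ?_ ?_ ?_))
  · have : 2 * y ≠ 1 := by omega
    simpa [this] using hr'.reg y
  · simpa [Op.eval] using lt_of_succ_mul_lt hW (hfin.reg y)
  · refine ⟨by simpa using hr'.reg 0, by simp [Op.eval], by simpa using hr'.arr⟩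

end RAM

/-! ### Paths, reversals and rotations -/

/-- `f` with its values at the positions `i, …, j` in reverse order. -/
def revSeg (i j : ℕ) (f : ℕ → ℕ) (q : ℕ) : ℕ :=
  if i ≤ q ∧ q ≤ j then f (i + j - q) else f q

/-- The first `n` values of `f` are the numbers below `n`, each once. -/
structure IsPerm (n : ℕ) (f : ℕ → ℕ) : Prop where
  lt : ∀ i < n, f i < n
  inj : ∀ i < n, ∀ j < n, f i = f j → i = j

/-- `f` lists the vertices `0, …, n - 1`, and the first `L` of them, in this order, form a path with
respect to the adjacency relation `A`. -/
structure IsPathPerm (A : ℕ → ℕ → Prop) (n : ℕ) (f : ℕ → ℕ) (L : ℕ) : Prop extends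
    IsPerm n f where
  pos : 1 ≤ L
  le : L ≤ n
  adj : ∀ i, i + 1 < L → A (f i) (f (i + 1))

/-- Adjacency of a graph on the vertices `0, …, n - 1`. -/
structure IsAdj (A : ℕ → ℕ → Prop) (n : ℕ) : Prop where
  symm : ∀ u < n, ∀ v < n, A u v → A v u
  irrefl : ∀ u < n, ¬ A u u

lemma revSeg_of_mem {i j q : ℕ} (f : ℕ → ℕ) (h₁ : i ≤ q) (h₂ : q ≤ j) :
    revSeg i j f q = f (i + j - q) := if_pos ⟨h₁, h₂⟩

lemma revSeg_of_lt {i j q : ℕ} (f : ℕ → ℕ) (h : q < i) : revSeg i j f q = f q :=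
  if_neg (by omega)

lemma revSeg_of_gt {i j q : ℕ} (f : ℕ → ℕ) (h : j < q) : revSeg i j f q = f q :=
  if_neg (by omega)

lemma IsPerm.revSeg {n i j : ℕ} {f : ℕ → ℕ} (hf : IsPerm n f) (hj : j < n) :
    IsPerm n (revSeg i j f) where
  lt q hq := by
    unfold _root_.revSeg
    split_ifs
    · exact hf.lt _ (by omega)
    · exact hf.lt _ hq
  inj p hp q hq h := by
    unfold _root_.revSeg at h
    split_ifs at h
    · have := hf.inj _ (by omega) _ (by omega) h
      omega
    · have := hf.inj _ (by omega) _ (by omega) h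
      omega
    · have := hf.inj _ (by omega) _ (by omega) h
      omega
    · exact hf.inj _ hp _ hq h

section Moves

variable {A : ℕ → ℕ → Prop} {n L : ℕ} {f : ℕ → ℕ}

/-- Reversing the part before a neighbor of the first vertex of a path gives a path. -/
lemma IsPathPerm.rotate_left {a : ℕ} (hA : IsAdj A n) (hf : IsPathPerm A n f L) (ha : 1 ≤ a)
    (haL : a < L) (h : A (f 0) (f a)) : IsPathPerm A n (revSeg 0 (a - 1) f) L where
  toIsPerm := hf.toIsPerm.revSeg (by have := hf.le; omega)
  pos := hf.pos
  le := hf.le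
  adj i hi := by
    have hL := hf.le
    rcases lt_trichotomy (i + 1) a with h₁ | h₁ | h₁
    · rw [revSeg_of_mem _ (by omega) (by omega), revSeg_of_mem _ (by omega) (by omega)]
      refine hA.symm _ (hf.lt _ (by omega)) _ (hf.lt _ (by omega)) ?_
      have := hf.adj (0 + (a - 1) - (i + 1)) (by omega)
      rwa [show 0 + (a - 1) - (i + 1) + 1 = 0 + (a - 1) - i by omega] at this
    · rw [revSeg_of_mem _ (by omega) (by omega), revSeg_of_gt _ (by omega)]
      rwa [show 0 + (a - 1) - i = 0 by omega, h₁]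
    · rw [revSeg_of_gt _ (by omega), revSeg_of_gt _ (by omega)]
      exact hf.adj i hi

/-- Reversing the part after a neighbor of the last vertex of a path gives a path. -/
lemma IsPathPerm.rotate_right {b : ℕ} (hA : IsAdj A n) (hf : IsPathPerm A n f L)
    (hb : b + 1 < L) (h : A (f (L - 1)) (f b)) :
    IsPathPerm A n (revSeg (b + 1) (L - 1) f) L where
  toIsPerm := hf.toIsPerm.revSeg (by have := hf.le; omega)
  pos := hf.pos
  le := hf.le
  adj i hi := by
    have hL := hf.le
    rcases lt_trichotomy i b with h₁ | h₁ | h₁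
    · rw [revSeg_of_lt _ (by omega), revSeg_of_lt _ (by omega)]
      exact hf.adj i hi
    · rw [revSeg_of_lt _ (by omega), revSeg_of_mem _ (by omega) (by omega)]
      rw [show b + 1 + (L - 1) - (i + 1) = L - 1 by omega, h₁]
      exact hA.symm _ (hf.lt _ (by omega)) _ (hf.lt _ (by omega)) h
    · rw [revSeg_of_mem _ (by omega) (by omega), revSeg_of_mem _ (by omega) (by omega)]
      refine hA.symm _ (hf.lt _ (by omega)) _ (hf.lt _ (by omega)) ?_
      have := hf.adj (b + 1 + (L - 1) - (i + 1)) (by omega)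
      rwa [show b + 1 + (L - 1) - (i + 1) + 1 = b + 1 + (L - 1) - i by omega] at this

lemma IsPathPerm.reverse (hA : IsAdj A n) (hf : IsPathPerm A n f L) :
    IsPathPerm A n (revSeg 0 (L - 1) f) L where
  toIsPerm := hf.toIsPerm.revSeg (by have := hf.le; have := hf.pos; omega)
  pos := hf.pos
  le := hf.le
  adj i hi := by
    have hL := hf.le
    rw [revSeg_of_mem _ (by omega) (by omega), revSeg_of_mem _ (by omega) (by omega)]
    refine hA.symm _ (hf.lt _ (by omega)) _ (hf.lt _ (by omega)) ?_
    have := hf.adj (0 + (L - 1) - (i + 1)) (by omega)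
    rwa [show 0 + (L - 1) - (i + 1) + 1 = 0 + (L - 1) - i by omega] at this

/-- A closed path can be cut open just behind any of its vertices, which then comes first. -/
lemma IsPathPerm.recut {a : ℕ} (hA : IsAdj A n) (hf : IsPathPerm A n f L)
    (hcl : A (f 0) (f (L - 1))) (ha : a < L) :
    IsPathPerm A n (revSeg (a + 1) (L - 1) (revSeg 0 a f)) L where
  toIsPerm := (hf.toIsPerm.revSeg (by have := hf.le; omega)).revSeg (by have := hf.le; omega)
  pos := hf.pos
  le := hf.le
  adj i hi := by
    have hL := hf.le
    have hlow : ∀ q ≤ a, revSeg (a + 1) (L - 1) (revSeg 0 a f) q = f (a - q) := fun q hq => by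
      rw [revSeg_of_lt _ (by omega), revSeg_of_mem _ (by omega) hq, Nat.zero_add]
    have hhigh : ∀ q, a < q → q < L →
        revSeg (a + 1) (L - 1) (revSeg 0 a f) q = f (a + L - q) := fun q hq hq' => by
      rw [revSeg_of_mem _ (by omega) (by omega), revSeg_of_gt _ (by omega),
        show a + 1 + (L - 1) - q = a + L - q by omega]
    rcases lt_trichotomy i a with h₁ | h₁ | h₁
    · rw [hlow i (by omega), hlow (i + 1) (by omega)]
      refine hA.symm _ (hf.lt _ (by omega)) _ (hf.lt _ (by omega)) ?_
      have := hf.adj (a - (i + 1)) (by omega)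
      rwa [show a - (i + 1) + 1 = a - i by omega] at this
    · rw [hlow i (by omega), hhigh (i + 1) (by omega) hi]
      rwa [show a - i = 0 by omega, show a + L - (i + 1) = L - 1 by omega]
    · rw [hhigh i (by omega) (by omega), hhigh (i + 1) (by omega) hi]
      refine hA.symm _ (hf.lt _ (by omega)) _ (hf.lt _ (by omega)) ?_
      have := hf.adj (a + L - (i + 1)) (by omega)
      rwa [show a + L - (i + 1) + 1 = a + L - i by omega] at this

/-- A path can be extended by a neighbor of its last vertex that is not on the path. -/
lemma IsPathPerm.extend {b : ℕ} (hf : IsPathPerm A n f L) (hb : b < n) (hLb : L ≤ b)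
    (h : A (f (L - 1)) (f b)) : IsPathPerm A n (revSeg L b f) (L + 1) where
  toIsPerm := hf.toIsPerm.revSeg hb
  pos := by omega
  le := by omega
  adj i hi := by
    have := hf.pos
    rw [revSeg_of_lt _ (by omega)]
    rcases lt_or_ge (i + 1) L with h₁ | h₁
    · rw [revSeg_of_lt _ h₁]
      exact hf.adj i h₁
    · rw [revSeg_of_mem _ (by omega) (by omega), show L + b - (i + 1) = b by omega]
      rwa [show i = L - 1 by omega]

/-- The ends of the path are adjacent. -/
def Closed (A : ℕ → ℕ → Prop) (f : ℕ → ℕ) (L : ℕ) : Prop := A (f 0) (f (L - 1))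

/-- The vertices at the positions `a ≤ b` are neighbors of the first and of the last vertex
respectively, and the vertex before `a` is adjacent to the vertex after `b`: rotating the path at
both ends closes it. -/
def CanCloseOutward (A : ℕ → ℕ → Prop) (f : ℕ → ℕ) (L a b : ℕ) : Prop :=
  ¬ Closed A f L ∧ 1 ≤ a ∧ a ≤ b ∧ b + 1 < L ∧ A (f 0) (f a) ∧ A (f (L - 1)) (f b) ∧
    A (f (a - 1)) (f (b + 1))

/-- The vertices at the positions `a > b` are neighbors of the first and of the last vertex
respectively, and the vertices before them are adjacent: two rotations close the path. -/
def CanCloseCrossing (A : ℕ → ℕ → Prop) (f : ℕ → ℕ) (L a b : ℕ) : Prop :=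
  ¬ Closed A f L ∧ 1 ≤ b ∧ b < a ∧ a < L ∧ A (f 0) (f a) ∧ A (f (L - 1)) (f b) ∧
    A (f (a - 1)) (f (b - 1))

/-- The path is closed, and the vertex at position `a` of it has a neighbor `b` outside. -/
def CanLeave (A : ℕ → ℕ → Prop) (f : ℕ → ℕ) (L a b : ℕ) : Prop :=
  Closed A f L ∧ a < L ∧ L ≤ b ∧ A (f a) (f b)

/-- The first vertex has a neighbor outside the path. -/
def CanExtendFront (A : ℕ → ℕ → Prop) (f : ℕ → ℕ) (L b : ℕ) : Prop :=
  L ≤ b ∧ A (f 0) (f b)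

/-- The last vertex has a neighbor outside the path. -/
def CanExtendBack (A : ℕ → ℕ → Prop) (f : ℕ → ℕ) (L b : ℕ) : Prop :=
  L ≤ b ∧ A (f (L - 1)) (f b)

/-- None of the moves that close, open or extend the path is possible. -/
structure Stuck (A : ℕ → ℕ → Prop) (n : ℕ) (f : ℕ → ℕ) (L : ℕ) : Prop where
  outward : ∀ a < n, ∀ b < n, ¬ CanCloseOutward A f L a b
  crossing : ∀ a < n, ∀ b < n, ¬ CanCloseCrossing A f L a b
  leave : ∀ a < n, ∀ b < n, ¬ CanLeave A f L a b
  front : ∀ b < n, ¬ CanExtendFront A f L b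
  back : ∀ b < n, ¬ CanExtendBack A f L b

/-- A move: if `C a b` holds for some `a, b < n`, then the new value is `F a b` for one such pair;
otherwise nothing changes. -/
def Moved {α : Type*} (n : ℕ) (C : ℕ → ℕ → Prop) (F : ℕ → ℕ → α) (x y : α) : Prop :=
  (∃ a < n, ∃ b < n, C a b ∧ y = F a b) ∨ ((∀ a < n, ∀ b < n, ¬ C a b) ∧ y = x)

lemma Moved.eq_of_forall_not {α : Type*} {C : ℕ → ℕ → Prop} {F : ℕ → ℕ → α} {x y : α}
    (h : Moved n C F x y) (hC : ∀ a < n, ∀ b < n, ¬ C a b) : y = x := by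
  obtain ⟨a, ha, b, hb, hc, -⟩ | ⟨-, h⟩ := h
  · exact absurd hc (hC a ha b hb)
  · exact h

lemma closed_outward {a b : ℕ} (hA : IsAdj A n) (hf : IsPathPerm A n f L)
    (h : CanCloseOutward A f L a b) :
    IsPathPerm A n (revSeg (b + 1) (L - 1) (revSeg 0 (a - 1) f)) L ∧
      Closed A (revSeg (b + 1) (L - 1) (revSeg 0 (a - 1) f)) L := by
  obtain ⟨-, h₁, h₂, h₃, h₄, h₅, h₆⟩ := h
  refine ⟨(hf.rotate_left hA h₁ (by omega) h₄).rotate_right hA h₃ ?_, ?_⟩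
  · rwa [revSeg_of_gt _ (by omega), revSeg_of_gt _ (by omega)]
  · unfold Closed
    rw [revSeg_of_lt _ (by omega), revSeg_of_mem _ (by omega) (by omega),
      revSeg_of_mem _ (by omega) (by omega), revSeg_of_gt _ (by omega)]
    rwa [show 0 + (a - 1) - 0 = a - 1 by omega, show b + 1 + (L - 1) - (L - 1) = b + 1 by omega]

lemma closed_crossing {a b : ℕ} (hA : IsAdj A n) (hf : IsPathPerm A n f L)
    (h : CanCloseCrossing A f L a b) :
    IsPathPerm A n (revSeg (a - b) (L - 1) (revSeg 0 (a - 1) f)) L ∧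
      Closed A (revSeg (a - b) (L - 1) (revSeg 0 (a - 1) f)) L := by
  obtain ⟨-, h₁, h₂, h₃, h₄, h₅, h₆⟩ := h
  rw [show a - b = a - b - 1 + 1 by omega]
  refine ⟨(hf.rotate_left hA (by omega) h₃ h₄).rotate_right hA (by omega) ?_, ?_⟩
  · rw [revSeg_of_gt _ (by omega), revSeg_of_mem _ (by omega) (by omega)]
    rwa [show 0 + (a - 1) - (a - b - 1) = b by omega]
  · unfold Closed
    rw [revSeg_of_lt _ (by omega), revSeg_of_mem _ (by omega) (by omega),
      revSeg_of_mem _ (by omega) (by omega), revSeg_of_mem _ (by omega) (by omega)]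
    rwa [show 0 + (a - 1) - 0 = a - 1 by omega,
      show 0 + (a - 1) - (a - b - 1 + 1 + (L - 1) - (L - 1)) = b - 1 by omega]

/-- One round of moves either lengthens the path or ends in a stuck position. In a stuck position
nothing moves. -/
lemma round_of_moves {f₁ f₂ f₃ f₄ : ℕ → ℕ} {y : (ℕ → ℕ) × ℕ} (hA : IsAdj A n)
    (hf : IsPathPerm A n f L)
    (h₁ : Moved n (CanCloseOutward A f L)
      (fun a b => revSeg (b + 1) (L - 1) (revSeg 0 (a - 1) f)) f f₁)
    (h₂ : Moved n (CanCloseCrossing A f₁ L)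
      (fun a b => revSeg (a - b) (L - 1) (revSeg 0 (a - 1) f₁)) f₁ f₂)
    (h₃ : Moved n (CanLeave A f₂ L)
      (fun a _ => revSeg (a + 1) (L - 1) (revSeg 0 a f₂)) f₂ f₃)
    (h₄ : Moved n (fun _ => CanExtendFront A f₃ L) (fun _ _ => revSeg 0 (L - 1) f₃) f₃ f₄)
    (h₅ : Moved n (fun _ => CanExtendBack A f₄ L) (fun _ b => (revSeg L b f₄, L + 1)) (f₄, L) y) :
    IsPathPerm A n y.1 y.2 ∧ (y.2 = L + 1 ∨ Stuck A n y.1 y.2) ∧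
      (Stuck A n f L → y = (f, L)) := by
  have hL := hf.le
  have hL' := hf.pos
  have p₁ : IsPathPerm A n f₁ L := by
    obtain ⟨a, ha, b, hb, hc, rfl⟩ | ⟨-, rfl⟩ := h₁
    exacts [(closed_outward hA hf hc).1, hf]
  have p₂ : IsPathPerm A n f₂ L := by
    obtain ⟨a, ha, b, hb, hc, rfl⟩ | ⟨-, rfl⟩ := h₂
    exacts [(closed_crossing hA p₁ hc).1, p₁]
  have p₃ : IsPathPerm A n f₃ L := by
    obtain ⟨a, ha, b, hb, hc, rfl⟩ | ⟨-, rfl⟩ := h₃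
    exacts [p₂.recut hA hc.1 hc.2.1, p₂]
  have p₄ : IsPathPerm A n f₄ L := by
    obtain ⟨a, ha, b, hb, hc, rfl⟩ | ⟨-, rfl⟩ := h₄
    exacts [p₃.reverse hA, p₃]
  refine ⟨?_, ?_, fun hs => ?_⟩
  · obtain ⟨a, ha, b, hb, hc, rfl⟩ | ⟨-, rfl⟩ := h₅
    exacts [p₄.extend hb hc.1 hc.2, p₄]
  · obtain ⟨a, ha, b, hb, hc, rfl⟩ | ⟨n₅, rfl⟩ := h₅
    · exact .inl rfl
    right
    -- A move at the front would have made an extension at the back possible, and opening a closed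
    -- path would have made a move at the front possible.
    obtain ⟨a, ha, b, hb, hc, rfl⟩ | ⟨n₄, rfl⟩ := h₄
    · refine absurd ⟨hc.1, ?_⟩ (n₅ a ha b hb)
      dsimp only
      rw [revSeg_of_mem _ (by omega) (by omega), revSeg_of_gt _ (by have := hc.1; omega)]
      rw [show 0 + (L - 1) - (L - 1) = 0 by omega]
      exact hc.2
    obtain ⟨a, ha, b, hb, hc, rfl⟩ | ⟨n₃, rfl⟩ := h₃
    · obtain ⟨h, h', h'', h'''⟩ := hc
      refine absurd ⟨h'', ?_⟩ (n₄ a ha b hb)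
      dsimp only
      rw [revSeg_of_lt _ (by omega), revSeg_of_mem _ (by omega) (by omega),
        revSeg_of_gt _ (by omega), revSeg_of_gt _ (by omega)]
      rwa [show 0 + a - 0 = a by omega]
    have n₀ : 0 < n := by omega
    have key : (∀ a < n, ∀ b < n, ¬ CanCloseOutward A f₄ L a b) ∧
        ∀ a < n, ∀ b < n, ¬ CanCloseCrossing A f₄ L a b := by
      obtain ⟨a, ha, b, hb, hc, rfl⟩ | ⟨n₂, rfl⟩ := h₂
      · have := (closed_crossing hA p₁ hc).2
        exact ⟨fun _ _ _ _ h => h.1 this, fun _ _ _ _ h => h.1 this⟩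
      · refine ⟨?_, n₂⟩
        obtain ⟨a, ha, b, hb, hc, rfl⟩ | ⟨n₁, rfl⟩ := h₁
        · have := (closed_outward hA hf hc).2
          exact fun _ _ _ _ h => h.1 this
        · exact n₁
    exact ⟨key.1, key.2, n₃, n₄ 0 n₀, n₅ 0 n₀⟩
  · obtain rfl := h₁.eq_of_forall_not hs.outward
    obtain rfl := h₂.eq_of_forall_not hs.crossing
    obtain rfl := h₃.eq_of_forall_not hs.leave
    obtain rfl := h₄.eq_of_forall_not fun _ _ => hs.front
    exact h₅.eq_of_forall_not fun _ _ => hs.back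

end Moves

/-! ### Bipartite holes at a stuck path -/

open Classical in
lemma card_filter_count_lt (p : ℕ → Prop) (i n : ℕ) :
    ((Finset.range n).filter fun a => p a ∧ Nat.count p a < i).card = min i (Nat.count p n) := by
  induction n with
  | zero => simp
  | succ n ih =>
    rw [Finset.range_add_one, Finset.filter_insert, Nat.count_succ]
    by_cases hp : p n <;> by_cases hi : Nat.count p n < i
    · rw [if_pos ⟨hp, hi⟩, Finset.card_insert_of_notMem (by simp), ih, if_pos hp]
      omega
    · rw [if_neg (fun h => hi h.2), ih]
      omega
    · rw [if_neg (fun h => hp h.1), ih, if_neg hp, Nat.add_zero]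
    · rw [if_neg (fun h => hp h.1), ih, if_neg hp, Nat.add_zero]

open Classical in
lemma exists_count_eq {p : ℕ → Prop} {j n : ℕ} (h : j < Nat.count p n) :
    ∃ a < n, p a ∧ Nat.count p a = j := by
  induction n with
  | zero => simp at h
  | succ n ih =>
    by_cases hj : j < Nat.count p n
    · obtain ⟨a, ha, hp⟩ := ih hj
      exact ⟨a, by omega, hp⟩
    · rw [Nat.count_succ] at h
      split_ifs at h with hp
      · exact ⟨n, by omega, hp, by omega⟩
      · omega

open Classical in
lemma count_le_count_add_card (p : ℕ → Prop) (m n : ℕ) :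
    Nat.count p n ≤ Nat.count p m + ((Finset.range n).filter fun b => p b ∧ m ≤ b).card := by
  rw [Nat.count_eq_card_filter_range, Nat.count_eq_card_filter_range]
  refine (Finset.card_le_card fun b hb => ?_).trans (Finset.card_union_le _ _)
  simp only [Finset.mem_filter, Finset.mem_range, Finset.mem_union] at hb ⊢
  rcases lt_or_ge b m with h | h
  · exact .inl ⟨h, hb.2⟩
  · exact .inr ⟨hb.1, hb.2, h⟩

open Classical in
lemma IsPerm.count_comp {n : ℕ} {f : ℕ → ℕ} (hf : IsPerm n f) (p : ℕ → Prop) :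
    Nat.count (fun q => p (f q)) n = Nat.count p n := by
  have himg : (Finset.range n).image f = Finset.range n := by
    refine Finset.eq_of_subset_of_card_le (fun v hv => ?_) ?_
    · obtain ⟨q, hq, rfl⟩ := Finset.mem_image.1 hv
      exact Finset.mem_range.2 (hf.lt q (Finset.mem_range.1 hq))
    · rw [Finset.card_image_of_injOn]
      intro i hi j hj h
      exact hf.inj i (by simpa using hi) j (by simpa using hj) h
  rw [Nat.count_eq_card_filter_range, Nat.count_eq_card_filter_range]
  conv_rhs => rw [← himg, Finset.filter_image]
  rw [Finset.card_image_of_injOn]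
  intro i hi j hj h
  simp only [Finset.coe_filter, Finset.mem_range] at hi hj
  exact hf.inj i hi.1 j hj.1 h

/-- Position `a` of the path, other than the first, holds a neighbor of the vertex `v`. (The first
position is left out because the vertex before `a` will be needed.) -/
def NbrAt (A : ℕ → ℕ → Prop) (f : ℕ → ℕ) (L v a : ℕ) : Prop :=
  1 ≤ a ∧ a < L ∧ A v (f a)

section Stuck

variable {A : ℕ → ℕ → Prop} {n L d : ℕ} {f : ℕ → ℕ}

open Classical in
lemma le_count_nbrAt (hf : IsPathPerm A n f L) (hdeg : ∀ u < n, d ≤ Nat.count (A u) n) {v : ℕ}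
    (hv : v < n) (hout : ∀ q < n, L ≤ q → ¬ A v (f q)) (h0 : ¬ A v (f 0)) :
    d ≤ Nat.count (NbrAt A f L v) n := by
  refine (hdeg v hv).trans ?_
  rw [← hf.toIsPerm.count_comp]
  refine Nat.count_mono_left fun q hq h => ⟨?_, ?_, h⟩
  · rcases Nat.eq_zero_or_pos q with rfl | h'
    · exact absurd h h0
    · exact h'
  · by_contra h'
    exact hout q hq (by omega) h

open Classical in
/-- At a stuck path that is not a Hamilton cycle there are, for all positive `i` and `t` with
`i + t = d + 1` (where `d` is at most the minimum degree), large bipartite holes of a special form: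
one side consists of the vertices just before the first `i` neighbors of one of the two ends of the
path, and the other side has `t` vertices. (The set `T` consists of positions.)

If the path is closed, then no edge leaves it. Otherwise let `m` be the position of the `i`-th
neighbor of the first vertex. If the last vertex has `t` neighbors at positions from `m - 1` on,
then the vertices after these will do, since the path cannot be closed outward. If not, then the
last vertex has `i` neighbors before position `m - 1`, and the vertices just before the neighbors
of the first vertex from `m` on will do, since the path cannot be closed crossing. -/
lemma Stuck.exists_hole (hA : IsAdj A n) (hf : IsPathPerm A n f L) (hs : Stuck A n f L)
    (hnot : ¬ (Closed A f L ∧ L = n)) (hdeg : ∀ u < n, d ≤ Nat.count (A u) n) {i t : ℕ}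
    (hi : 1 ≤ i) (ht : 1 ≤ t) (hit : i + t = d + 1) :
    ∃ v, (v = f 0 ∨ v = f (L - 1)) ∧ i ≤ Nat.count (NbrAt A f L v) n ∧
      ∃ T : Finset ℕ, t ≤ T.card ∧ ∀ q ∈ T, q < n ∧
        ∀ a, NbrAt A f L v a → Nat.count (NbrAt A f L v) a < i →
          q ≠ a - 1 ∧ ¬ A (f (a - 1)) (f q) := by
  have hL := hf.le
  have hL' := hf.pos
  have hfront : d ≤ Nat.count (NbrAt A f L (f 0)) n :=
    le_count_nbrAt hf hdeg (hf.lt 0 (by omega)) (fun q hq hLq h => hs.front q hq ⟨hLq, h⟩)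
      (hA.irrefl _ (hf.lt 0 (by omega)))
  by_cases hcl : Closed A f L
  · refine ⟨f 0, .inl rfl, by omega, Finset.Ico L n, ?_, fun q hq => ?_⟩
    · have hLn : L < n := lt_of_le_of_ne hL fun h => hnot ⟨hcl, h⟩
      have h1 := hdeg (f L) (hf.lt L hLn)
      rw [← hf.toIsPerm.count_comp, Nat.count_eq_card_filter_range] at h1
      have h2 : ((Finset.range n).filter fun q => A (f L) (f q)) ⊆ Finset.Ico (L + 1) n := by
        intro q hq
        obtain ⟨hq, h⟩ := Finset.mem_filter.1 hq
        have hq := Finset.mem_range.1 hq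
        refine Finset.mem_Ico.2 ⟨?_, hq⟩
        by_contra hlt
        rcases Nat.lt_or_ge q L with h' | h'
        · exact hs.leave q hq L hLn ⟨hcl, h', le_rfl,
            hA.symm _ (hf.lt _ hLn) _ (hf.lt _ hq) h⟩
        · rw [show q = L by omega] at h
          exact hA.irrefl _ (hf.lt _ hLn) h
      have h3 := Finset.card_le_card h2
      simp only [Nat.card_Ico] at h3 ⊢
      omega
    · obtain ⟨h1, h2⟩ := Finset.mem_Ico.1 hq
      refine ⟨h2, fun a ha _ => ?_⟩
      obtain ⟨h3, h4, h5⟩ := ha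
      exact ⟨by omega, fun h => hs.leave (a - 1) (by omega) q h2 ⟨hcl, by omega, h1, h⟩⟩
  have hback : d ≤ Nat.count (NbrAt A f L (f (L - 1))) n :=
    le_count_nbrAt hf hdeg (hf.lt _ (by omega)) (fun q hq hLq h => hs.back q hq ⟨hLq, h⟩)
      fun h => hcl (hA.symm _ (hf.lt _ (by omega)) _ (hf.lt _ (by omega)) h)
  obtain ⟨m, hmn, hm, hcount⟩ := exists_count_eq (show i - 1 < Nat.count (NbrAt A f L (f 0)) n by
    omega)
  by_cases hcase : t ≤ ((Finset.range n).filter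
      fun b => NbrAt A f L (f (L - 1)) b ∧ m - 1 ≤ b).card
  · refine ⟨f 0, .inl rfl, by omega,
      ((Finset.range n).filter fun b => NbrAt A f L (f (L - 1)) b ∧ m - 1 ≤ b).image (· + 1), ?_,
      fun q hq => ?_⟩
    · rwa [Finset.card_image_of_injective _ (add_left_injective 1)]
    · obtain ⟨b, hb, rfl⟩ := Finset.mem_image.1 hq
      obtain ⟨hbn, ⟨hb1, hbL, hb⟩, hmb⟩ := Finset.mem_filter.1 hb
      have hbn := Finset.mem_range.1 hbn
      have hbL1 : b + 1 < L := by
        by_contra h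
        obtain rfl : b = L - 1 := by omega
        exact hA.irrefl _ (hf.lt _ hbn) hb
      refine ⟨by omega, fun a ha hac => ?_⟩
      have ham : a < m + 1 := by
        refine Nat.lt_of_count_lt_count (p := NbrAt A f L (f 0)) ?_
        rw [Nat.count_succ, if_pos hm]
        omega
      obtain ⟨ha1, haL, ha⟩ := ha
      refine ⟨by omega, fun h => ?_⟩
      rcases Nat.lt_or_ge b a with hba | hba
      · -- Here `b = a - 1`, and the edge between the last vertex and the one before `a` closes
        -- the path.
        obtain rfl : b = a - 1 := by omega
        have haL2 : a ≠ L - 1 := by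
          rintro rfl
          exact hcl ha
        refine hs.outward a (by omega) (L - 2) (by omega)
          ⟨hcl, ha1, by omega, by omega, ha, ?_, ?_⟩
        · have := hf.adj (L - 2) (by omega)
          rw [show L - 2 + 1 = L - 1 by omega] at this
          exact hA.symm _ (hf.lt _ (by omega)) _ (hf.lt _ (by omega)) this
        · rw [show L - 2 + 1 = L - 1 by omega]
          exact hA.symm _ (hf.lt _ (by omega)) _ (hf.lt _ (by omega)) hb
      · exact hs.outward a (by omega) b hbn ⟨hcl, ha1, hba, hbL1, ha, hb, h⟩
  · have h1 := count_le_count_add_card (NbrAt A f L (f (L - 1))) (m - 1) n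
    have h2 := count_le_count_add_card (NbrAt A f L (f 0)) m n
    refine ⟨f (L - 1), .inr rfl, by omega,
      ((Finset.range n).filter fun a => NbrAt A f L (f 0) a ∧ m ≤ a).image (· - 1), ?_,
      fun q hq => ?_⟩
    · rw [Finset.card_image_of_injOn]
      · omega
      · intro a ha b hb h
        have ha' := (Finset.mem_filter.1 ha).2.1.1
        have hb' := (Finset.mem_filter.1 hb).2.1.1
        simp only at h
        omega
    · obtain ⟨a, ha, rfl⟩ := Finset.mem_image.1 hq
      obtain ⟨han, ⟨ha1, haL, ha⟩, hma⟩ := Finset.mem_filter.1 ha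
      have han := Finset.mem_range.1 han
      refine ⟨by omega, fun b hb hbc => ?_⟩
      have hbm : b < m - 1 := Nat.lt_of_count_lt_count (p := NbrAt A f L (f (L - 1))) (by omega)
      obtain ⟨hb1, hbL, hb⟩ := hb
      refine ⟨by omega, fun h => ?_⟩
      exact hs.crossing a han b (by omega) ⟨hcl, hb1, by omega, haL, ha, hb,
        hA.symm _ (hf.lt _ (by omega)) _ (hf.lt _ (by omega)) h⟩

open Classical in
/-- The vertices just before the first `i` neighbors of `v` on the path. -/
def Before (A : ℕ → ℕ → Prop) (f : ℕ → ℕ) (L v i u : ℕ) : Prop :=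
  ∃ a, NbrAt A f L v a ∧ Nat.count (NbrAt A f L v) a < i ∧ f (a - 1) = u

/-- The vertices outside `S` without a neighbor in `S`. -/
def Free (N : ℕ → ℕ → Prop) (n : ℕ) (S : ℕ → Prop) (w : ℕ) : Prop :=
  ¬ S w ∧ ∀ u < n, S u → ¬ N u w

open Classical in
lemma count_before (hf : IsPathPerm A n f L) {v i : ℕ}
    (hi : i ≤ Nat.count (NbrAt A f L v) n) : Nat.count (Before A f L v i) n = i := by
  have hL := hf.le
  have h1 := card_filter_count_lt (NbrAt A f L v) i n
  rw [min_eq_left hi] at h1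
  conv_rhs => rw [← h1]
  rw [Nat.count_eq_card_filter_range]
  symm
  refine Finset.card_bij (fun a _ => f (a - 1)) (fun a ha => ?_) (fun a ha b hb h => ?_)
    fun u hu => ?_
  · obtain ⟨ha, ha', ha''⟩ := Finset.mem_filter.1 ha
    simp only [Finset.mem_filter, Finset.mem_range] at ha ⊢
    exact ⟨hf.lt _ (by omega), a, ha', ha'', rfl⟩
  · obtain ⟨ha, ⟨ha', -⟩, -⟩ := Finset.mem_filter.1 ha
    obtain ⟨hb, ⟨hb', -⟩, -⟩ := Finset.mem_filter.1 hb
    simp only [Finset.mem_range] at ha hb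
    have := hf.inj _ (by omega) _ (by omega) h
    omega
  · obtain ⟨hu, a, ha, hac, rfl⟩ := Finset.mem_filter.1 hu
    have := ha.2.1
    exact ⟨a, Finset.mem_filter.2 ⟨Finset.mem_range.2 (by omega), ha, hac⟩, rfl⟩

open Classical in
/-- If `N` arises from `A` by adding at most `ρ` edges at each vertex, then the holes of `A` yield
smaller holes of `N`: a set of `i` vertices meets at most `i * ρ` additional edges. -/
lemma Stuck.exists_le_count_free {N : ℕ → ℕ → Prop} {ρ : ℕ} (hA : IsAdj A n)
    (hf : IsPathPerm A n f L) (hs : Stuck A n f L)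
    (hnot : ¬ (Closed A f L ∧ L = n)) (hdeg : ∀ u < n, d ≤ Nat.count (A u) n)
    (hN : ∀ u < n, Nat.count (fun v => N u v ∧ ¬ A u v) n ≤ ρ) {i t m : ℕ}
    (hi : 1 ≤ i) (ht : 1 ≤ t) (hit : i + t = d + 1) (hm : m + i * ρ ≤ t) :
    ∃ v, (v = f 0 ∨ v = f (L - 1)) ∧ i ≤ Nat.count (NbrAt A f L v) n ∧
      m ≤ Nat.count (Free N n (Before A f L v i)) n := by
  obtain ⟨v, hv, hiv, T, hT, hTS⟩ := hs.exists_hole hA hf hnot hdeg hi ht hit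
  refine ⟨v, hv, hiv, ?_⟩
  have hL := hf.le
  set S := (Finset.range n).filter (Before A f L v i) with hS
  set B := S.biUnion fun u => (Finset.range n).filter fun w => N u w ∧ ¬ A u w with hB
  have hScard : S.card = i := by
    rw [hS, ← Nat.count_eq_card_filter_range, count_before hf hiv]
  have hBcard : B.card ≤ i * ρ := by
    rw [← hScard]
    refine Finset.card_biUnion_le_card_mul _ _ _ fun u hu => ?_
    rw [← Nat.count_eq_card_filter_range]
    exact hN u (Finset.mem_range.1 (Finset.mem_filter.1 hu).1)
  have hTcard : (T.image f).card = T.card := by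
    refine Finset.card_image_of_injOn fun a ha b hb h => ?_
    exact hf.inj a (hTS a ha).1 b (hTS b hb).1 h
  have hsub : T.image f ⊆
      ((Finset.range n).filter fun w => Free N n (Before A f L v i) w) ∪ B := by
    intro w hw
    obtain ⟨q, hq, rfl⟩ := Finset.mem_image.1 hw
    obtain ⟨hqn, hqS⟩ := hTS q hq
    rw [Finset.mem_union, or_iff_not_imp_right]
    intro hnB
    refine Finset.mem_filter.2 ⟨Finset.mem_range.2 (hf.lt q hqn), ?_, ?_⟩
    · rintro ⟨a, ha, hac, h⟩
      have haL := ha.2.1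
      exact (hqS a ha hac).1 (hf.inj _ (by omega) _ hqn h).symm
    · rintro u hu ⟨a, ha, hac, rfl⟩ hNu
      refine hnB (Finset.mem_biUnion.2 ⟨f (a - 1), ?_, ?_⟩)
      · exact Finset.mem_filter.2 ⟨Finset.mem_range.2 hu, a, ha, hac, rfl⟩
      · exact Finset.mem_filter.2 ⟨Finset.mem_range.2 (hf.lt q hqn), hNu, (hqS a ha hac).2⟩
  have h1 := (Finset.card_le_card hsub).trans (Finset.card_union_le _ _)
  rw [Nat.count_eq_card_filter_range]
  omega

end Stuck

/-! ### Hamilton cycles, and bounds for the bipartite-hole-number -/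

section Graph

variable {V : Type*} {G : SimpleGraph V}

/-- The walk `x a, x (a + 1), …, x b`, where `b = a + m`. -/
def walkAlong (x : ℕ → V) (hx : ∀ j, G.Adj (x j) (x (j + 1))) :
    ∀ (m a b : ℕ), a + m = b → G.Walk (x a) (x b)
  | 0, _, _, h => (SimpleGraph.Walk.nil).copy rfl (congrArg x h)
  | m + 1, a, b, h => .cons (hx a) (walkAlong x hx m (a + 1) b (by omega))

section Walk

variable {x : ℕ → V} {hx : ∀ j, G.Adj (x j) (x (j + 1))}

lemma length_walkAlong : ∀ (m a b : ℕ) (h : a + m = b), (walkAlong x hx m a b h).length = m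
  | 0, _, _, _ => by simp [walkAlong]
  | m + 1, a, b, h => by simp [walkAlong, length_walkAlong m]

lemma getVert_walkAlong : ∀ (m a b : ℕ) (h : a + m = b) (j : ℕ), j ≤ m →
    (walkAlong x hx m a b h).getVert j = x (a + j)
  | 0, a, _, _, j, hj => by
    obtain rfl : j = 0 := by omega
    simp
  | m + 1, a, b, h, 0, _ => by simp
  | m + 1, a, b, h, j + 1, hj => by
    rw [walkAlong, SimpleGraph.Walk.getVert_cons_succ, getVert_walkAlong m _ _ _ j (by omega)]
    congr 1
    omega

lemma support_walkAlong : ∀ (m a b : ℕ) (h : a + m = b),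
    (walkAlong x hx m a b h).support = (List.range' a (m + 1)).map x
  | 0, _, _, _ => by simp [walkAlong]
  | m + 1, a, b, h => by
    rw [walkAlong, SimpleGraph.Walk.support_cons, support_walkAlong m,
      List.range'_succ (n := m + 1), List.map_cons]

lemma edges_walkAlong : ∀ (m a b : ℕ) (h : a + m = b),
    (walkAlong x hx m a b h).edges = (List.range' a m).map fun j => s(x j, x (j + 1))
  | 0, _, _, _ => by simp [walkAlong]
  | m + 1, a, b, h => by
    rw [walkAlong, SimpleGraph.Walk.edges_cons, edges_walkAlong m, List.range'_succ, List.map_cons]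

end Walk

/-- A periodic enumeration of the vertices with consecutive ones adjacent gives a Hamilton cycle. -/
lemma exists_isHamiltonianCycle [Fintype V] [DecidableEq V] {n : ℕ} (hn : 3 ≤ n)
    (hV : Fintype.card V = n) (x : ℕ → V) (hx : ∀ j, G.Adj (x j) (x (j + 1))) (hper : x n = x 0)
    (hinj : ∀ i < n, ∀ j < n, x i = x j → i = j) :
    ∃ H : G.Walk (x 0) (x 0), H.IsHamiltonianCycle ∧ (∀ j < n, H.getVert j = x j) ∧
      ∀ e ∈ H.edges, ∃ j < n, e = s(x j, x (j + 1)) := by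
  refine ⟨.cons (hx 0) ((walkAlong x hx (n - 1) 1 n (by omega)).copy rfl hper), ?_, ?_, ?_⟩
  · rw [SimpleGraph.Walk.isHamiltonianCycle_iff_isCycle_and_length_eq,
      SimpleGraph.Walk.cons_isCycle_iff]
    have hinj' : ∀ i, 1 ≤ i → i ≤ n → ∀ j, 1 ≤ j → j ≤ n → x i = x j → i = j := by
      have key : ∀ i, 1 ≤ i → i ≤ n → x i = x 0 → i = n := fun i hi hi' h => by
        by_contra hne
        have := hinj i (by omega) 0 (by omega) h
        omega
      intro i hi hi' j hj hj' h
      rcases Nat.lt_or_ge i n with h1 | h1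
      · rcases Nat.lt_or_ge j n with h2 | h2
        · exact hinj i h1 j h2 h
        · obtain rfl : j = n := by omega
          exact key i hi hi' (h.trans hper)
      · obtain rfl : i = n := by omega
        exact (key j hj hj' (h.symm.trans hper)).symm
    refine ⟨⟨?_, ?_⟩, ?_⟩
    · rw [SimpleGraph.Walk.isPath_copy, SimpleGraph.Walk.isPath_def, support_walkAlong]
      refine List.Nodup.map_on (fun i hi j hj h => ?_) List.nodup_range'
      rw [List.mem_range'_1] at hi hj
      exact hinj' i hi.1 (by omega) j hj.1 (by omega) h
    · rw [SimpleGraph.Walk.edges_copy, edges_walkAlong, List.mem_map]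
      rintro ⟨j, hj, h⟩
      rw [List.mem_range'_1] at hj
      rcases Sym2.eq_iff.1 h with ⟨h1, -⟩ | ⟨h1, h2⟩
      · have := hinj j (by omega) 0 (by omega) h1
        omega
      · have h3 := hinj' j (by omega) (by omega) 1 (by omega) (by omega) h1
        rw [← hper] at h2
        have h4 := hinj' (j + 1) (by omega) (by omega) n (by omega) (by omega) h2
        omega
    · rw [SimpleGraph.Walk.length_cons, SimpleGraph.Walk.length_copy, length_walkAlong, hV]
      omega
  · intro j hj
    rcases j with _ | j
    · simp
    · rw [SimpleGraph.Walk.getVert_cons_succ, SimpleGraph.Walk.getVert_copy,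
        getVert_walkAlong _ _ _ _ _ (by omega), Nat.add_comm]
  · intro e he
    rw [SimpleGraph.Walk.edges_cons, SimpleGraph.Walk.edges_copy, edges_walkAlong,
      List.mem_cons, List.mem_map] at he
    rcases he with rfl | ⟨j, hj, rfl⟩
    · exact ⟨0, by omega, rfl⟩
    · rw [List.mem_range'_1] at hj
      exact ⟨j, by omega, rfl⟩

/-- If `G` has an `(i, k - i)`-bipartite-hole for each `i ≤ k / 2`, then it has an
`(s, t)`-bipartite-hole whenever `s + t ≤ k`. -/
lemma IsHoleCertificate.le_bipartiteHoleNumber [Fintype V] [Nonempty V] {k : ℕ}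
    {S T : ℕ → Finset V} (h : IsHoleCertificate G k S T) : k ≤ bipartiteHoleNumber G := by
  have hne : {r : ℕ | ∃ s t : ℕ, 0 < s ∧ 0 < t ∧ r = s + t - 1 ∧
      ¬ ∃ S T : Finset V, IsBipartiteHole G s t S T}.Nonempty := by
    refine ⟨_, 1, Fintype.card V, one_pos, Fintype.card_pos, rfl, ?_⟩
    rintro ⟨S, T, hST⟩
    classical
    have h1 := Finset.card_union_of_disjoint hST.disjoint
    have h2 := Finset.card_le_univ (S ∪ T)
    rw [hST.card_left, hST.card_right] at h1
    omega
  refine le_csInf hne ?_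
  rintro r ⟨s, t, hs, ht, rfl, hno⟩
  by_contra hlt
  rcases Nat.lt_or_ge (k / 2) s with h1 | h1
  · obtain ⟨d, c1, c2, e⟩ := h t ht (by omega)
    obtain ⟨T', hT', hc⟩ := Finset.exists_subset_card_eq (show s ≤ (T t).card by omega)
    exact hno ⟨T', S t, d.symm.mono_left hT', hc, c1, fun u hu v hv huv =>
      e v hv u (hT' hu) huv.symm⟩
  · obtain ⟨d, c1, c2, e⟩ := h s hs h1
    obtain ⟨T', hT', hc⟩ := Finset.exists_subset_card_eq (show t ≤ (T s).card by omega)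
    exact hno ⟨S s, T', d.mono_right hT', c1, hc, fun u hu v hv => e u hu v (hT' hv)⟩

end Graph

lemma card_filter_fin {n : ℕ} (p : ℕ → Prop) [DecidablePred p] :
    (Finset.univ.filter fun v : Fin n => p v).card = Nat.count p n := by
  rw [Nat.count_eq_card_filter_range]
  refine Finset.card_bij (fun v _ => (v : ℕ)) (fun v hv => ?_) (fun u _ v _ h => Fin.ext h)
    fun v hv => ?_
  · simp only [Finset.mem_filter, Finset.mem_range] at hv ⊢
    exact ⟨v.2, hv.2⟩
  · simp only [Finset.mem_filter, Finset.mem_range] at hv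
    exact ⟨⟨v, hv.1⟩, by simpa using hv.2, rfl⟩

/-! ### Reasoning about commands -/

namespace RAM

/-- Whether a command may assign to variable `y`. -/
def Cmd.writes : Cmd → ℕ → Bool
  | .skip, _ => false
  | .assign x _, y => x == y
  | .put _ _ _ _, _ => false
  | .seq p q, y => p.writes y || q.writes y
  | .ite _ p q, y => p.writes y || q.writes y
  | .forEach x p, y => x == y || p.writes y

/-- Whether a command may store into array `b`. -/
def Cmd.puts : Cmd → ℕ → Bool
  | .skip, _ => false
  | .assign _ _, _ => false
  | .put a _ _ _, b => a == b
  | .seq p q, b => p.puts b || q.puts b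
  | .ite _ p q, b => p.puts b || q.puts b
  | .forEach _ p, b => p.puts b

lemma iter_induct {f : ℕ → State → State} {h : State} (I : ℕ → State → Prop) (h0 : I 0 h) :
    ∀ n, (∀ k < n, ∀ h', I k h' → I (k + 1) (f k h')) → I n (iter f n h)
  | 0, _ => h0
  | n + 1, hs => hs n (by omega) _ (iter_induct I h0 n fun k hk => hs k (by omega))

lemma Cmd.eval_reg {n y : ℕ} (p : Cmd) : ∀ {h : State}, p.writes y = false →
    (p.eval n h).reg y = h.reg y := by
  induction p with
  | skip => exact fun _ => rfl
  | assign x e =>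
    intro h hw
    simp only [writes, beq_eq_false_iff_ne] at hw
    simp [eval, hw.symm]
  | put a i j e => exact fun _ => rfl
  | seq p q ihp ihq =>
    intro h hw
    simp only [writes, Bool.or_eq_false_iff] at hw
    exact (ihq hw.2).trans (ihp hw.1)
  | ite b p q ihp ihq =>
    intro h hw
    simp only [writes, Bool.or_eq_false_iff] at hw
    simp only [eval]
    split_ifs
    exacts [ihp hw.1, ihq hw.2]
  | forEach x p ih =>
    intro h hw
    simp only [writes, Bool.or_eq_false_iff, beq_eq_false_iff_ne] at hw
    refine iter_induct (fun _ h' => h'.reg y = h.reg y) rfl n fun k _ h' hk => ?_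
    rw [ih hw.2, ← hk]
    simp [hw.1.symm]

lemma Cmd.eval_arr {n b : ℕ} (p : Cmd) : ∀ {h : State}, p.puts b = false →
    (p.eval n h).arr b = h.arr b := by
  induction p with
  | skip => exact fun _ => rfl
  | assign x e => exact fun _ => rfl
  | put a i j e =>
    intro h hw
    simp only [puts, beq_eq_false_iff_ne] at hw
    funext q
    simp [eval, hw.symm]
  | seq p q ihp ihq =>
    intro h hw
    simp only [puts, Bool.or_eq_false_iff] at hw
    exact (ihq hw.2).trans (ihp hw.1)
  | ite b p q ihp ihq =>
    intro h hw
    simp only [puts, Bool.or_eq_false_iff] at hw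
    simp only [eval]
    split_ifs
    exacts [ihp hw.1, ihq hw.2]
  | forEach x p ih =>
    intro h hw
    exact iter_induct (fun _ h' => h'.arr b = h.arr b) rfl n fun k _ h' hk => (ih hw).trans hk

/-- The rule for loops: an invariant `I k` before round `k`. Variables and arrays that the loop does
not touch keep their values. -/
lemma Cmd.forEach_induct {n x : ℕ} {p : Cmd} {h : State} (I : ℕ → State → Prop) (h0 : I 0 h)
    (hs : ∀ k < n, ∀ h', (∀ y, (Cmd.forEach x p).writes y = false → h'.reg y = h.reg y) →
      (∀ b, p.puts b = false → h'.arr b = h.arr b) → I k h' →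
      I (k + 1) (p.eval n (h'.setReg x k))) :
    I n ((Cmd.forEach x p).eval n h) := by
  refine (iter_induct (fun k h' => (∀ y, (Cmd.forEach x p).writes y = false →
    h'.reg y = h.reg y) ∧ (∀ b, p.puts b = false → h'.arr b = h.arr b) ∧ I k h')
    ⟨fun _ _ => rfl, fun _ _ => rfl, h0⟩ n fun k hk h' ⟨h₁, h₂, h₃⟩ =>
      ⟨fun y hy => ?_, fun b hb => ?_, hs k hk h' h₁ h₂ h₃⟩).2.2
  · rw [← h₁ y hy]
    simp only [writes, Bool.or_eq_false_iff, beq_eq_false_iff_ne] at hy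
    rw [p.eval_reg hy.2]
    simp [hy.1.symm]
  · rw [p.eval_arr hb]
    exact h₂ b hb

section Eval

variable {n : ℕ} {h : State}

lemma Cmd.eval_skip : Cmd.skip.eval n h = h := rfl

lemma Cmd.eval_assign {x : ℕ} {e : Exp} :
    (Cmd.assign x e).eval n h = h.setReg x (e.eval n h) := rfl

lemma Cmd.eval_put {a : ℕ} {i j e : Exp} : (Cmd.put a i j e).eval n h =
    h.setArr a (n * i.eval n h + j.eval n h) (e.eval n h) := rfl

lemma Cmd.eval_seq {p q : Cmd} : (Cmd.seq p q).eval n h = q.eval n (p.eval n h) := rfl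

lemma Cmd.eval_ite_pos {b : Test} {p q : Cmd} (hb : b.Holds n h) :
    (Cmd.ite b p q).eval n h = p.eval n h := if_pos hb

lemma Cmd.eval_ite_neg {b : Test} {p q : Cmd} (hb : ¬ b.Holds n h) :
    (Cmd.ite b p q).eval n h = q.eval n h := if_neg hb

end Eval

/-- Equality as a test. -/
def Test.eq (e f : Exp) : Test := .and (.not (.lt e f)) (.not (.lt f e))

/-- The weak inequality as a test. -/
def Test.le (e f : Exp) : Test := .not (.lt f e)

@[simp] lemma Test.holds_eq {n : ℕ} {h : State} {e f : Exp} :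
    (Test.eq e f).Holds n h ↔ e.eval n h = f.eval n h := by
  simp only [Test.eq, Holds]
  omega

@[simp] lemma Test.holds_le {n : ℕ} {h : State} {e f : Exp} :
    (Test.le e f).Holds n h ↔ e.eval n h ≤ f.eval n h := by
  simp only [Test.le, Holds]
  omega

end RAM

/-! ### Commands that lengthen a path -/

namespace RAM

/-! The variables of the algorithm, and the arrays: the adjacency matrix (in which the entry `2`
marks the edges of the cycles found so far), the cycles, the two parts of the certificate, and the
list of vertices of which the first `xLen` form the current path. -/

local notation "xRes" => (0 : ℕ)
local notation "xK" => (1 : ℕ)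
local notation "xLen" => (2 : ℕ)
local notation "xFlag" => (3 : ℕ)
local notation "xA" => (4 : ℕ)
local notation "xB" => (5 : ℕ)
local notation "xI" => (6 : ℕ)
local notation "xJ" => (7 : ℕ)
local notation "xLo" => (8 : ℕ)
local notation "xHi" => (9 : ℕ)
local notation "xT" => (10 : ℕ)
local notation "xTmp" => (11 : ℕ)
local notation "xRound" => (12 : ℕ)
local notation "xStop" => (13 : ℕ)
local notation "xDeg" => (14 : ℕ)
local notation "xCount" => (15 : ℕ)
local notation "xOk" => (16 : ℕ)
local notation "xRow" => (17 : ℕ)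
local notation "xW" => (18 : ℕ)
local notation "xU" => (19 : ℕ)
local notation "xEnd" => (20 : ℕ)
local notation "xPrev" => (21 : ℕ)
local notation "xNum" => (22 : ℕ)
local notation "xTriple" => (23 : ℕ)
local notation "xTry" => (24 : ℕ)
local notation "arrAdj" => (0 : ℕ)
local notation "arrCyc" => (1 : ℕ)
local notation "arrS" => (2 : ℕ)
local notation "arrT" => (3 : ℕ)
local notation "arrPath" => (4 : ℕ)

local infixr:60 " ;; " => Cmd.seq

/-- The vertex at a position of the list. -/
def pathAt (e : Exp) : Exp := .get arrPath (.const 0) e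

/-- Adjacency in the graph without the edges of the cycles found so far. -/
def edge (e f : Exp) : Test := .eq (.get arrAdj e f) (.const 1)

/-- The relation that `edge` tests. -/
def Adj₁ (n : ℕ) (h : State) (u v : ℕ) : Prop := h.arr arrAdj (n * u + v) = 1

@[simp] lemma eval_pathAt {n : ℕ} {h : State} {e : Exp} :
    (pathAt e).eval n h = h.arr arrPath (e.eval n h) := by
  simp [pathAt, Exp.eval]

@[simp] lemma holds_edge {n : ℕ} {h : State} {e f : Exp} :
    (edge e f).Holds n h ↔ Adj₁ n h (e.eval n h) (f.eval n h) := by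
  simp [edge, Exp.eval, Adj₁]

lemma adj₁_congr {n : ℕ} {h h' : State} (harr : h'.arr arrAdj = h.arr arrAdj) :
    Adj₁ n h' = Adj₁ n h := by
  funext u v
  simp [Adj₁, harr]

/-- One round of `reverse`: exchange the entries at the positions `xLo` and `xHi`, and move these
positions towards each other. -/
def exchange : Cmd :=
  .ite (.lt (.var xLo) (.var xHi))
    (.assign xTmp (pathAt (.var xLo)) ;;
      .put arrPath (.const 0) (.var xLo) (pathAt (.var xHi)) ;;
      .put arrPath (.const 0) (.var xHi) (.var xTmp) ;;
      .assign xLo (.succ (.var xLo)) ;; .assign xHi (.sub (.var xHi) (.const 1)))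
    .skip

/-- Reverse the part of the list between two positions. -/
def reverse (e f : Exp) : Cmd :=
  .assign xLo e ;; .assign xHi f ;; .forEach xT exchange

lemma eval_reverse {n i j : ℕ} {h : State} {e f : Exp} (hi : e.eval n h = i)
    (hj : f.eval n (h.setReg xLo i) = j) (hij : i ≤ j + 1) (hjn : j < n) :
    ((reverse e f).eval n h).arr arrPath = revSeg i j (h.arr arrPath) := by
  obtain ⟨h1, h2, h3, h4, h5⟩ := Cmd.forEach_induct (n := n) (x := xT)
    (h := (h.setReg xLo i).setReg xHi j) (p := exchange)
    (fun k h' => i ≤ h'.reg xLo ∧ h'.reg xLo + h'.reg xHi = i + j ∧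
      h'.reg xLo ≤ h'.reg xHi + 1 ∧ (h'.reg xLo = i + k ∨ h'.reg xHi ≤ h'.reg xLo) ∧
      ∀ q, h'.arr arrPath q = if i ≤ q ∧ q ≤ j ∧ (q < h'.reg xLo ∨ h'.reg xHi < q) then
        h.arr arrPath (i + j - q) else h.arr arrPath q) (by
      refine ⟨by simp, by simp, by simpa using hij, by simp, fun q => ?_⟩
      simp only [setReg_reg, setReg_arr, if_true, reduceIte, Nat.reduceEqDiff]
      rw [if_neg (by omega)]) (by
      rintro k hk h' - - ⟨h1, h2, h3, h4, h5⟩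
      by_cases hlt : h'.reg xLo < h'.reg xHi
      · rw [exchange, Cmd.eval_ite_pos (by simpa [Test.Holds, Exp.eval] using hlt)]
        simp only [Cmd.eval_seq, Cmd.eval_assign, Cmd.eval_put, Exp.eval, setReg_reg, setReg_arr,
          setArr_reg, setArr_arr, Nat.reduceEqDiff, if_false, reduceIte, eval_pathAt, true_and]
        refine ⟨by omega, by omega, by omega, by omega, fun q => ?_⟩
        have hlo := h5 (h'.reg xLo)
        have hhi := h5 (h'.reg xHi)
        rw [if_neg (by omega)] at hlo hhi
        simp only [Nat.mul_zero, Nat.zero_add]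
        rw [hlo, hhi, h5 q]
        by_cases hq1 : q = h'.reg xHi
        · rw [if_pos hq1, if_pos (by omega)]
          congr 1
          omega
        · rw [if_neg hq1]
          by_cases hq2 : q = h'.reg xLo
          · rw [if_pos hq2, if_pos (by omega)]
            congr 1
            omega
          · rw [if_neg hq2]
            by_cases hq3 : i ≤ q ∧ q ≤ j ∧ (q < h'.reg xLo ∨ h'.reg xHi < q)
            · rw [if_pos hq3, if_pos (by omega)]
            · rw [if_neg hq3, if_neg (by omega)]
      · rw [exchange, Cmd.eval_ite_neg (by simpa [Test.Holds, Exp.eval] using hlt)]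
        simp only [Cmd.eval_skip, setReg_reg, setReg_arr, Nat.reduceEqDiff, if_false]
        exact ⟨h1, h2, h3, by omega, h5⟩)
  simp only [reverse, Cmd.eval_seq, Cmd.eval_assign, hi, hj]
  funext q
  rw [h5 q, revSeg]
  split_ifs
  · rfl
  · omega
  · congr 1
    omega
  · rfl

/-- One round of `search`: if the flag is not yet set and the test succeeds, set the flag and store
the current pair. -/
def probe (c : Test) : Cmd :=
  .ite (.and (.lt (.var xFlag) (.const 1)) c)
    (.assign xA (.var xI) ;; .assign xB (.var xJ) ;; .assign xFlag (.const 1)) .skip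

/-- Search for values of `xI` and `xJ` that satisfy a test, and store the first pair found in `xA`
and `xB`. -/
def search (c : Test) : Cmd :=
  .assign xFlag (.const 0) ;; .forEach xI (.forEach xJ (probe c))

/-- `h'` differs from `h` at most in the variables that `search` uses. -/
def SearchFrame (h h' : State) : Prop :=
  (∀ y, (y < xFlag ∨ xJ < y) → h'.reg y = h.reg y) ∧ h'.arr = h.arr

lemma search_frame {n : ℕ} (h : State) (c : Test) : SearchFrame h ((search c).eval n h) := by
  refine ⟨fun y hy => Cmd.eval_reg _ ?_, funext fun b => Cmd.eval_arr _ rfl⟩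
  simp [search, probe, Cmd.writes]
  omega

/-- The test is assumed to express a relation `C` between `xI` and `xJ` in all states that may occur
during the search. -/
lemma eval_search {n : ℕ} {h : State} {c : Test} {C : ℕ → ℕ → Prop}
    (hc : ∀ h', SearchFrame h h' → (c.Holds n h' ↔ C (h'.reg xI) (h'.reg xJ))) :
    (((search c).eval n h).reg xFlag = 1 ∧ ((search c).eval n h).reg xA < n ∧
      ((search c).eval n h).reg xB < n ∧
      C (((search c).eval n h).reg xA) (((search c).eval n h).reg xB)) ∨
    (((search c).eval n h).reg xFlag = 0 ∧ ∀ a < n, ∀ b < n, ¬ C a b) := by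
  let Found (h' : State) : Prop := h'.reg xFlag = 1 ∧ h'.reg xA < n ∧
      h'.reg xB < n ∧ C (h'.reg xA) (h'.reg xB)
  refine Cmd.forEach_induct (n := n) (x := xI) (p := .forEach xJ (probe c))
    (h := h.setReg xFlag 0)
    (fun k h' => Found h' ∨ (h'.reg xFlag = 0 ∧ ∀ a < k, ∀ b < n, ¬ C a b))
    (.inr ⟨by simp, by simp⟩) ?_
  intro k hk h' hreg harr hI
  have := Cmd.forEach_induct (n := n) (x := xJ) (h := h'.setReg xI k) (p := probe c)
    (fun l h'' => Found h'' ∨ (h''.reg xFlag = 0 ∧ (∀ a < k, ∀ b < n, ¬ C a b) ∧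
      ∀ b < l, ¬ C k b)) ?_ ?_
  · refine this.imp_right fun ⟨h1, h2, h3⟩ => ⟨h1, fun a ha => ?_⟩
    rcases Nat.lt_succ_iff_lt_or_eq.1 ha with ha | rfl
    exacts [h2 a ha, h3]
  · refine hI.imp (fun h => ?_) fun h => ⟨by simpa using h.1, h.2, by simp⟩
    simpa [Found] using h
  · intro l hl h'' hreg' harr' hI'
    have hframe : SearchFrame h (h''.setReg xJ l) := by
      refine ⟨fun y hy => ?_, ?_⟩
      · have e1 : y ≠ xFlag := by omega
        have e2 : y ≠ xI := by omega
        have e3 : y ≠ xJ := by omega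
        have e4 : y ≠ xA := by omega
        have e5 : y ≠ xB := by omega
        have := hreg' y (by simp [probe, Cmd.writes]; omega)
        simp only [setReg_reg, e3, if_false, this, e2]
        rw [hreg y (by simp [probe, Cmd.writes]; omega)]
        simp [e1]
      · funext b
        rw [setReg_arr, harr' b rfl, setReg_arr, harr b rfl, setReg_arr]
    have hk'' : h''.reg xI = k := by
      rw [hreg' xI rfl]
      simp
    have hiff : (Test.and (.lt (.var xFlag) (.const 1)) c).Holds n (h''.setReg xJ l) ↔
        h''.reg xFlag < 1 ∧ C k l := by
      simp [Test.Holds, hc _ hframe, hk'', Exp.eval]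
    rcases hI' with hf | ⟨hf, h1, h2⟩
    · left
      rw [probe, Cmd.eval_ite_neg (by rw [hiff, hf.1]; simp)]
      simpa [Found, Cmd.eval_skip] using hf
    · by_cases hC : C k l
      · left
        rw [probe, Cmd.eval_ite_pos (by rw [hiff, hf]; simpa using hC)]
        simp [Cmd.eval_seq, Cmd.eval_assign, Exp.eval, hC, Found, hk'', hk, hl]
      · right
        rw [probe, Cmd.eval_ite_neg (by rw [hiff]; exact fun h => hC h.2)]
        refine ⟨by simpa [Cmd.eval_skip] using hf, h1, fun b hb => ?_⟩
        rcases Nat.lt_succ_iff_lt_or_eq.1 hb with hb | rfl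
        exacts [h2 b hb, hC]

/-- Search for a pair that satisfies a test; if there is one, act on it. -/
def move (c : Test) (act : Cmd) : Cmd :=
  search c ;; .ite (.eq (.var xFlag) (.const 1)) act .skip

/-- `V` is the part of the memory that is of interest; the search does not touch it. -/
lemma eval_move {α : Type*} {n : ℕ} {h : State} {c : Test} {act : Cmd} {C : ℕ → ℕ → Prop}
    {F : ℕ → ℕ → α} (V : State → α)
    (hc : ∀ h', SearchFrame h h' → (c.Holds n h' ↔ C (h'.reg xI) (h'.reg xJ)))
    (hact : ∀ h', SearchFrame h h' → h'.reg xA < n → h'.reg xB < n →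
      C (h'.reg xA) (h'.reg xB) → V (act.eval n h') = F (h'.reg xA) (h'.reg xB))
    (hV : ∀ h', SearchFrame h h' → V h' = V h) :
    Moved n C F (V h) (V ((move c act).eval n h)) := by
  have hfr := search_frame (n := n) h c
  rw [move, Cmd.eval_seq]
  rcases eval_search hc with ⟨h1, h2, h3, h4⟩ | ⟨h1, h2⟩
  · rw [Cmd.eval_ite_pos (by simpa [Exp.eval] using h1)]
    exact .inl ⟨_, h2, _, h3, h4, hact _ hfr h2 h3 h4⟩
  · rw [Cmd.eval_ite_neg (by simp [Exp.eval, h1])]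
    exact .inr ⟨h2, hV _ hfr⟩

lemma adj₁_of_searchFrame {n : ℕ} {h h' : State} (hf : SearchFrame h h') :
    Adj₁ n h' = Adj₁ n h := adj₁_congr (by rw [hf.2])

/-- The last position of the path. -/
def lastPos : Exp := .sub (.var xLen) (.const 1)

/-- The test for `Closed`. -/
def closedTest : Test := edge (pathAt (.const 0)) (pathAt lastPos)

lemma holds_closedTest {n : ℕ} {h : State} :
    closedTest.Holds n h ↔ Closed (Adj₁ n h) (h.arr arrPath) (h.reg xLen) := by
  simp [closedTest, Closed, lastPos, Exp.eval]

/-- The test for `CanCloseOutward`. -/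
def outwardTest : Test :=
  .and (.not closedTest) (.and (.le (.const 1) (.var xI)) (.and (.le (.var xI) (.var xJ))
    (.and (.lt (.succ (.var xJ)) (.var xLen))
    (.and (edge (pathAt (.const 0)) (pathAt (.var xI)))
    (.and (edge (pathAt lastPos) (pathAt (.var xJ)))
      (edge (pathAt (.sub (.var xI) (.const 1))) (pathAt (.succ (.var xJ)))))))))

/-- The test for `CanCloseCrossing`. -/
def crossingTest : Test :=
  .and (.not closedTest) (.and (.le (.const 1) (.var xJ)) (.and (.lt (.var xJ) (.var xI))
    (.and (.lt (.var xI) (.var xLen))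
    (.and (edge (pathAt (.const 0)) (pathAt (.var xI)))
    (.and (edge (pathAt lastPos) (pathAt (.var xJ)))
      (edge (pathAt (.sub (.var xI) (.const 1))) (pathAt (.sub (.var xJ) (.const 1)))))))))

/-- The test for `CanLeave`. -/
def leaveTest : Test :=
  .and closedTest (.and (.lt (.var xI) (.var xLen)) (.and (.le (.var xLen) (.var xJ))
    (edge (pathAt (.var xI)) (pathAt (.var xJ)))))

/-- The test for `CanExtendFront`. -/
def frontTest : Test :=
  .and (.le (.var xLen) (.var xJ)) (edge (pathAt (.const 0)) (pathAt (.var xJ)))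

/-- The test for `CanExtendBack`. -/
def backTest : Test :=
  .and (.le (.var xLen) (.var xJ)) (edge (pathAt lastPos) (pathAt (.var xJ)))

/-- The move for `CanCloseOutward`. -/
def outwardMove : Cmd := move outwardTest
  (reverse (.const 0) (.sub (.var xA) (.const 1)) ;; reverse (.succ (.var xB)) lastPos)

/-- The move for `CanCloseCrossing`. -/
def crossingMove : Cmd := move crossingTest
  (reverse (.const 0) (.sub (.var xA) (.const 1)) ;; reverse (.sub (.var xA) (.var xB)) lastPos)

/-- The move for `CanLeave`. -/
def leaveMove : Cmd := move leaveTest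
  (reverse (.const 0) (.var xA) ;; reverse (.succ (.var xA)) lastPos)

/-- The move for `CanExtendFront`. -/
def frontMove : Cmd := move frontTest (reverse (.const 0) lastPos)

/-- The move for `CanExtendBack`. -/
def backMove : Cmd := move backTest
  (reverse (.var xLen) (.var xB) ;; .assign xLen (.succ (.var xLen)))

section Moves

variable {n : ℕ} {h : State}

lemma eval_outwardMove (hL : h.reg xLen ≤ n) :
    Moved n (CanCloseOutward (Adj₁ n h) (h.arr arrPath) (h.reg xLen))
      (fun a b => revSeg (b + 1) (h.reg xLen - 1) (revSeg 0 (a - 1) (h.arr arrPath)))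
      (h.arr arrPath) ((outwardMove.eval n h).arr arrPath) := by
  refine eval_move (fun h => h.arr arrPath) (fun h' hf => ?_) (fun h' hf ha hb hC => ?_)
    fun h' hf => by rw [hf.2]
  · simp [outwardTest, CanCloseOutward, Test.Holds, holds_closedTest, adj₁_of_searchFrame hf,
      hf.2, hf.1 xLen (by simp), Exp.eval, lastPos]
  · rw [Cmd.eval_seq, eval_reverse (i := h'.reg xB + 1) (j := h.reg xLen - 1),
      eval_reverse (i := 0) (j := h'.reg xA - 1), hf.2]
    · simp [Exp.eval]
    · simp [Exp.eval]
    · omega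
    · omega
    · rw [Exp.eval, Exp.eval, Cmd.eval_reg _ rfl]
    · simp [Exp.eval, lastPos]
      rw [Cmd.eval_reg _ rfl, hf.1 xLen (by simp)]
    · have := hC.2.2.2.1
      omega
    · omega

lemma eval_crossingMove (hL : h.reg xLen ≤ n) :
    Moved n (CanCloseCrossing (Adj₁ n h) (h.arr arrPath) (h.reg xLen))
      (fun a b => revSeg (a - b) (h.reg xLen - 1) (revSeg 0 (a - 1) (h.arr arrPath)))
      (h.arr arrPath) ((crossingMove.eval n h).arr arrPath) := by
  refine eval_move (fun h => h.arr arrPath) (fun h' hf => ?_) (fun h' hf ha hb hC => ?_)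
    fun h' hf => by rw [hf.2]
  · simp [crossingTest, CanCloseCrossing, Test.Holds, holds_closedTest, adj₁_of_searchFrame hf,
      hf.2, hf.1 xLen (by simp), Exp.eval, lastPos]
  · rw [Cmd.eval_seq, eval_reverse (i := h'.reg xA - h'.reg xB) (j := h.reg xLen - 1),
      eval_reverse (i := 0) (j := h'.reg xA - 1), hf.2]
    · simp [Exp.eval]
    · simp [Exp.eval]
    · omega
    · omega
    · simp only [Exp.eval]
      rw [Cmd.eval_reg _ rfl, Cmd.eval_reg _ rfl]
    · simp [Exp.eval, lastPos]
      rw [Cmd.eval_reg _ rfl, hf.1 xLen (by simp)]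
    · have := hC.2.2.2.1
      omega
    · omega

lemma eval_leaveMove (hL : h.reg xLen ≤ n) :
    Moved n (CanLeave (Adj₁ n h) (h.arr arrPath) (h.reg xLen))
      (fun a _ => revSeg (a + 1) (h.reg xLen - 1) (revSeg 0 a (h.arr arrPath)))
      (h.arr arrPath) ((leaveMove.eval n h).arr arrPath) := by
  refine eval_move (fun h => h.arr arrPath) (fun h' hf => ?_) (fun h' hf ha hb hC => ?_)
    fun h' hf => by rw [hf.2]
  · simp [leaveTest, CanLeave, Test.Holds, holds_closedTest, adj₁_of_searchFrame hf,
      hf.2, hf.1 xLen (by simp), Exp.eval]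
  · rw [Cmd.eval_seq, eval_reverse (i := h'.reg xA + 1) (j := h.reg xLen - 1),
      eval_reverse (i := 0) (j := h'.reg xA), hf.2]
    · simp [Exp.eval]
    · simp [Exp.eval]
    · omega
    · omega
    · rw [Exp.eval, Exp.eval, Cmd.eval_reg _ rfl]
    · simp [Exp.eval, lastPos]
      rw [Cmd.eval_reg _ rfl, hf.1 xLen (by simp)]
    · have := hC.2.1
      omega
    · omega

lemma eval_frontMove (hL : h.reg xLen ≤ n) :
    Moved n (fun _ => CanExtendFront (Adj₁ n h) (h.arr arrPath) (h.reg xLen))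
      (fun _ _ => revSeg 0 (h.reg xLen - 1) (h.arr arrPath))
      (h.arr arrPath) ((frontMove.eval n h).arr arrPath) := by
  refine eval_move (fun h => h.arr arrPath) (fun h' hf => ?_) (fun h' hf ha hb hC => ?_)
    fun h' hf => by rw [hf.2]
  · simp [frontTest, CanExtendFront, Test.Holds, adj₁_of_searchFrame hf,
      hf.2, hf.1 xLen (by simp), Exp.eval]
  · rw [eval_reverse (i := 0) (j := h.reg xLen - 1), hf.2]
    · simp [Exp.eval]
    · simp [Exp.eval, lastPos, hf.1 xLen (by simp)]
    · omega
    · omega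

lemma eval_backMove :
    Moved n (fun _ => CanExtendBack (Adj₁ n h) (h.arr arrPath) (h.reg xLen))
      (fun _ b => (revSeg (h.reg xLen) b (h.arr arrPath), h.reg xLen + 1))
      (h.arr arrPath, h.reg xLen)
      ((backMove.eval n h).arr arrPath, (backMove.eval n h).reg xLen) := by
  refine eval_move (fun h => (h.arr arrPath, h.reg xLen)) (fun h' hf => ?_)
    (fun h' hf ha hb hC => ?_) fun h' hf => by rw [hf.2, hf.1 xLen (by simp)]
  · simp [backTest, CanExtendBack, Test.Holds, adj₁_of_searchFrame hf,
      hf.2, hf.1 xLen (by simp), Exp.eval, lastPos]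
  · rw [Cmd.eval_seq, Cmd.eval_assign, setReg_arr, eval_reverse (i := h.reg xLen)
      (j := h'.reg xB), hf.2]
    · simp only [setReg_reg, Exp.eval, if_true]
      rw [Cmd.eval_reg _ rfl, hf.1 xLen (by simp)]
    · simp [Exp.eval, hf.1 xLen (by simp)]
    · simp [Exp.eval]
    · have := hC.1
      omega
    · exact hb

end Moves

/-- One round of moves. -/
def round : Cmd := outwardMove ;; crossingMove ;; leaveMove ;; frontMove ;; backMove

lemma eval_round {n : ℕ} {h : State} {A : ℕ → ℕ → Prop} (hadj : Adj₁ n h = A) (hA : IsAdj A n)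
    (hf : IsPathPerm A n (h.arr arrPath) (h.reg xLen)) :
    IsPathPerm A n ((round.eval n h).arr arrPath) ((round.eval n h).reg xLen) ∧
      ((round.eval n h).reg xLen = h.reg xLen + 1 ∨
        Stuck A n ((round.eval n h).arr arrPath) ((round.eval n h).reg xLen)) ∧
      (Stuck A n (h.arr arrPath) (h.reg xLen) →
        ((round.eval n h).arr arrPath, (round.eval n h).reg xLen) =
          (h.arr arrPath, h.reg xLen)) := by
  simp only [round, Cmd.eval_seq]
  set h₁ := outwardMove.eval n h with hh₁
  set h₂ := crossingMove.eval n h₁ with hh₂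
  set h₃ := leaveMove.eval n h₂ with hh₃
  set h₄ := frontMove.eval n h₃ with hh₄
  have e₁ : h₁.reg xLen = h.reg xLen := Cmd.eval_reg _ rfl
  have e₂ : h₂.reg xLen = h.reg xLen := (Cmd.eval_reg _ rfl).trans e₁
  have e₃ : h₃.reg xLen = h.reg xLen := (Cmd.eval_reg _ rfl).trans e₂
  have e₄ : h₄.reg xLen = h.reg xLen := (Cmd.eval_reg _ rfl).trans e₃
  have a₁ : Adj₁ n h₁ = A := (adj₁_congr (Cmd.eval_arr _ rfl)).trans hadj
  have a₂ : Adj₁ n h₂ = A := (adj₁_congr (Cmd.eval_arr _ rfl)).trans a₁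
  have a₃ : Adj₁ n h₃ = A := (adj₁_congr (Cmd.eval_arr _ rfl)).trans a₂
  have a₄ : Adj₁ n h₄ = A := (adj₁_congr (Cmd.eval_arr _ rfl)).trans a₃
  have hL := hf.le
  have m₁ := eval_outwardMove (n := n) (h := h) hL
  have m₂ := eval_crossingMove (n := n) (h := h₁) (e₁.le.trans hL)
  have m₃ := eval_leaveMove (n := n) (h := h₂) (e₂.le.trans hL)
  have m₄ := eval_frontMove (n := n) (h := h₃) (e₃.le.trans hL)
  have m₅ := eval_backMove (n := n) (h := h₄)
  rw [hadj] at m₁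
  rw [a₁, e₁] at m₂
  rw [a₂, e₂] at m₃
  rw [a₃, e₃] at m₄
  rw [a₄, e₄] at m₅
  exact round_of_moves hA hf m₁ m₂ m₃ m₄ m₅

/-- Start from the path that consists of vertex `0` and make `n` rounds of moves. -/
def growPath : Cmd :=
  .forEach xT (.put arrPath (.const 0) (.var xT) (.var xT)) ;; .assign xLen (.const 1) ;;
    .forEach xRound round

/-- Since each round lengthens the path unless it is stuck, the path is stuck in the end. -/
lemma eval_growPath {n : ℕ} {h : State} (hn : 1 ≤ n) (hA : IsAdj (Adj₁ n h) n) :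
    IsPathPerm (Adj₁ n h) n ((growPath.eval n h).arr arrPath) ((growPath.eval n h).reg xLen) ∧
      Stuck (Adj₁ n h) n ((growPath.eval n h).arr arrPath) ((growPath.eval n h).reg xLen) := by
  simp only [growPath, Cmd.eval_seq, Cmd.eval_assign]
  set h₁ := (Cmd.forEach xT (.put arrPath (.const 0) (.var xT) (.var xT))).eval n h with hh₁
  have a₁ : Adj₁ n h₁ = Adj₁ n h := adj₁_congr (Cmd.eval_arr _ rfl)
  have hid : ∀ q < n, h₁.arr arrPath q = q := by
    refine Cmd.forEach_induct (fun k h' => ∀ q < k, h'.arr arrPath q = q) (by simp) ?_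
    intro k hk h' _ _ hI q hq
    simp only [Cmd.eval_put, Exp.eval, setArr_arr, setReg_reg, setReg_arr, Nat.mul_zero,
      Nat.zero_add, if_true, true_and]
    split_ifs with hqk
    · exact hqk.symm
    · exact hI q (by omega)
  have h0 : IsPathPerm (Adj₁ n h) n (h₁.arr arrPath) 1 :=
    { lt := fun i hi => by rwa [hid i hi]
      inj := fun i hi j hj hij => by rwa [hid i hi, hid j hj] at hij
      pos := le_rfl
      le := hn
      adj := fun i hi => by omega }
  obtain ⟨h1, h2⟩ := Cmd.forEach_induct (n := n) (x := xRound) (p := round)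
    (h := h₁.setReg xLen ((Exp.const 1).eval n h₁))
    (fun k h' => IsPathPerm (Adj₁ n h) n (h'.arr arrPath) (h'.reg xLen) ∧
      (k + 1 ≤ h'.reg xLen ∨ Stuck (Adj₁ n h) n (h'.arr arrPath) (h'.reg xLen)))
    (by simpa [Exp.eval] using h0) (by
      intro k hk h' hreg harr hI
      have a' : Adj₁ n (h'.setReg xRound k) = Adj₁ n h :=
        (adj₁_congr (harr 0 rfl)).trans a₁
      obtain ⟨r1, r2, r3⟩ := eval_round a' hA (by simpa using hI.1)
      refine ⟨r1, ?_⟩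
      rcases hI.2 with hk' | hs
      · refine r2.imp_left fun r2 => ?_
        simp only [setReg_reg, Nat.reduceEqDiff, if_false] at r2
        omega
      · right
        obtain ⟨e1, e2⟩ := Prod.ext_iff.1 (r3 (by simpa using hs))
        simp only [setReg_reg, Nat.reduceEqDiff, if_false, setReg_arr] at e1 e2
        rw [e1, e2]
        exact hs)
  refine ⟨h1, h2.resolve_left fun h3 => ?_⟩
  have := h1.le
  omega

/-! ### Removing a Hamilton cycle -/

lemma address_inj {n i j i' j' : ℕ} (hj : j < n) (hj' : j' < n) :
    n * i + j = n * i' + j' ↔ i = i' ∧ j = j' := by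
  refine ⟨fun h => ?_, fun h => by rw [h.1, h.2]⟩
  have hn : 0 < n := by omega
  have h1 : (n * i + j) / n = i := by
    rw [Nat.mul_add_div hn, Nat.div_eq_of_lt hj, Nat.add_zero]
  have h2 : (n * i' + j') / n = i' := by
    rw [Nat.mul_add_div hn, Nat.div_eq_of_lt hj', Nat.add_zero]
  have h3 : i = i' := by rw [← h1, h, h2]
  subst h3
  exact ⟨rfl, by omega⟩

/-- The position before `j` in cyclic order. -/
def predPos (n j : ℕ) : ℕ := if j = 0 then n - 1 else j - 1

lemma predPos_lt {n j : ℕ} (hj : j < n) : predPos n j < n := by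
  unfold predPos
  split_ifs <;> omega

/-- `u` and `v` are consecutive entries, in cyclic order, of the list `f 0, …, f (n - 1)`; the
position of the second one is less than `k`. -/
def CycEdge (n : ℕ) (f : ℕ → ℕ) (k u v : ℕ) : Prop :=
  ∃ j < k, (u = f (predPos n j) ∧ v = f j) ∨ (v = f (predPos n j) ∧ u = f j)

/-- One round of `recordCycle`. -/
def recordStep : Cmd :=
  .put arrCyc (.var xRes) (.var xT) (pathAt (.var xT)) ;;
  .put arrAdj (.var xPrev) (pathAt (.var xT)) (.const 2) ;;
  .put arrAdj (pathAt (.var xT)) (.var xPrev) (.const 2) ;;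
  .assign xPrev (pathAt (.var xT))

/-- Store the list of vertices as the next cycle, and mark its edges. -/
def recordCycle : Cmd :=
  .assign xPrev (pathAt (.sub .size (.const 1))) ;; .forEach xT recordStep ;;
    .assign xRes (.succ (.var xRes))

open Classical in
/-- The invariant of the loop is that the edges with second vertex at a position before `k` are
marked. -/
lemma eval_recordCycle {n : ℕ} {h : State} (hf : IsPerm n (h.arr arrPath)) :
    (∀ j < n, (recordCycle.eval n h).arr arrCyc (n * h.reg xRes + j) = h.arr arrPath j) ∧
    (∀ i ≠ h.reg xRes, ∀ j < n,
      (recordCycle.eval n h).arr arrCyc (n * i + j) = h.arr arrCyc (n * i + j)) ∧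
    (∀ u < n, ∀ v < n, (recordCycle.eval n h).arr arrAdj (n * u + v) =
      if CycEdge n (h.arr arrPath) n u v then 2 else h.arr arrAdj (n * u + v)) ∧
    (recordCycle.eval n h).reg xRes = h.reg xRes + 1 := by
  set f := h.arr arrPath with hfdef
  set r := h.reg xRes with hr
  set h₁ := h.setReg xPrev (f (n - 1)) with hh₁
  have e : recordCycle.eval n h = ((Cmd.forEach xT recordStep).eval n h₁).setReg xRes
      (((Cmd.forEach xT recordStep).eval n h₁).reg xRes + 1) := by
    simp [recordCycle, Cmd.eval_seq, Cmd.eval_assign, Exp.eval, hh₁, hfdef]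
  rw [e]
  have key := Cmd.forEach_induct (n := n) (x := xT) (p := recordStep) (h := h₁)
    (fun k h' => h'.reg xPrev = f (predPos n k) ∧
      (∀ j < k, h'.arr arrCyc (n * r + j) = f j) ∧
      (∀ i ≠ r, ∀ j < n, h'.arr arrCyc (n * i + j) = h.arr arrCyc (n * i + j)) ∧
      ∀ u < n, ∀ v < n, h'.arr arrAdj (n * u + v) =
        if CycEdge n f k u v then 2 else h.arr arrAdj (n * u + v)) ?_ ?_
  · obtain ⟨-, h2, h3, h4⟩ := key
    refine ⟨h2, h3, h4, ?_⟩
    rw [setReg_reg, if_pos rfl, Cmd.eval_reg _ rfl]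
    simp [hh₁, hr]
  · simp [predPos, CycEdge, hh₁]
  · rintro k hk h' hreg harr ⟨h1, h2, h3, h4⟩
    have hres : h'.reg xRes = r := by
      rw [hreg _ rfl]
      simp [hh₁, hr]
    have hpath : h'.arr arrPath = f := by
      rw [harr _ rfl]
      simp [hh₁, hfdef]
    have hpred := predPos_lt hk
    simp only [recordStep, Cmd.eval_seq, Cmd.eval_put, Cmd.eval_assign, Exp.eval, eval_pathAt,
      setReg_reg, setReg_arr, setArr_reg, setArr_arr, if_true, Nat.reduceEqDiff, if_false,
      false_and, hres, hpath, h1, true_and, OfNat.ofNat_ne_zero, OfNat.zero_ne_ofNat,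
      one_ne_zero, zero_ne_one, OfNat.ofNat_ne_one]
    refine ⟨by simp [predPos], fun j hj => ?_, fun i hi j hj => ?_, fun u hu v hv => ?_⟩
    · by_cases hjk : j = k
      · simp [hjk]
      · rw [if_neg (by omega)]
        exact h2 j (by omega)
    · rw [if_neg (by rw [address_inj hj hk]; exact fun h => hi h.1)]
      exact h3 i hi j hj
    · have hfk := hf.lt k hk
      have hfp := hf.lt _ hpred
      simp only [address_inj hv hfp, address_inj hv hfk, h4 u hu v hv]
      have hstep : CycEdge n f (k + 1) u v ↔ CycEdge n f k u v ∨
          (u = f (predPos n k) ∧ v = f k) ∨ (v = f (predPos n k) ∧ u = f k) := by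
        constructor
        · rintro ⟨j, hj, h⟩
          rcases Nat.lt_succ_iff_lt_or_eq.1 hj with hj | rfl
          exacts [.inl ⟨j, hj, h⟩, .inr h]
        · rintro (⟨j, hj, h⟩ | h)
          exacts [⟨j, by omega, h⟩, ⟨k, by omega, h⟩]
      simp only [hstep]
      by_cases c1 : u = f k ∧ v = f (predPos n k)
      · rw [if_pos c1, if_pos (.inr (.inr ⟨c1.2, c1.1⟩))]
      · rw [if_neg c1]
        by_cases c2 : u = f (predPos n k) ∧ v = f k
        · rw [if_pos c2, if_pos (.inr (.inl c2))]
        · rw [if_neg c2]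
          congr 1
          rw [eq_iff_iff]
          exact ⟨.inl, fun h => h.resolve_right fun h' =>
            h'.elim c2 fun h'' => c1 ⟨h''.2, h''.1⟩⟩

lemma CycEdge.symm {n k u v : ℕ} {f : ℕ → ℕ} (h : CycEdge n f k u v) : CycEdge n f k v u := by
  obtain ⟨j, hj, h | h⟩ := h
  exacts [⟨j, hj, .inr h⟩, ⟨j, hj, .inl h⟩]

open Classical in
/-- Every vertex has at most two neighbors on a cycle. -/
lemma count_cycEdge_le {n u : ℕ} {f : ℕ → ℕ} (hf : IsPerm n f) :
    Nat.count (CycEdge n f n u) n ≤ 2 := by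
  by_cases hu : ∃ j < n, f j = u
  · obtain ⟨j, hj, rfl⟩ := hu
    rw [Nat.count_eq_card_filter_range]
    refine (Finset.card_le_card (t := {f (predPos n j), f (if j + 1 = n then 0 else j + 1)})
      fun v hv => ?_).trans Finset.card_le_two
    obtain ⟨-, l, hl, ⟨h1, rfl⟩ | ⟨rfl, h1⟩⟩ := Finset.mem_filter.1 hv
    · have h2 := hf.inj j hj _ (predPos_lt hl) h1
      have h3 : (if j + 1 = n then 0 else j + 1) = l := by
        unfold predPos at h2
        split_ifs at h2 ⊢ <;> omega
      simp [h3]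
    · rw [hf.inj j hj l hl h1]
      simp
  · rw [Nat.count_eq_card_filter_range, Finset.filter_eq_empty_iff.2]
    · simp
    · rintro v - ⟨l, hl, ⟨h1, -⟩ | ⟨-, h1⟩⟩
      · exact hu ⟨predPos n l, predPos_lt hl, h1.symm⟩
      · exact hu ⟨l, hl, h1.symm⟩

/-! ### The minimum degree -/

/-- Count the neighbors of the vertex `xU`. -/
def countStep : Cmd :=
  .ite (edge (.var xU) (.var xW)) (.assign xCount (.succ (.var xCount))) .skip

/-- One round of `minDegree`. -/
def minDegreeStep : Cmd :=
  .assign xCount (.const 0) ;; .forEach xW countStep ;;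
    .ite (.lt (.var xCount) (.var xDeg)) (.assign xDeg (.var xCount)) .skip

/-- Compute the minimum degree. -/
def minDegree : Cmd := .assign xDeg .size ;; .forEach xU minDegreeStep

open Classical in
/-- The computed number is a lower bound for the degrees. As it is `n` or one of the degrees, it is
at least the minimum degree. -/
lemma eval_minDegree {n : ℕ} {h : State} :
    (∀ u < n, (minDegree.eval n h).reg xDeg ≤ Nat.count (Adj₁ n h u) n) ∧
      ((minDegree.eval n h).reg xDeg = n ∨
        ∃ u < n, (minDegree.eval n h).reg xDeg = Nat.count (Adj₁ n h u) n) := by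
  simp only [minDegree, Cmd.eval_seq, Cmd.eval_assign, Exp.eval]
  refine Cmd.forEach_induct (fun k h' => (∀ u < k, h'.reg xDeg ≤ Nat.count (Adj₁ n h u) n) ∧
    (h'.reg xDeg = n ∨ ∃ u < n, h'.reg xDeg = Nat.count (Adj₁ n h u) n)) (by simp) ?_
  rintro k hk h' hreg harr ⟨h1, h2⟩
  have hadj : Adj₁ n h' = Adj₁ n h := adj₁_congr (harr _ rfl)
  rw [minDegreeStep, Cmd.eval_seq, Cmd.eval_seq, Cmd.eval_assign]
  set h₁ := (h'.setReg xU k).setReg xCount ((Exp.const 0).eval n (h'.setReg xU k)) with hh₁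
  set h₂ := (Cmd.forEach xW countStep).eval n h₁ with hh₂
  have hc : h₂.reg xCount = Nat.count (Adj₁ n h k) n := by
    refine Cmd.forEach_induct (fun l h'' => h''.reg xCount = Nat.count (Adj₁ n h k) l)
      (by simp [hh₁, Exp.eval]) ?_
    intro l hl h'' hreg' harr' hI
    have hU : h''.reg xU = k := by
      rw [hreg' _ rfl]
      simp [hh₁]
    have hadj' : Adj₁ n (h''.setReg xW l) = Adj₁ n h := by
      rw [← hadj]
      exact adj₁_congr (harr' _ rfl)
    rw [Nat.count_succ]
    by_cases hA : Adj₁ n h k l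
    · rw [countStep, Cmd.eval_ite_pos (by simpa [hadj', Exp.eval, hU] using hA)]
      simp [Cmd.eval_assign, Exp.eval, hI, hA]
    · rw [countStep, Cmd.eval_ite_neg (by simpa [hadj', Exp.eval, hU] using hA)]
      simp [Cmd.eval_skip, hI, hA]
  have hd : h₂.reg xDeg = h'.reg xDeg := by
    rw [hh₂, Cmd.eval_reg _ rfl]
    simp [hh₁]
  have hlt : ∀ u < k + 1, u < k ∨ u = k := fun u hu => by omega
  by_cases hcase : h₂.reg xCount < h₂.reg xDeg
  · rw [Cmd.eval_ite_pos (by simpa [Test.Holds, Exp.eval] using hcase)]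
    simp only [Cmd.eval_assign, Exp.eval, setReg_reg, if_true]
    refine ⟨fun u hu => ?_, .inr ⟨k, hk, hc⟩⟩
    rcases hlt u hu with hu | rfl
    · have := h1 u hu
      omega
    · exact hc.le
  · rw [Cmd.eval_ite_neg (by simpa [Test.Holds, Exp.eval] using hcase), Cmd.eval_skip, hd]
    refine ⟨fun u hu => ?_, h2⟩
    rcases hlt u hu with hu | rfl
    · exact h1 u hu
    · omega

/-! ### The certificate -/

/-- One round of `clearRow`. -/
def clearStep : Cmd :=
  .put arrS (.var xRow) (.var xT) (.const 0) ;; .put arrT (.var xRow) (.var xT) (.const 0)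

/-- If the position `xT` of the path holds a neighbor of the vertex `xEnd`, and fewer than `xRow`
have been found before, then put the vertex before it into `S`. -/
def pickStep : Cmd :=
  .ite (.and (.le (.const 1) (.var xT)) (.and (.lt (.var xT) (.var xLen))
      (.and (edge (.var xEnd) (pathAt (.var xT))) (.lt (.var xCount) (.var xRow)))))
    (.put arrS (.var xRow) (pathAt (.sub (.var xT) (.const 1))) (.const 1) ;;
      .assign xCount (.succ (.var xCount)))
    .skip

/-- Fill row `xRow` of `S` with the vertices just before the first `xRow` neighbors of the vertex
`xEnd` on the path, and clear this row of `T`. -/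
def pickLeft : Cmd :=
  .forEach xT clearStep ;; .assign xCount (.const 0) ;; .forEach xT pickStep

/-- Reset the flag `xOk` if the vertex `xU` is in `S` and adjacent, in the input graph, to `xW`. -/
def freeTest : Cmd :=
  .ite (.and (.eq (.get arrS (.var xRow) (.var xU)) (.const 1))
    (.lt (.const 0) (.get arrAdj (.var xU) (.var xW)))) (.assign xOk (.const 0)) .skip

/-- Put the vertex `xW` into `T` if it is free and `T` is not yet complete. -/
def freeStep : Cmd :=
  .ite (.and (.lt (.var xNum) (.sub (.var xK) (.var xRow)))
      (.not (.eq (.get arrS (.var xRow) (.var xW)) (.const 1))))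
    (.assign xOk (.const 1) ;; .forEach xU freeTest ;;
      .ite (.eq (.var xOk) (.const 1))
        (.put arrT (.var xRow) (.var xW) (.const 1) ;; .assign xNum (.succ (.var xNum))) .skip)
    .skip

/-- Fill row `xRow` of `T` with the first vertices that are neither in row `xRow` of `S` nor
adjacent to a vertex in it. -/
def pickRight : Cmd := .assign xNum (.const 0) ;; .forEach xW freeStep

/-- Adjacency in the input graph: the entry is not `0`. -/
def Adj₀ (n : ℕ) (h : State) (u v : ℕ) : Prop := 0 < h.arr arrAdj (n * u + v)

lemma adj₀_congr {n : ℕ} {h h' : State} (harr : h'.arr arrAdj = h.arr arrAdj) :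
    Adj₀ n h' = Adj₀ n h := by
  funext u v
  simp [Adj₀, harr]

section Rows

variable {n : ℕ} {h : State}

lemma min_succ_of_lt {i c c' : ℕ} (hc : c = min i c') (hci : c < i) : c + 1 = min i (c' + 1) := by
  omega

open Classical in
lemma eval_pickLeft (hf : IsPerm n (h.arr arrPath)) (hL : h.reg xLen ≤ n) :
    (∀ w < n, (pickLeft.eval n h).arr arrS (n * h.reg xRow + w) = 1 ↔
      Before (Adj₁ n h) (h.arr arrPath) (h.reg xLen) (h.reg xEnd) (h.reg xRow) w) ∧
    (∀ i ≠ h.reg xRow, ∀ w < n,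
      (pickLeft.eval n h).arr arrS (n * i + w) = h.arr arrS (n * i + w)) ∧
    (∀ w < n, (pickLeft.eval n h).arr arrT (n * h.reg xRow + w) = 0) ∧
    (∀ i ≠ h.reg xRow, ∀ w < n,
      (pickLeft.eval n h).arr arrT (n * i + w) = h.arr arrT (n * i + w)) := by
  set f := h.arr arrPath with hfdef
  set i₀ := h.reg xRow with hi₀
  set p := NbrAt (Adj₁ n h) f (h.reg xLen) (h.reg xEnd) with hp
  simp only [pickLeft, Cmd.eval_seq, Cmd.eval_assign, Exp.eval]
  set h₁ := (Cmd.forEach xT clearStep).eval n h with hh₁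
  have clear : (∀ w < n, h₁.arr arrS (n * i₀ + w) = 0 ∧ h₁.arr arrT (n * i₀ + w) = 0) ∧
      ∀ i ≠ i₀, ∀ w < n, h₁.arr arrS (n * i + w) = h.arr arrS (n * i + w) ∧
        h₁.arr arrT (n * i + w) = h.arr arrT (n * i + w) := by
    refine Cmd.forEach_induct (fun k h' =>
      (∀ w < k, h'.arr arrS (n * i₀ + w) = 0 ∧ h'.arr arrT (n * i₀ + w) = 0) ∧
      ∀ i ≠ i₀, ∀ w < n, h'.arr arrS (n * i + w) = h.arr arrS (n * i + w) ∧
        h'.arr arrT (n * i + w) = h.arr arrT (n * i + w)) (by simp) ?_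
    rintro k hk h' hreg harr ⟨h1, h2⟩
    have hrow : h'.reg xRow = i₀ := hreg _ rfl
    simp only [clearStep, Cmd.eval_seq, Cmd.eval_put, Exp.eval, setReg_reg, setReg_arr,
      setArr_reg, setArr_arr, if_true, Nat.reduceEqDiff, if_false, false_and, true_and, hrow]
    refine ⟨fun w hw => ?_, fun i hi w hw => ?_⟩
    · by_cases hwk : w = k
      · simp [hwk]
      · rw [if_neg (by omega), if_neg (by omega)]
        exact h1 w (by omega)
    · have : ¬ n * i + w = n * i₀ + k := by
        rw [address_inj hw hk]
        exact fun h => hi h.1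
      rw [if_neg this, if_neg this]
      exact h2 i hi w hw
  have r₁ : h₁.reg xRow = i₀ := Cmd.eval_reg _ rfl
  have l₁ : h₁.reg xLen = h.reg xLen := Cmd.eval_reg _ rfl
  have v₁ : h₁.reg xEnd = h.reg xEnd := Cmd.eval_reg _ rfl
  have f₁ : h₁.arr arrPath = f := Cmd.eval_arr _ rfl
  have a₁ : Adj₁ n h₁ = Adj₁ n h := adj₁_congr (Cmd.eval_arr _ rfl)
  have t₁ : ((Cmd.forEach xT pickStep).eval n (h₁.setReg xCount 0)).arr arrT = h₁.arr arrT :=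
    Cmd.eval_arr _ rfl
  rw [t₁]
  have key := Cmd.forEach_induct (n := n) (x := xT) (p := pickStep) (h := h₁.setReg xCount 0)
    (fun k h' => h'.reg xCount = min i₀ (Nat.count p k) ∧
      (∀ w < n, h'.arr arrS (n * i₀ + w) = 1 ↔
        ∃ a < k, p a ∧ Nat.count p a < i₀ ∧ f (a - 1) = w) ∧
      ∀ i ≠ i₀, ∀ w < n, h'.arr arrS (n * i + w) = h.arr arrS (n * i + w)) ?_ ?_
  · obtain ⟨-, h2, h3⟩ := key
    refine ⟨fun w hw => (h2 w hw).trans ⟨?_, ?_⟩, h3, fun w hw => (clear.1 w hw).2,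
      fun i hi w hw => (clear.2 i hi w hw).2⟩
    · rintro ⟨a, -, ha⟩
      exact ⟨a, ha⟩
    · rintro ⟨a, ha⟩
      exact ⟨a, ha.1.2.1.trans_le hL, ha⟩
  · refine ⟨by simp, fun w hw => ?_, fun i hi w hw => (clear.2 i hi w hw).1⟩
    simp [(clear.1 w hw).1]
  · rintro k hk h' hreg harr ⟨h1, h2, h3⟩
    have hrow : h'.reg xRow = i₀ := by simpa [r₁] using hreg xRow rfl
    have hlen : h'.reg xLen = h.reg xLen := by simpa [l₁] using hreg xLen rfl
    have hend : h'.reg xEnd = h.reg xEnd := by simpa [v₁] using hreg xEnd rfl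
    have hpath : h'.arr arrPath = f := by simpa [f₁] using harr arrPath rfl
    have hadj : Adj₁ n (h'.setReg xT k) = Adj₁ n h := by
      rw [← a₁]
      exact adj₁_congr (harr arrAdj rfl)
    have hstep : ∀ w, (∃ a < k + 1, p a ∧ Nat.count p a < i₀ ∧ f (a - 1) = w) ↔
        (∃ a < k, p a ∧ Nat.count p a < i₀ ∧ f (a - 1) = w) ∨
          (p k ∧ Nat.count p k < i₀ ∧ f (k - 1) = w) := by
      intro w
      constructor
      · rintro ⟨a, ha, h⟩
        rcases Nat.lt_succ_iff_lt_or_eq.1 ha with ha | rfl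
        exacts [.inl ⟨a, ha, h⟩, .inr h]
      · rintro (⟨a, ha, h⟩ | h)
        exacts [⟨a, by omega, h⟩, ⟨k, by omega, h⟩]
    have htest : (Test.and (.le (.const 1) (.var xT)) (.and (.lt (.var xT) (.var xLen))
        (.and (edge (.var xEnd) (pathAt (.var xT))) (.lt (.var xCount) (.var xRow))))).Holds n
          (h'.setReg xT k) ↔ p k ∧ h'.reg xCount < i₀ := by
      simp [Test.Holds, Exp.eval, hadj, hrow, hlen, hend, hpath, hp, NbrAt, and_assoc]
    rw [Nat.count_succ]
    by_cases hc : p k ∧ h'.reg xCount < i₀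
    · rw [pickStep, Cmd.eval_ite_pos (htest.2 hc)]
      have hk1 : f (k - 1) < n := hf.lt _ (by omega)
      have hcnt : Nat.count p k < i₀ := by omega
      simp only [Cmd.eval_seq, Cmd.eval_put, Cmd.eval_assign, Exp.eval, eval_pathAt, setReg_reg,
        setReg_arr, setArr_reg, setArr_arr, if_true, Nat.reduceEqDiff, if_false, true_and, hrow,
        hpath, hc.1, hstep]
      refine ⟨min_succ_of_lt h1 hc.2, fun w hw => ?_, fun i hi w hw => ?_⟩
      · simp only [address_inj hw hk1, true_and]
        by_cases hwk : w = f (k - 1)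
        · simp [hwk, hcnt]
        · rw [if_neg hwk, h2 w hw]
          exact ⟨.inl, fun h => h.resolve_right fun h' => hwk h'.2.symm⟩
      · rw [if_neg (by rw [address_inj hw hk1]; exact fun h => hi h.1)]
        exact h3 i hi w hw
    · rw [pickStep, Cmd.eval_ite_neg (fun h => hc (htest.1 h)), Cmd.eval_skip]
      simp only [setReg_reg, setReg_arr, Nat.reduceEqDiff, if_false, hstep]
      have hno : ¬ (p k ∧ Nat.count p k < i₀) := fun h => hc ⟨h.1, by omega⟩
      refine ⟨?_, fun w hw => ?_, h3⟩
      · by_cases hpk : p k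
        · have : ¬ Nat.count p k < i₀ := fun h => hno ⟨hpk, h⟩
          rw [if_pos hpk]
          omega
        · rw [if_neg hpk, h1, Nat.add_zero]
      · rw [h2 w hw]
        exact ⟨.inl, fun h => h.resolve_right fun h' => hno ⟨h'.1, h'.2.1⟩⟩

open Classical in
lemma eval_pickRight {S : ℕ → Prop} {i₀ m : ℕ} (hi₀ : h.reg xRow = i₀)
    (hm : h.reg xK - i₀ = m) (hS : ∀ w < n, h.arr arrS (n * i₀ + w) = 1 ↔ S w)
    (hT : ∀ w < n, h.arr arrT (n * i₀ + w) = 0) :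
    (pickRight.eval n h).reg xNum = min m (Nat.count (Free (Adj₀ n h) n S) n) ∧
    (∀ w < n, (pickRight.eval n h).arr arrT (n * i₀ + w) = 1 ↔
      Free (Adj₀ n h) n S w ∧ Nat.count (Free (Adj₀ n h) n S) w < m) ∧
    (∀ i ≠ i₀, ∀ w < n,
      (pickRight.eval n h).arr arrT (n * i + w) = h.arr arrT (n * i + w)) := by
  set p := Free (Adj₀ n h) n S with hp
  simp only [pickRight, Cmd.eval_seq, Cmd.eval_assign, Exp.eval]
  have key := Cmd.forEach_induct (n := n) (x := xW) (p := freeStep) (h := h.setReg xNum 0)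
    (fun k h' => h'.reg xNum = min m (Nat.count p k) ∧
      (∀ w < n, h'.arr arrT (n * i₀ + w) = 1 ↔ w < k ∧ p w ∧ Nat.count p w < m) ∧
      ∀ i ≠ i₀, ∀ w < n, h'.arr arrT (n * i + w) = h.arr arrT (n * i + w)) ?_ ?_
  · obtain ⟨h1, h2, h3⟩ := key
    exact ⟨h1, fun w hw => (h2 w hw).trans ⟨fun h => h.2, fun h => ⟨hw, h⟩⟩, h3⟩
  · refine ⟨by simp, fun w hw => ?_, fun _ _ _ _ => rfl⟩
    simp [hT w hw]
  · rintro k hk h' hreg harr ⟨h1, h2, h3⟩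
    have hrow : h'.reg xRow = i₀ := by simpa [hi₀] using hreg xRow rfl
    have hK : h'.reg xK - i₀ = m := by simpa [hm] using congrArg (· - i₀) (hreg xK rfl)
    have harrS : h'.arr arrS = h.arr arrS := harr arrS rfl
    have harrA : h'.arr arrAdj = h.arr arrAdj := harr arrAdj rfl
    have htest : (Test.and (.lt (.var xNum) (.sub (.var xK) (.var xRow)))
        (.not (.eq (.get arrS (.var xRow) (.var xW)) (.const 1)))).Holds n (h'.setReg xW k) ↔
          h'.reg xNum < m ∧ ¬ S k := by
      simp [Test.Holds, Exp.eval, hrow, hK, harrS, hS k hk]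
    -- The case in which vertex `k` is not put into `T`.
    have stay : ∀ h'' : State, ¬ (p k ∧ h'.reg xNum < m) → h''.reg xNum = h'.reg xNum →
        h''.arr arrT = h'.arr arrT →
        h''.reg xNum = min m (Nat.count p (k + 1)) ∧
        (∀ w < n, h''.arr arrT (n * i₀ + w) = 1 ↔ w < k + 1 ∧ p w ∧ Nat.count p w < m) ∧
        ∀ i ≠ i₀, ∀ w < n, h''.arr arrT (n * i + w) = h.arr arrT (n * i + w) := by
      intro h'' hno e1 e2
      rw [e1, e2, Nat.count_succ]
      refine ⟨?_, fun w hw => ?_, h3⟩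
      · by_cases hpk : p k
        · have : ¬ h'.reg xNum < m := fun h => hno ⟨hpk, h⟩
          rw [if_pos hpk]
          omega
        · rw [if_neg hpk, h1, Nat.add_zero]
      · rw [h2 w hw]
        refine ⟨fun h => ⟨by omega, h.2⟩, fun h => ⟨?_, h.2⟩⟩
        rcases Nat.lt_succ_iff_lt_or_eq.1 h.1 with h' | rfl
        · exact h'
        · exact absurd ⟨h.2.1, by have := h.2.2; omega⟩ hno
    by_cases hc : h'.reg xNum < m ∧ ¬ S k
    · rw [freeStep, Cmd.eval_ite_pos (htest.2 hc)]
      simp only [Cmd.eval_seq, Cmd.eval_assign, Exp.eval]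
      set h₁ := (h'.setReg xW k).setReg xOk 1 with hh₁
      set h₂ := (Cmd.forEach xU freeTest).eval n h₁ with hh₂
      have hok : h₂.reg xOk = 1 ↔ ∀ u < n, S u → ¬ Adj₀ n h u k := by
        refine Cmd.forEach_induct (fun l h'' => h''.reg xOk = 1 ↔
          ∀ u < l, S u → ¬ Adj₀ n h u k) (by simp [hh₁]) ?_
        intro l hl h'' hreg' harr' hI
        have hrow' : h''.reg xRow = i₀ := by simpa [hh₁, hrow] using hreg' xRow rfl
        have hw' : h''.reg xW = k := by simpa [hh₁] using hreg' xW rfl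
        have harrS' : h''.arr arrS = h.arr arrS := (harr' arrS rfl).trans harrS
        have harrA' : h''.arr arrAdj = h.arr arrAdj := (harr' arrAdj rfl).trans harrA
        have htest' : (Test.and (.eq (.get arrS (.var xRow) (.var xU)) (.const 1))
            (.lt (.const 0) (.get arrAdj (.var xU) (.var xW)))).Holds n (h''.setReg xU l) ↔
              S l ∧ Adj₀ n h l k := by
          simp [Test.Holds, Exp.eval, hrow', hw', harrS', harrA', hS l hl, Adj₀]
        by_cases hc' : S l ∧ Adj₀ n h l k
        · rw [freeTest, Cmd.eval_ite_pos (htest'.2 hc')]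
          simp only [Cmd.eval_assign, Exp.eval, setReg_reg, if_true, zero_ne_one, false_iff]
          exact fun h => h l (by omega) hc'.1 hc'.2
        · rw [freeTest, Cmd.eval_ite_neg (fun h => hc' (htest'.1 h)), Cmd.eval_skip]
          simp only [setReg_reg, Nat.reduceEqDiff, if_false, hI]
          refine ⟨fun h u hu hSu hA => ?_, fun h u hu => h u (by omega)⟩
          rcases Nat.lt_succ_iff_lt_or_eq.1 hu with hu | rfl
          exacts [h u hu hSu hA, hc' ⟨hSu, hA⟩]
      have hpk : h₂.reg xOk = 1 ↔ p k := by
        rw [hok]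
        exact ⟨fun h => ⟨hc.2, h⟩, fun h => h.2⟩
      have e1 : h₂.reg xNum = h'.reg xNum := by
        rw [hh₂, Cmd.eval_reg _ rfl]
        simp [hh₁]
      have e2 : h₂.arr arrT = h'.arr arrT := by
        rw [hh₂, Cmd.eval_arr _ rfl]
        simp [hh₁]
      have e3 : h₂.reg xRow = i₀ := by
        rw [hh₂, Cmd.eval_reg _ rfl]
        simpa [hh₁] using hrow
      have e4 : h₂.reg xW = k := by
        rw [hh₂, Cmd.eval_reg _ rfl]
        simp [hh₁]
      by_cases hpk' : p k
      · have hcnt : Nat.count p k < m := by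
          have := hc.1
          omega
        rw [Cmd.eval_ite_pos (by simpa [Exp.eval] using hpk.2 hpk'), Nat.count_succ]
        simp only [Cmd.eval_seq, Cmd.eval_put, Cmd.eval_assign, Exp.eval, setReg_reg,
          setReg_arr, setArr_reg, setArr_arr, if_true, true_and, e1, e2, e3, e4, hpk']
        refine ⟨min_succ_of_lt h1 hc.1, fun w hw => ?_, fun i hi w hw => ?_⟩
        · simp only [address_inj hw hk, true_and]
          by_cases hwk : w = k
          · subst hwk
            simp [hpk', hcnt]
          · rw [if_neg hwk, h2 w hw]
            exact ⟨fun h => ⟨by omega, h.2⟩, fun h => ⟨by omega, h.2⟩⟩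
        · rw [if_neg (by rw [address_inj hw hk]; exact fun h => hi h.1)]
          exact h3 i hi w hw
      · rw [Cmd.eval_ite_neg (by simpa [Exp.eval] using fun h => hpk' (hpk.1 h)), Cmd.eval_skip]
        exact stay _ (fun h => hpk' h.1) e1 e2
    · rw [freeStep, Cmd.eval_ite_neg (fun h => hc (htest.1 h)), Cmd.eval_skip]
      exact stay _ (fun h => hc ⟨h.2, h.1.1⟩) (by simp) (by simp)

open Classical in
/-- In `h'`, row `i` of the arrays for the certificate has been computed from the end `v` of the
path in `h`. -/
def RowDone (n : ℕ) (h h' : State) (i v : ℕ) : Prop :=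
  (∀ w < n, h'.arr arrS (n * i + w) = 1 ↔
    Before (Adj₁ n h) (h.arr arrPath) (h.reg xLen) v i w) ∧
  ∀ w < n, h'.arr arrT (n * i + w) = 1 ↔
    Free (Adj₀ n h) n (Before (Adj₁ n h) (h.arr arrPath) (h.reg xLen) v i) w ∧
    Nat.count (Free (Adj₀ n h) n (Before (Adj₁ n h) (h.arr arrPath) (h.reg xLen) v i)) w <
      h.reg xK - i

open Classical in
/-- The number of vertices available for the right side in row `i` if the left side is computed from
the end `v` of the path. -/
noncomputable def freeCount (n : ℕ) (h : State) (i v : ℕ) : ℕ :=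
  Nat.count (Free (Adj₀ n h) n (Before (Adj₁ n h) (h.arr arrPath) (h.reg xLen) v i)) n

/-- `h'` agrees with `h` in the data from which the certificate is computed. -/
structure SameInput (h h' : State) : Prop where
  adj : h'.arr arrAdj = h.arr arrAdj
  path : h'.arr arrPath = h.arr arrPath
  len : h'.reg xLen = h.reg xLen
  k : h'.reg xK = h.reg xK

lemma SameInput.trans {h h' h'' : State} (h₁ : SameInput h h') (h₂ : SameInput h' h'') :
    SameInput h h'' :=
  ⟨h₂.adj.trans h₁.adj, h₂.path.trans h₁.path, h₂.len.trans h₁.len, h₂.k.trans h₁.k⟩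

lemma SameInput.rowDone_iff {h h' h'' : State} {i v : ℕ} (hs : SameInput h h') :
    RowDone n h' h'' i v ↔ RowDone n h h'' i v := by
  unfold RowDone
  rw [adj₁_congr hs.adj, adj₀_congr hs.adj, hs.path, hs.len, hs.k]

lemma SameInput.freeCount_eq {h h' : State} {i v : ℕ} (hs : SameInput h h') :
    freeCount n h' i v = freeCount n h i v := by
  unfold freeCount
  rw [adj₁_congr hs.adj, adj₀_congr hs.adj, hs.path, hs.len]

/-- Row `i` of the arrays for the certificate agrees. -/
def SameRow (n : ℕ) (h h' : State) (i : ℕ) : Prop :=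
  ∀ w < n, h'.arr arrS (n * i + w) = h.arr arrS (n * i + w) ∧
    h'.arr arrT (n * i + w) = h.arr arrT (n * i + w)

lemma SameRow.trans {h h' h'' : State} {i : ℕ} (h₁ : SameRow n h h' i)
    (h₂ : SameRow n h' h'' i) : SameRow n h h'' i := fun w hw =>
  ⟨(h₂ w hw).1.trans (h₁ w hw).1, (h₂ w hw).2.trans (h₁ w hw).2⟩

lemma RowDone.of_sameRow {h h' h'' : State} {i v : ℕ} (hd : RowDone n h h' i v)
    (hs : SameRow n h' h'' i) : RowDone n h h'' i v := by
  refine ⟨fun w hw => ?_, fun w hw => ?_⟩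
  · rw [(hs w hw).1]
    exact hd.1 w hw
  · rw [(hs w hw).2]
    exact hd.2 w hw

/-- Compute row `xRow` of the certificate, starting from the end `xEnd` of the path. -/
def fillRow : Cmd := pickLeft ;; pickRight

/-- Compute row `xRow` of the certificate from the first vertex of the path or, if this does not
give enough vertices, from the last vertex. -/
def certificateStep : Cmd :=
  .assign xEnd (pathAt (.const 0)) ;; fillRow ;;
  .ite (.lt (.var xNum) (.sub (.var xK) (.var xRow))) (.assign xEnd (pathAt lastPos) ;; fillRow)
    .skip

/-- Compute the certificate. -/
def certificate : Cmd := .forEach xRow certificateStep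

lemma eval_fillRow {i v : ℕ} (hf : IsPerm n (h.arr arrPath)) (hL : h.reg xLen ≤ n)
    (hi : h.reg xRow = i) (hv : h.reg xEnd = v) :
    RowDone n h (fillRow.eval n h) i v ∧
    (fillRow.eval n h).reg xNum = min (h.reg xK - i) (freeCount n h i v) ∧
    ∀ i' ≠ i, SameRow n h (fillRow.eval n h) i' := by
  subst hi hv
  obtain ⟨l1, l2, l3, l4⟩ := eval_pickLeft (n := n) (h := h) hf hL
  rw [fillRow, Cmd.eval_seq]
  set h₁ := pickLeft.eval n h with hh₁
  have e1 : h₁.reg xRow = h.reg xRow := Cmd.eval_reg _ rfl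
  have e2 : h₁.reg xK = h.reg xK := Cmd.eval_reg _ rfl
  have e3 : Adj₀ n h₁ = Adj₀ n h := adj₀_congr (Cmd.eval_arr _ rfl)
  have e4 : (pickRight.eval n h₁).arr arrS = h₁.arr arrS := Cmd.eval_arr _ rfl
  obtain ⟨r1, r2, r3⟩ := eval_pickRight e1 (by rw [e2]) l1 l3
  rw [e3] at r1 r2
  refine ⟨⟨?_, r2⟩, r1, fun i hi w hw => ⟨?_, ?_⟩⟩
  · rw [e4]
    exact l1
  · rw [e4]
    exact l2 i hi w hw
  · rw [r3 i hi w hw]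
    exact l4 i hi w hw

/-- Row `i` is computed from the first vertex of the path if this gives enough vertices, and from
the last vertex otherwise. -/
lemma eval_certificate (hf : IsPerm n (h.arr arrPath)) (hL : h.reg xLen ≤ n) :
    ∀ i < n,
      (h.reg xK - i ≤ freeCount n h i (h.arr arrPath 0) ∧
        RowDone n h (certificate.eval n h) i (h.arr arrPath 0)) ∨
      (freeCount n h i (h.arr arrPath 0) < h.reg xK - i ∧
        RowDone n h (certificate.eval n h) i (h.arr arrPath (h.reg xLen - 1))) := by
  refine Cmd.forEach_induct (p := certificateStep) (fun k h' => ∀ i < k,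
    (h.reg xK - i ≤ freeCount n h i (h.arr arrPath 0) ∧ RowDone n h h' i (h.arr arrPath 0)) ∨
      (freeCount n h i (h.arr arrPath 0) < h.reg xK - i ∧
        RowDone n h h' i (h.arr arrPath (h.reg xLen - 1)))) (by simp) ?_
  intro k hk h' hreg harr hI
  rw [certificateStep, Cmd.eval_seq, Cmd.eval_seq, Cmd.eval_assign]
  set h₁ := (h'.setReg xRow k).setReg xEnd ((pathAt (.const 0)).eval n (h'.setReg xRow k)) with hh₁
  have s₁ : SameInput h h₁ :=
    ⟨harr arrAdj rfl, harr arrPath rfl, hreg xLen rfl, hreg xK rfl⟩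
  have v₁ : h₁.reg xEnd = h.arr arrPath 0 := by simp [hh₁, Exp.eval, harr arrPath rfl]
  obtain ⟨d₁, c₁, o₁⟩ := eval_fillRow (n := n) (h := h₁) (i := k) (by rwa [s₁.path])
    (by rwa [s₁.len]) (by simp [hh₁]) v₁
  set h₂ := fillRow.eval n h₁ with hh₂
  have s₂ : SameInput h₁ h₂ := ⟨Cmd.eval_arr _ rfl, Cmd.eval_arr _ rfl, Cmd.eval_reg _ rfl,
    Cmd.eval_reg _ rfl⟩
  have s₂' := s₁.trans s₂
  have row₂ : h₂.reg xRow = k := by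
    rw [hh₂, Cmd.eval_reg _ rfl]
    simp [hh₁]
  rw [s₁.rowDone_iff] at d₁
  rw [s₁.k, s₁.freeCount_eq] at c₁
  have old : ∀ i < k, SameRow n h' h₂ i := fun i hi w hw => by
    obtain ⟨h3, h4⟩ := o₁ i (by omega) w hw
    exact ⟨h3, h4⟩
  have hlt : ∀ i < k + 1, i < k ∨ i = k := fun i hi => by omega
  by_cases hc : freeCount n h k (h.arr arrPath 0) < h.reg xK - k
  · rw [Cmd.eval_ite_pos (by
      simp only [Test.Holds, Exp.eval, row₂, c₁, s₂'.k]
      omega), Cmd.eval_seq, Cmd.eval_assign]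
    set h₃ := h₂.setReg xEnd ((pathAt lastPos).eval n h₂) with hh₃
    have s₃ : SameInput h h₃ := s₂'.trans ⟨rfl, rfl, rfl, rfl⟩
    have v₃ : h₃.reg xEnd = h.arr arrPath (h.reg xLen - 1) := by
      simp [hh₃, Exp.eval, lastPos, s₂'.path, s₂'.len]
    obtain ⟨d₂, -, o₂⟩ := eval_fillRow (n := n) (h := h₃) (i := k) (by rwa [s₃.path])
      (by rwa [s₃.len]) (by simpa [hh₃] using row₂) v₃
    rw [s₃.rowDone_iff] at d₂
    intro i hi
    rcases hlt i hi with hi | rfl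
    · have hs : SameRow n h' (fillRow.eval n h₃) i :=
        (old i hi).trans fun w hw => o₂ i (by omega) w hw
      exact (hI i hi).imp (fun h => ⟨h.1, h.2.of_sameRow hs⟩) fun h => ⟨h.1, h.2.of_sameRow hs⟩
    · exact .inr ⟨hc, d₂⟩
  · rw [Cmd.eval_ite_neg (by
      simp only [Test.Holds, Exp.eval, row₂, c₁, s₂'.k]
      omega), Cmd.eval_skip]
    intro i hi
    rcases hlt i hi with hi | rfl
    · exact (hI i hi).imp (fun h => ⟨h.1, h.2.of_sameRow (old i hi)⟩)
        fun h => ⟨h.1, h.2.of_sameRow (old i hi)⟩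
    · exact .inl ⟨by omega, d₁⟩

end Rows

/-! ### The algorithm -/

/-- Unless the search has failed before, search for a Hamilton cycle in the graph without the edges
of the cycles found so far. -/
def cycleStep : Cmd :=
  .ite (.lt (.var xStop) (.const 1))
    (growPath ;; .ite (.and closedTest (.eq (.var xLen) .size))
      (recordCycle ;; .assign xTriple (.succ (.succ (.succ (.var xTriple)))))
      (.assign xStop (.const 1)))
    .skip

/-- Compute the size of the certificate from the minimum degree and the number of cycles. -/
def computeK : Cmd :=
  .ite (.lt (.var xDeg) (.var xTriple)) (.assign xK (.const 0))
    (.assign xK (.succ (.div (.sub (.var xDeg) (.var xTriple)) (.succ (.var xRes)))))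

/-- The whole algorithm. Variable `xRes` holds `n` in the input. A graph has fewer than `n`
edge-disjoint Hamilton cycles, so `n` searches suffice. -/
def algorithm : Cmd :=
  .assign xRes (.const 0) ;; .assign xTriple (.const 0) ;; .assign xStop (.const 0) ;;
    minDegree ;; .forEach xTry cycleStep ;; computeK ;; certificate

/-- The list of vertices in row `i` of the array of cycles. -/
def State.cycle (h : State) (n i j : ℕ) : ℕ := h.arr arrCyc (n * i + j)

open Classical in
/-- The arrays after `r` edge-disjoint Hamilton cycles have been found in the graph with adjacency
relation `N`. -/
structure CyclesFound (n : ℕ) (N : ℕ → ℕ → Prop) (h : State) (r : ℕ) : Prop where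
  adj : ∀ u < n, ∀ v < n, Adj₀ n h u v ↔ N u v
  le_two : ∀ u < n, ∀ v < n, h.arr arrAdj (n * u + v) ≤ 2
  symm : ∀ u < n, ∀ v < n, h.arr arrAdj (n * u + v) = h.arr arrAdj (n * v + u)
  removed : ∀ u < n, Nat.count (fun v => h.arr arrAdj (n * u + v) = 2) n ≤ 2 * r
  perm : ∀ i < r, IsPerm n (h.cycle n i)
  edges : ∀ i < r, ∀ u < n, ∀ v < n, CycEdge n (h.cycle n i) n u v → h.arr arrAdj (n * u + v) = 2
  disjoint : ∀ i < r, ∀ j < r, i ≠ j → ∀ u < n, ∀ v < n, CycEdge n (h.cycle n i) n u v →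
    ¬ CycEdge n (h.cycle n j) n u v

section Algorithm

variable {n : ℕ} {h : State} {N : ℕ → ℕ → Prop}

lemma CyclesFound.isAdj {r : ℕ} (hc : CyclesFound n N h r) (hN : ∀ u < n, ¬ N u u) :
    IsAdj (Adj₁ n h) n where
  symm u hu v hv huv := by
    unfold Adj₁ at huv ⊢
    rw [← hc.symm u hu v hv, huv]
  irrefl u hu huu := by
    refine hN u hu ((hc.adj u hu u hu).1 ?_)
    unfold Adj₁ at huu
    unfold Adj₀
    omega

lemma cycEdge_congr {f g : ℕ → ℕ} {u v : ℕ} (hfg : ∀ j < n, f j = g j) :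
    CycEdge n f n u v ↔ CycEdge n g n u v := by
  refine exists_congr fun j => and_congr_right fun hj => ?_
  rw [hfg j hj, hfg _ (predPos_lt hj)]

lemma CyclesFound.congr {h' : State} {r : ℕ} (hc : CyclesFound n N h r)
    (ha : h'.arr arrAdj = h.arr arrAdj) (hcyc : h'.arr arrCyc = h.arr arrCyc) :
    CyclesFound n N h' r := by
  have e : h'.cycle n = h.cycle n := by
    funext i j
    simp [State.cycle, hcyc]
  obtain ⟨h1, h2, h3, h4, h5, h6, h7⟩ := hc
  refine ⟨?_, ?_, ?_, ?_, ?_, ?_, ?_⟩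
  · rwa [adj₀_congr ha]
  · rwa [ha]
  · rwa [ha]
  · rwa [ha]
  · rwa [e]
  · rwa [ha, e]
  · rwa [e]

open Classical in
/-- A closed path through all vertices is a further Hamilton cycle, edge-disjoint from the previous
ones. -/
lemma CyclesFound.recordCycle (hc : CyclesFound n N h (h.reg xRes)) (hN : ∀ u < n, ¬ N u u)
    (hf : IsPathPerm (Adj₁ n h) n (h.arr arrPath) n)
    (hcl : Closed (Adj₁ n h) (h.arr arrPath) n) :
    CyclesFound n N (RAM.recordCycle.eval n h) (h.reg xRes + 1) := by
  obtain ⟨c1, c2, c3, -⟩ := eval_recordCycle (n := n) (h := h) hf.toIsPerm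
  set f := h.arr arrPath with hfdef
  set r := h.reg xRes with hr
  set h' := RAM.recordCycle.eval n h with hh'
  have hA := hc.isAdj hN
  have hedge : ∀ u < n, ∀ v < n, CycEdge n f n u v → h.arr arrAdj (n * u + v) = 1 := by
    have key : ∀ j < n, Adj₁ n h (f (predPos n j)) (f j) := by
      intro j hj
      unfold predPos
      split_ifs with hj0
      · rw [hj0]
        exact hA.symm _ (hf.lt _ (by omega)) _ (hf.lt _ (by omega)) hcl
      · have := hf.adj (j - 1) (by omega)
        rwa [show j - 1 + 1 = j by omega] at this
    rintro u hu v hv ⟨j, hj, ⟨rfl, rfl⟩ | ⟨rfl, rfl⟩⟩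
    · exact key j hj
    · exact hA.symm _ hv _ hu (key j hj)
  have hnew : ∀ j < n, h'.cycle n r j = f j := c1
  have hold : ∀ i < r, ∀ j < n, h'.cycle n i j = h.cycle n i j := fun i hi j hj =>
    c2 i (by omega) j hj
  have hlt : ∀ i < r + 1, i < r ∨ i = r := fun i hi => by omega
  -- The edges of the earlier cycles carry the mark `2`, those of the new one have carried `1`.
  have hdisj : ∀ i < r, ∀ u < n, ∀ v < n, CycEdge n (h'.cycle n i) n u v →
      ¬ CycEdge n (h'.cycle n r) n u v := by
    intro i hi u hu v hv h1 h2
    rw [cycEdge_congr (hold i hi)] at h1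
    rw [cycEdge_congr hnew] at h2
    have e1 := hc.edges i hi u hu v hv h1
    have e2 := hedge u hu v hv h2
    omega
  refine ⟨fun u hu v hv => ?_, fun u hu v hv => ?_, fun u hu v hv => ?_, fun u hu => ?_,
    fun i hi => ?_, fun i hi u hu v hv huv => ?_, fun i hi j hj hij u hu v hv => ?_⟩
  · rw [← hc.adj u hu v hv, Adj₀, Adj₀, c3 u hu v hv]
    split_ifs with hcyc
    · simp [hedge u hu v hv hcyc]
    · rfl
  · rw [c3 u hu v hv]
    split_ifs
    exacts [le_rfl, hc.le_two u hu v hv]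
  · rw [c3 u hu v hv, c3 v hv u hu, hc.symm u hu v hv]
    congr 1
    rw [eq_iff_iff]
    exact ⟨CycEdge.symm, CycEdge.symm⟩
  · have h1 := hc.removed u hu
    have h2 := count_cycEdge_le (u := u) hf.toIsPerm
    rw [Nat.count_eq_card_filter_range] at h1 h2 ⊢
    have h3 : (Finset.range n).filter (fun v => h'.arr arrAdj (n * u + v) = 2) ⊆
        ((Finset.range n).filter fun v => h.arr arrAdj (n * u + v) = 2) ∪
          (Finset.range n).filter fun v => CycEdge n f n u v := by
      intro v hv
      obtain ⟨hv, h3⟩ := Finset.mem_filter.1 hv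
      rw [c3 u hu v (Finset.mem_range.1 hv)] at h3
      simp only [Finset.mem_union, Finset.mem_filter, hv, true_and]
      split_ifs at h3 with h4
      exacts [.inr h4, .inl h3]
    have h4 := (Finset.card_le_card h3).trans (Finset.card_union_le _ _)
    omega
  · rcases hlt i hi with hi | rfl
    · have hp := hc.perm i hi
      refine ⟨fun j hj => ?_, fun j hj l hl => ?_⟩
      · rw [hold i hi j hj]
        exact hp.lt j hj
      · rw [hold i hi j hj, hold i hi l hl]
        exact hp.inj j hj l hl
    · refine ⟨fun j hj => ?_, fun j hj l hl => ?_⟩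
      · rw [hnew j hj]
        exact hf.lt j hj
      · rw [hnew j hj, hnew l hl]
        exact hf.inj j hj l hl
  · rw [c3 u hu v hv]
    rcases hlt i hi with hi | rfl
    · split_ifs
      · rfl
      · rw [cycEdge_congr (hold i hi)] at huv
        exact hc.edges i hi u hu v hv huv
    · rw [cycEdge_congr hnew] at huv
      rw [if_pos huv]
  · rcases hlt i hi with hi | rfl <;> rcases hlt j hj with hj | rfl
    · rw [cycEdge_congr (hold i hi), cycEdge_congr (hold j hj)]
      exact hc.disjoint i hi j hj hij u hu v hv
    · exact hdisj i hi u hu v hv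
    · exact fun h1 h2 => hdisj j hj u hu v hv h2 h1
    · exact absurd rfl hij

/-- The search for Hamilton cycles has ended with a stuck path that is not a Hamilton cycle. -/
structure Failed (n : ℕ) (h : State) : Prop where
  path : IsPathPerm (Adj₁ n h) n (h.arr arrPath) (h.reg xLen)
  stuck : Stuck (Adj₁ n h) n (h.arr arrPath) (h.reg xLen)
  not_cycle : ¬ (Closed (Adj₁ n h) (h.arr arrPath) (h.reg xLen) ∧ h.reg xLen = n)

lemma Failed.congr {h' : State} (hF : Failed n h) (ha : h'.arr arrAdj = h.arr arrAdj)
    (hp : h'.arr arrPath = h.arr arrPath) (hl : h'.reg xLen = h.reg xLen) : Failed n h' := by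
  obtain ⟨h1, h2, h3⟩ := hF
  rw [← adj₁_congr ha, ← hp, ← hl] at h1 h2 h3
  exact ⟨h1, h2, h3⟩

/-- The invariant of the search: either all of the `k` searches up to now have given a cycle, or the
search has failed. -/
lemma eval_cycleStep {k : ℕ} (hn : 1 ≤ n) (hN : ∀ u < n, ¬ N u u)
    (hc : CyclesFound n N h (h.reg xRes)) (h3 : h.reg xTriple = 3 * h.reg xRes)
    (hs : (h.reg xStop = 0 ∧ h.reg xRes = k) ∨ (h.reg xStop = 1 ∧ Failed n h)) :
    CyclesFound n N (cycleStep.eval n h) ((cycleStep.eval n h).reg xRes) ∧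
      (cycleStep.eval n h).reg xTriple = 3 * (cycleStep.eval n h).reg xRes ∧
      (((cycleStep.eval n h).reg xStop = 0 ∧ (cycleStep.eval n h).reg xRes = k + 1) ∨
        ((cycleStep.eval n h).reg xStop = 1 ∧ Failed n (cycleStep.eval n h))) := by
  rcases hs with ⟨hs, hk⟩ | ⟨hs, hF⟩
  · rw [cycleStep, Cmd.eval_ite_pos (by simp [Test.Holds, Exp.eval, hs]), Cmd.eval_seq]
    obtain ⟨g1, g2⟩ := eval_growPath hn (hc.isAdj hN)
    set h₁ := growPath.eval n h with hh₁
    have ha : h₁.arr arrAdj = h.arr arrAdj := Cmd.eval_arr _ rfl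
    have hr : h₁.reg xRes = h.reg xRes := Cmd.eval_reg _ rfl
    have ht : h₁.reg xTriple = 3 * h.reg xRes := (Cmd.eval_reg _ rfl).trans h3
    have hst : h₁.reg xStop = 0 := (Cmd.eval_reg _ rfl).trans hs
    have hc₁ : CyclesFound n N h₁ (h₁.reg xRes) := by
      rw [hr]
      exact hc.congr ha (Cmd.eval_arr _ rfl)
    rw [← adj₁_congr ha] at g1 g2
    have htest : (Test.and closedTest (.eq (.var xLen) .size)).Holds n h₁ ↔
        Closed (Adj₁ n h₁) (h₁.arr arrPath) (h₁.reg xLen) ∧ h₁.reg xLen = n := by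
      simp [Test.Holds, holds_closedTest, Exp.eval]
    by_cases hcase : Closed (Adj₁ n h₁) (h₁.arr arrPath) (h₁.reg xLen) ∧ h₁.reg xLen = n
    · rw [Cmd.eval_ite_pos (htest.2 hcase), Cmd.eval_seq, Cmd.eval_assign]
      obtain ⟨hcl, hLn⟩ := hcase
      rw [hLn] at hcl g1
      have hrec := hc₁.recordCycle hN g1 hcl
      obtain ⟨-, -, -, e4⟩ := eval_recordCycle (n := n) (h := h₁) g1.toIsPerm
      have e5 : (recordCycle.eval n h₁).reg xTriple = h₁.reg xTriple := Cmd.eval_reg _ rfl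
      have e6 : (recordCycle.eval n h₁).reg xStop = h₁.reg xStop := Cmd.eval_reg _ rfl
      simp only [setReg_reg, if_true, Nat.reduceEqDiff, if_false, OfNat.zero_ne_ofNat, e4, e5, e6,
        hr, ht, hst, Exp.eval]
      refine ⟨?_, by ring, .inl ⟨trivial, by rw [hk]⟩⟩
      rw [← hr]
      exact hrec.congr rfl rfl
    · rw [Cmd.eval_ite_neg (fun h => hcase (htest.1 h)), Cmd.eval_assign]
      simp only [setReg_reg, if_true, Nat.reduceEqDiff, if_false, OfNat.zero_ne_ofNat, ht, hr,
        Exp.eval]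
      refine ⟨?_, trivial, .inr ⟨trivial, ?_⟩⟩
      · rw [← hr]
        exact hc₁.congr rfl rfl
      · exact Failed.congr (h := h₁) ⟨g1, g2, hcase⟩ rfl rfl rfl
  · rw [cycleStep, Cmd.eval_ite_neg (by simp [Test.Holds, Exp.eval, hs]), Cmd.eval_skip]
    exact ⟨hc, h3, .inr ⟨hs, hF⟩⟩

end Algorithm

section Correctness

variable {n : ℕ} {h : State} {N : ℕ → ℕ → Prop}

open Classical in
/-- The sets in row `i` of the certificate, if the search for cycles has ended with a stuck path.
With `d = D - 2 * r`, a lower bound for the degrees without the edges of the `r` cycles, the left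
side of the hole has `i` vertices and the right side has at least `d + 1 - i - 2 * r * i` vertices;
this is at least `K - i`, because `2 * i ≤ K` and `(r + 1) * K ≤ d + 1`. -/
lemma Failed.eval_certificate {r D : ℕ} (hn : 2 ≤ n) (hF : Failed n h) (hN : ∀ u < n, ¬ N u u)
    (hc : CyclesFound n N h r) (hD : ∀ u < n, D ≤ Nat.count (N u) n) (h3 : 3 * r ≤ D)
    (hK : h.reg xK = (D - 3 * r) / (r + 1) + 1) {i : ℕ} (hi : 1 ≤ i) (hiK : i ≤ h.reg xK / 2) :
    Nat.count (fun w => (certificate.eval n h).arr arrS (n * i + w) = 1) n = i ∧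
    Nat.count (fun w => (certificate.eval n h).arr arrT (n * i + w) = 1) n = h.reg xK - i ∧
    ∀ u < n, (certificate.eval n h).arr arrS (n * i + u) = 1 →
      ∀ w < n, (certificate.eval n h).arr arrT (n * i + w) = 1 → u ≠ w ∧ ¬ N u w := by
  have hA := hc.isAdj hN
  have hL := hF.path.le
  have hL' := hF.path.pos
  set K := h.reg xK with hKdef
  set d := D - 2 * r with hd
  have hKd : (r + 1) * K ≤ d + 1 := by
    have h1 := Nat.mul_div_le (D - 3 * r) (r + 1)
    rw [hK, Nat.mul_add, Nat.mul_one]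
    omega
  have h2i : 2 * i ≤ K := by omega
  have hri : i * (2 * r) ≤ r * K := by
    calc i * (2 * r) = r * (2 * i) := by ring
      _ ≤ r * K := Nat.mul_le_mul_left _ h2i
  have hKd' : r * K + K ≤ d + 1 := by
    rw [← Nat.succ_mul]
    exact hKd
  have hsplit : ∀ u < n, Nat.count (fun v => Adj₀ n h u v ∧ ¬ Adj₁ n h u v) n ≤ 2 * r := by
    intro u hu
    refine le_trans (Nat.count_mono_left fun v hv hv' => ?_) (hc.removed u hu)
    have h1 := hc.le_two u hu v hv
    obtain ⟨h2, h3⟩ := hv'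
    unfold Adj₀ at h2
    unfold Adj₁ at h3
    omega
  have hdeg : ∀ u < n, d ≤ Nat.count (Adj₁ n h u) n := by
    intro u hu
    have h1 := hD u hu
    have h2 := hsplit u hu
    rw [Nat.count_eq_card_filter_range] at h1 h2 ⊢
    have h3 : (Finset.range n).filter (fun v => N u v) ⊆
        ((Finset.range n).filter fun v => Adj₁ n h u v) ∪
          (Finset.range n).filter fun v => Adj₀ n h u v ∧ ¬ Adj₁ n h u v := by
      intro v hv
      obtain ⟨hv, h3⟩ := Finset.mem_filter.1 hv
      have h4 := (hc.adj u hu v (Finset.mem_range.1 hv)).2 h3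
      simp only [Finset.mem_union, Finset.mem_filter, hv, true_and, h4]
      exact Classical.em _
    have h4 := (Finset.card_le_card h3).trans (Finset.card_union_le _ _)
    omega
  have hin : i < n := by
    have h1 := hD 0 (by omega)
    have h2 := Nat.count_le (p := N 0) (n := n)
    have h3 : 1 * K ≤ (r + 1) * K := Nat.mul_le_mul_right _ (by omega)
    omega
  -- The first vertex of the path has at least `i` neighbors on it.
  have hfront : i ≤ Nat.count
      (NbrAt (Adj₁ n h) (h.arr arrPath) (h.reg xLen) (h.arr arrPath 0)) n := by
    refine le_trans ?_ (le_count_nbrAt hF.path hdeg (hF.path.lt 0 (by omega))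
      (fun q hq hLq h => hF.stuck.front q hq ⟨hLq, h⟩) (hA.irrefl _ (hF.path.lt 0 (by omega))))
    have h3 : 1 * K ≤ (r + 1) * K := Nat.mul_le_mul_right _ (by omega)
    omega
  obtain ⟨v, hv, hiv, hm⟩ := hF.stuck.exists_le_count_free (N := Adj₀ n h) (ρ := 2 * r) (i := i)
    (t := d + 1 - i) (m := K - i) hA hF.path hF.not_cycle hdeg hsplit hi (by omega) (by omega)
    (by omega)
  -- The row has been computed from an end of the path that gives enough vertices.
  obtain ⟨v', hiv', hm', hrow⟩ : ∃ v',
      i ≤ Nat.count (NbrAt (Adj₁ n h) (h.arr arrPath) (h.reg xLen) v') n ∧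
      K - i ≤ freeCount n h i v' ∧ RowDone n h (certificate.eval n h) i v' := by
    rcases RAM.eval_certificate hF.path.toIsPerm hL i hin with ⟨h1, h2⟩ | ⟨h1, h2⟩
    · exact ⟨_, hfront, h1, h2⟩
    · rcases hv with rfl | rfl
      · exact absurd h1 (not_lt.2 hm)
      · exact ⟨_, hiv, hm, h2⟩
  obtain ⟨hS, hT⟩ := hrow
  refine ⟨?_, ?_, fun u hu hSu w hw hTw => ?_⟩
  · refine Eq.trans ?_ (count_before (A := Adj₁ n h) hF.path hiv')
    exact le_antisymm (Nat.count_mono_left fun w hw => (hS w hw).1)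
      (Nat.count_mono_left fun w hw => (hS w hw).2)
  · have h1 := card_filter_count_lt
      (Free (Adj₀ n h) n (Before (Adj₁ n h) (h.arr arrPath) (h.reg xLen) v' i)) (K - i) n
    refine Eq.trans ?_ (h1.trans (min_eq_left hm'))
    rw [Nat.count_eq_card_filter_range]
    congr 1
    exact Finset.filter_congr fun w hw => hT w (Finset.mem_range.1 hw)
  · obtain ⟨⟨f1, f2⟩, -⟩ := (hT w hw).1 hTw
    have hBu := (hS u hu).1 hSu
    refine ⟨fun huw => f1 (huw ▸ hBu), fun hNuw => f2 u hu hBu ((hc.adj u hu w hw).2 hNuw)⟩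

open Classical in
/-- The output of the algorithm, in terms of the arrays. -/
lemma eval_algorithm (hn : 2 ≤ n) (hle : ∀ u < n, ∀ v < n, h.arr arrAdj (n * u + v) ≤ 1)
    (hsymm : ∀ u < n, ∀ v < n, h.arr arrAdj (n * u + v) = h.arr arrAdj (n * v + u))
    (hirr : ∀ u < n, h.arr arrAdj (n * u + u) = 0) :
    ∃ D r K, (algorithm.eval n h).reg xRes = r ∧ (algorithm.eval n h).reg xK = K ∧
      (∀ u < n, D ≤ Nat.count (Adj₁ n h u) n) ∧
      (D = n ∨ ∃ u < n, D = Nat.count (Adj₁ n h u) n) ∧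
      CyclesFound n (Adj₁ n h) (algorithm.eval n h) r ∧
      K = (if D < 3 * r then 0 else (D - 3 * r) / (r + 1) + 1) ∧
      ∀ i, 1 ≤ i → i ≤ K / 2 →
        Nat.count (fun w => (algorithm.eval n h).arr arrS (n * i + w) = 1) n = i ∧
        Nat.count (fun w => (algorithm.eval n h).arr arrT (n * i + w) = 1) n = K - i ∧
        ∀ u < n, (algorithm.eval n h).arr arrS (n * i + u) = 1 →
          ∀ w < n, (algorithm.eval n h).arr arrT (n * i + w) = 1 →
            u ≠ w ∧ ¬ Adj₁ n h u w := by
  set N := Adj₁ n h with hNdef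
  have hN : ∀ u < n, ¬ N u u := fun u hu huu => by
    have := hirr u hu
    rw [hNdef, Adj₁] at huu
    omega
  simp only [algorithm, Cmd.eval_seq, Cmd.eval_assign, Exp.eval]
  set h₀ := ((h.setReg xRes 0).setReg xTriple 0).setReg xStop 0 with hh₀
  set h₁ := minDegree.eval n h₀ with hh₁
  have a₁ : h₁.arr arrAdj = h.arr arrAdj := Cmd.eval_arr _ rfl
  have hres₁ : h₁.reg xRes = 0 := by
    rw [hh₁, Cmd.eval_reg _ rfl]
    simp [hh₀]
  have htrip₁ : h₁.reg xTriple = 0 := by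
    rw [hh₁, Cmd.eval_reg _ rfl]
    simp [hh₀]
  have hstop₁ : h₁.reg xStop = 0 := by
    rw [hh₁, Cmd.eval_reg _ rfl]
    simp [hh₀]
  have hc₁ : CyclesFound n N h₁ 0 := by
    refine ⟨fun u hu v hv => ?_, fun u hu v hv => ?_, fun u hu v hv => ?_, fun u hu => ?_,
      by simp, by simp, by simp⟩
    · have := hle u hu v hv
      rw [hNdef, Adj₀, Adj₁, a₁]
      omega
    · rw [a₁]
      exact (hle u hu v hv).trans (by omega)
    · rw [a₁]
      exact hsymm u hu v hv
    · rw [Nat.mul_zero, Nat.le_zero, Nat.count_iff_forall_not]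
      intro v hv h2
      have := hle u hu v hv
      rw [a₁] at h2
      omega
  obtain ⟨hD, hD'⟩ := eval_minDegree (n := n) (h := h₀)
  rw [show Adj₁ n h₀ = N from rfl, ← hh₁] at hD hD'
  obtain ⟨i1, i2, i3⟩ := Cmd.forEach_induct (n := n) (x := xTry) (p := cycleStep) (h := h₁)
    (fun k h' => CyclesFound n N h' (h'.reg xRes) ∧ h'.reg xTriple = 3 * h'.reg xRes ∧
      ((h'.reg xStop = 0 ∧ h'.reg xRes = k) ∨ (h'.reg xStop = 1 ∧ Failed n h')))
    (by rw [hres₁]; exact ⟨hc₁, by simpa using htrip₁, .inl ⟨hstop₁, rfl⟩⟩) (by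
      rintro k hk h' - - ⟨i1, i2, i3⟩
      refine eval_cycleStep (k := k) (by omega) hN ?_ i2 ?_
      · exact i1.congr rfl rfl
      · exact i3.imp_right fun h => ⟨h.1, h.2.congr rfl rfl rfl⟩)
  set h₂ := (Cmd.forEach xTry cycleStep).eval n h₁ with hh₂
  have hdeg₂ : h₂.reg xDeg = h₁.reg xDeg := Cmd.eval_reg _ rfl
  set D := h₁.reg xDeg with hDdef
  set r := h₂.reg xRes with hrdef
  set h₃ := computeK.eval n h₂ with hh₃
  have hres₃ : h₃.reg xRes = r := Cmd.eval_reg _ rfl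
  have hK₃ : h₃.reg xK = if D < 3 * r then 0 else (D - 3 * r) / (r + 1) + 1 := by
    rw [hh₃, computeK]
    split_ifs with hlt
    · rw [Cmd.eval_ite_pos (by simpa [Test.Holds, Exp.eval, hdeg₂, i2] using hlt)]
      simp [Cmd.eval_assign, Exp.eval]
    · rw [Cmd.eval_ite_neg (by simpa [Test.Holds, Exp.eval, hdeg₂, i2] using hlt)]
      simp [Cmd.eval_assign, Exp.eval, hdeg₂, i2, hrdef]
  have a₃ : h₃.arr arrAdj = h₂.arr arrAdj := Cmd.eval_arr _ rfl
  have hc₃ : CyclesFound n N h₃ r := i1.congr a₃ (Cmd.eval_arr _ rfl)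
  refine ⟨D, r, h₃.reg xK, ?_, ?_, hD, hD', ?_, hK₃, fun i hi hiK => ?_⟩
  · rw [Cmd.eval_reg _ rfl, hres₃]
  · rw [Cmd.eval_reg _ rfl]
  · exact hc₃.congr (Cmd.eval_arr _ rfl) (Cmd.eval_arr _ rfl)
  · have hDn : D ≤ n := (hD 0 (by omega)).trans (Nat.count_le _)
    have hlt : ¬ D < 3 * r := by
      intro hlt
      rw [hK₃, if_pos hlt] at hiK
      omega
    rw [if_neg hlt] at hK₃
    rcases i3 with ⟨-, i3⟩ | ⟨-, hF⟩
    · -- If all searches had been successful, then `r = n` and `D < 3 * r`.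
      omega
    · exact (hF.congr a₃ (Cmd.eval_arr _ rfl) (Cmd.eval_reg _ rfl)).eval_certificate hn hN hc₃ hD
        (by omega) hK₃ hi hiK

end Correctness

/-! ### The final state -/

variable {n : ℕ} {G : SimpleGraph (Fin n)}

lemma input_arr (u v : Fin n) : (input G).arr arrAdj (n * u + v) ≤ 1 ∧
    ((input G).arr arrAdj (n * u + v) = 1 ↔ G.Adj u v) := by
  have h : (∃ i j : Fin n, n * (u : ℕ) + v = n * i + j ∧ G.Adj i j) ↔ G.Adj u v := by
    constructor
    · rintro ⟨i, j, hij, hadj⟩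
      obtain ⟨h1, h2⟩ := (address_inj v.2 j.2).1 hij
      rwa [Fin.ext h1, Fin.ext h2]
    · exact fun h => ⟨u, v, rfl, h⟩
  by_cases hadj : G.Adj u v <;> simp [input, h, hadj]

lemma adj₁_input {u v : ℕ} (hu : u < n) (hv : v < n) :
    Adj₁ n (input G) u v ↔ G.Adj ⟨u, hu⟩ ⟨v, hv⟩ := (input_arr ⟨u, hu⟩ ⟨v, hv⟩).2

open Classical in
lemma count_adj₁_input [DecidableRel G.Adj] (u : Fin n) :
    Nat.count (Adj₁ n (input G) u) n = G.degree u := by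
  rw [← card_filter_fin, ← SimpleGraph.card_neighborFinset_eq_degree]
  congr 1
  ext v
  simp only [Finset.mem_filter, Finset.mem_univ, true_and, SimpleGraph.mem_neighborFinset]
  exact adj₁_input u.2 v.2

lemma boundedBy_input (hn : 1 ≤ n) : (input G).BoundedBy n where
  reg x := by
    simp only [input]
    split_ifs <;> omega
  arr a p := by
    simp only [input]
    split_ifs <;> omega

/-- The rows of the array of cycles list Hamilton cycles of the graph. -/
lemma CyclesFound.exists_cycles {h : State} {r : ℕ} (hn : 3 ≤ n)
    (hc : CyclesFound n (Adj₁ n (input G)) h r) :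
    ∃ (b : Fin r → Fin n) (H : (i : Fin r) → G.Walk (b i) (b i)),
      (∀ i, (H i).IsHamiltonianCycle) ∧
      (∀ i j, i ≠ j → List.Disjoint (H i).edges (H j).edges) ∧
      (∀ i : Fin r, h.ListsCycle arrCyc (i : ℕ) (H i)) := by
  have hmod : ∀ j, j % n < n := fun j => Nat.mod_lt _ (by omega)
  let x (i : Fin r) (j : ℕ) : Fin n := ⟨h.cycle n i (j % n), (hc.perm i i.2).lt _ (hmod j)⟩
  have hcyc : ∀ (i : Fin r) (j : ℕ), CycEdge n (h.cycle n i) n (x i j) (x i (j + 1)) := by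
    intro i j
    refine ⟨(j + 1) % n, hmod _, .inl ⟨?_, rfl⟩⟩
    have : predPos n ((j + 1) % n) = j % n := by
      unfold predPos
      have h1 := hmod j
      rw [Nat.add_mod, Nat.mod_eq_of_lt (show 1 < n by omega)]
      rcases Nat.lt_or_ge (j % n + 1) n with h2 | h2
      · rw [Nat.mod_eq_of_lt h2, if_neg (by omega)]
        omega
      · rw [show j % n + 1 = n by omega, Nat.mod_self, if_pos rfl]
        omega
    rw [this]
  have hx : ∀ i j, G.Adj (x i j) (x i (j + 1)) := by
    intro i j
    have h1 := hc.edges i i.2 _ (x i j).2 _ (x i (j + 1)).2 (hcyc i j)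
    refine (adj₁_input (x i j).2 (x i (j + 1)).2).1
      ((hc.adj _ (x i j).2 _ (x i (j + 1)).2).1 ?_)
    unfold Adj₀
    omega
  have key := fun i : Fin r => exists_isHamiltonianCycle (G := G) hn (Fintype.card_fin n)
    (x i) (hx i) (by simp [x]) (fun a ha b hb hab => by
      have := congrArg Fin.val hab
      simp only [x, Nat.mod_eq_of_lt ha, Nat.mod_eq_of_lt hb] at this
      exact (hc.perm i i.2).inj a ha b hb this)
  choose H hH hvert hedge using key
  refine ⟨fun i => x i 0, H, hH, fun i j hij e hei hej => ?_, fun i j => ?_⟩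
  · obtain ⟨a, -, rfl⟩ := hedge i e hei
    obtain ⟨b, -, hb⟩ := hedge j _ hej
    refine hc.disjoint i i.2 j j.2 (fun h => hij (Fin.ext h)) _ (x i a).2 _ (x i (a + 1)).2
      (hcyc i a) ?_
    rcases Sym2.eq_iff.1 hb with ⟨h1, h2⟩ | ⟨h1, h2⟩
    · rw [h1, h2]
      exact hcyc j b
    · rw [h1, h2]
      exact (hcyc j b).symm
  · rw [hvert i j j.2]
    simp [x, State.cycle, Nat.mod_eq_of_lt j.2]

end RAM

/-- There are a program `P` and constants `c`, `C` such that on every graph `G` with `n ≥ 3`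
vertices, `P` halts within `C * n ^ 4` steps, on words of at most `c * log₂ n` bits, with
`r` in register `0`, with `r` pairwise edge-disjoint Hamilton cycles of `G` in the first `r` rows
of array `1`, and with a certificate that the bipartite-hole-number of `G` is at least some
`k > (δ(G) - 3 r) / (r + 1)`, where `k` is in register `1` and the sets of the certificate are in
the arrays `2` and `3`. -/
theorem mainTheorem4 :
    ∃ (P : RAM.Prog) (c C : ℕ), ∀ (n : ℕ), 3 ≤ n →
      ∀ (G : SimpleGraph (Fin n)) [DecidableRel G.Adj],
        ∃ (s : RAM.State) (t r k : ℕ),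
          RAM.Exec (n ^ c) P (RAM.input G) s t ∧ t ≤ C * n ^ 4 ∧
          s.reg 0 = r ∧ s.reg 1 = k ∧
          (∃ (b : Fin r → Fin n) (H : (i : Fin r) → G.Walk (b i) (b i)),
            (∀ i, (H i).IsHamiltonianCycle) ∧
            (∀ i j, i ≠ j → List.Disjoint (H i).edges (H j).edges) ∧
            (∀ i : Fin r, s.ListsCycle 1 (i : ℕ) (H i))) ∧
          IsHoleCertificate G k (s.vertexSet n 2) (s.vertexSet n 3) ∧
          ((G.minDegree : ℚ) - 3 * r) / (r + 1) < k ∧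
          ((G.minDegree : ℚ) - 3 * r) / (r + 1) < bipartiteHoleNumber G := by
  obtain ⟨P, c, C, hP⟩ := RAM.algorithm.exists_prog (m := 4) 1 (by decide)
  refine ⟨P, c, C, fun n hn G _ => ?_⟩
  obtain ⟨s, t, hexec, ht, h0, h1, harr⟩ := hP n hn (RAM.input G)
    (RAM.boundedBy_input (by omega)) (by simp [RAM.input]) (by simp +contextual [RAM.input])
  have hin := fun u v : Fin n => RAM.input_arr (G := G) u v
  obtain ⟨D, r, K, hr, hK, hD, hD', hc, hKD, hcert⟩ := RAM.eval_algorithm (n := n)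
    (h := RAM.input G) (by omega) (fun u hu v hv => (hin ⟨u, hu⟩ ⟨v, hv⟩).1)
    (fun u hu v hv => by
      have h2 := hin ⟨u, hu⟩ ⟨v, hv⟩
      have h3 := hin ⟨v, hv⟩ ⟨u, hu⟩
      rw [G.adj_comm] at h3
      have h4 := h2.2.trans h3.2.symm
      have h5 := h2.1
      have h6 := h3.1
      simp only at h4 h5 h6
      omega)
    (fun u hu => by
      have h2 := hin ⟨u, hu⟩ ⟨u, hu⟩
      have h3 := mt h2.2.1 (G.irrefl)
      have h4 := h2.1
      simp only at h3 h4
      omega)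
  have hrow : ∀ a i, s.vertexSet n a i = Finset.univ.filter fun v : Fin n =>
      (RAM.algorithm.eval n (RAM.input G)).arr a (n * i + v) = 1 := fun a i => by
    rw [RAM.State.vertexSet, harr]
  have hholes : IsHoleCertificate G K (s.vertexSet n 2) (s.vertexSet n 3) := by
    intro i hi hiK
    obtain ⟨c1, c2, c3⟩ := hcert i hi hiK
    rw [hrow, hrow]
    refine ⟨?_, ?_, ?_, ?_⟩
    · rw [Finset.disjoint_left]
      intro u hu hu'
      exact (c3 u u.2 (Finset.mem_filter.1 hu).2 u u.2 (Finset.mem_filter.1 hu').2).1 rfl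
    · exact (card_filter_fin _).trans c1
    · exact (card_filter_fin _).trans c2
    · intro u hu v hv huv
      exact (c3 u u.2 (Finset.mem_filter.1 hu).2 v v.2 (Finset.mem_filter.1 hv).2).2
        ((RAM.adj₁_input u.2 v.2).2 huv)
  have hδ : G.minDegree ≤ D := by
    have : Nonempty (Fin n) := ⟨⟨0, by omega⟩⟩
    rcases hD' with rfl | ⟨u, hu, rfl⟩
    · have := G.minDegree_lt_card
      rw [Fintype.card_fin] at this
      exact this.le
    · rw [RAM.count_adj₁_input ⟨u, hu⟩]
      exact G.minDegree_le_degree _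
  have hlt : ((G.minDegree : ℚ) - 3 * r) / (r + 1) < K := by
    have hδ' : (G.minDegree : ℚ) ≤ D := by exact_mod_cast hδ
    have hr1 : (0 : ℚ) < r + 1 := by positivity
    rw [div_lt_iff₀ hr1]
    split_ifs at hKD with h3
    · have h4 : (D : ℚ) < 3 * r := by exact_mod_cast h3
      rw [hKD]
      push_cast
      linarith
    · have h4 := Nat.lt_mul_div_succ (D - 3 * r) (show 0 < r + 1 by omega)
      rw [← hKD] at h4
      have h5 : D < 3 * r + (r + 1) * K := by omega
      have h6 : (D : ℚ) < 3 * r + (r + 1) * K := by exact_mod_cast h5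
      linarith
  have hne : Nonempty (Fin n) := ⟨⟨0, by omega⟩⟩
  refine ⟨s, t, r, K, hexec, ht, h0.trans hr, h1.trans hK, ?_, hholes, hlt, hlt.trans_le ?_⟩
  · obtain ⟨b, H, hH, hdisj, hlist⟩ := hc.exists_cycles hn
    refine ⟨b, H, hH, hdisj, fun i j => ?_⟩
    rw [harr]
    exact hlist i j
  · exact_mod_cast hholes.le_bipartiteHoleNumber
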